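/- For integers $n\ge 2$ let $d=d(n)\ge 1$ and $p=p(n)$ be integers with $d<n^{1/2}$, put $N=\binom{n}{d}$, and suppose $N/p\to\gamma\in(0,\infty)$ as $n\to\infty$. For each $n$ let $x_1,\dots,x_n$ be i.i.d. real random variables whose common law may depend on $n$, such that $x_1\overset{d}{=}-x_1$, $\mathbb{E}[x_1^2]=1$, and for some $C=C(n)\ge 2$, $$\mathbb{E}[x_1^{2k}]\le (Ck)^k\quad(k\in\mathbb{N}),\qquad \lim_{n\to\infty}\frac{\log C(n)}{\log\left(n^{1/2}/d(n)\right)}=0 .$$ Let $Z_0\in\mathbb{R}^N$ be the random vector with entries $x_{i_1}x_{i_2}\cdots x_{i_d}$, indexed by $1\le i_1<\dots<i_d\le n$. Let $T=T(n)\in\mathbb{R}^{N\times N}$ be deterministic, symmetric, positive semidefinite matrices with $\sup_n\|T(n)\|<\infty$ (operator norm), whose empirical spectral distributions (mass $1/N$ at each eigenvalue, counted with multiplicity) converge weakly to a deterministic probability measure $H$ on $\mathbb{R}$. Let $\tilde Z=\tilde Z(n)\in\mathbb{R}^{N\times p}$, $n\ge2$, be random matrices on a common probability space such that, for each $n$,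 the columns of $\tilde Z(n)$ are i.i.d. with the law of $T^{1/2}Z_0$ (no assumption is made on the dependence between different $n$). Then there is a (deterministic) probability measure $\mu$ on $\mathbb{R}$ such that, almost surely, the empirical spectral distribution of $\tilde S=\frac1p\tilde Z\tilde Z^T$ converges weakly to $\mu$ as $n\to\infty$. Moreover, the Stieltjes transform $m(z)=\int_{\mathbb{R}}\frac{1}{z-t}\,d\mu(t)$ satisfies $$m(z)=\int_{\mathbb{R}}\frac{1}{z-t\left(1-\gamma+\gamma z\,m(z)\right)}\,dH(t)\qquad\text{for all } z\in\mathbb{C}\text{ with } \operatorname{Im} z>0,$$ where the integrand on the right is defined for $H$-almost every $t$ and is $H$-integrable. -/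

import Mathlib

open MeasureTheory ProbabilityTheory Filter Topology
open scoped NNReal MatrixOrder

noncomputable section

/-- The `d`-element subsets `{i₁ < ⋯ < i_d}` of `{1, …, n}`, indexing the `N = n.choose d`
features of the random tensor product model. -/
abbrev TensorIndex (n d : ℕ) : Type := {s : Finset (Fin n) // s.card = d}

theorem card_tensorIndex (n d : ℕ) : Fintype.card (TensorIndex n d) = n.choose d := by
  simp [TensorIndex]

/-- The vector with entries `x_{i₁} x_{i₂} ⋯ x_{i_d}`, for `i₁ < ⋯ < i_d`. -/
def tensorVector {n : ℕ} (d : ℕ) (x : Fin n → ℝ) : TensorIndex n d → ℝ :=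
  fun s => ∏ i ∈ s.1, x i

/-- The law of the tensor vector of `n` i.i.d. real random variables with common law `ν`. -/
def tensorLaw (n d : ℕ) (ν : Measure ℝ) : Measure (TensorIndex n d → ℝ) :=
  (Measure.pi fun _ : Fin n => ν).map (tensorVector d)

/-- The law of `T^{1/2} Z₀`, where `Z₀` has law `tensorLaw n d ν`; for a positive semidefinite
`T`, `CFC.sqrt T` is its positive semidefinite square root. -/
def colouredTensorLaw {n d : ℕ} (ν : Measure ℝ)
    (T : Matrix (TensorIndex n d) (TensorIndex n d) ℝ) : Measure (TensorIndex n d → ℝ) :=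
  (tensorLaw n d ν).map fun v => (CFC.sqrt T).mulVec v

/-- The empirical spectral distribution of a real symmetric matrix, as a measure: mass
`1 / N` at each of its `N` eigenvalues, counted with multiplicity. -/
def esd {ι : Type*} [Fintype ι] [DecidableEq ι] {A : Matrix ι ι ℝ} (hA : A.IsHermitian) :
    FiniteMeasure ℝ :=
  (Fintype.card ι : ℝ≥0)⁻¹ • ∑ j, (diracProba (hA.eigenvalues j)).toFiniteMeasure

/-- The sample covariance matrix `(1 / p) Z Zᵀ` of a data matrix with `p` columns. -/
def sampleCov {ι : Type*} {p : ℕ} (Z : Matrix ι (Fin p) ℝ) : Matrix ι ι ℝ :=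
  (1 / (p : ℝ)) • (Z * Z.transpose)

theorem isHermitian_sampleCov {ι : Type*} {p : ℕ} (Z : Matrix ι (Fin p) ℝ) :
    (sampleCov Z).IsHermitian := by
  ext i j
  simp [sampleCov, Matrix.mul_apply, mul_comm]

/-- The Stieltjes transform `m(z) = ∫ 1 / (z - t) dμ(t)`. -/
def stieltjesTransform (μ : Measure ℝ) (z : ℂ) : ℂ := ∫ t : ℝ, 1 / (z - (t : ℂ)) ∂μ

end

/-! ### Stieltjes transforms: inversion, tightness and the continuity theorem -/

section StieltjesTransform

open scoped BoundedContinuousFunction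

/-! Write N for the number of features, S for the sample covariance matrix, R = (z - S)⁻¹ and m_n(z)
= N⁻¹ tr R, the Stieltjes transform of the empirical spectral distribution. The proof has three
ingredients.

Quadratic forms concentrate. The entries of Z₀ are orthonormal, and the products Z_s Z_t and Z_u Z_v
are uncorrelated unless the symmetric differences s ∆ t and u ∆ v agree. Counting such coincidences
bounds the row sums of the covariance kernel by N · `tensorErr`, so Schur's test bounds the variance
of the form with matrix B by N · `tensorErr` · ‖B‖_F², at most N² · `tensorErr` · ‖B‖²
(`integral_sq_tensor_quadratic_le`). The fourth moment is at most 4C², and the growth condition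
forces C d / √n → 0, so `tensorErr` → 0. This is packaged in `ConcentratedColumn`; the rest works
for any columns of that kind.

The trace solves the equation approximately. Removing column j is a rank one perturbation, so it
changes traces against R by O(1), however long the column is, and R x_j = β_j R_j x_j with R_j the
resolvent without column j. The average of the β_j is exactly 1 - N/p + (N/p) z m_n
(`companion_eq`). Let s be its mean and D = (z - sT)⁻¹. In tr(R - D) = tr(D(S - sT)R) each form x_jᵀ
R_j D x_j is close to tr(D T R), by concentration conditionally on the other columns and then by the
rank one bound. What remains is the fluctuation of m_n about its mean
(`norm_meanCovStieltjes_sub_le`). Resampling one column moves m_n by O(1/N), so McDiarmid gives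
tails exp(-cN²/p). As N ≥ n these are summable, and Borel–Cantelli gives almost sure convergence for
any coupling in n.

The limit exists. E m_n is bounded, and each limit point solves the self-consistent equation
together with the sign conditions Im s ≤ 0 and Im(s/z) ≤ 0. In the variable g = s/z the equation
reads z = 1/g + γ ∫ t/(1 - tg) dH; its imaginary part is a strict contraction estimate that excludes
a second solution (`IsCompanionSolution.unique`). Hence E m_n converges at each z. A first moment
bound gives tightness, and the continuity theorem produces μ. -/

theorem norm_one_div_sub_ofReal_le {z : ℂ} (hz : 0 < z.im) (t : ℝ) :
    ‖1 / (z - (t : ℂ))‖ ≤ 1 / z.im := by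
  rw [norm_div, norm_one]
  refine one_div_le_one_div_of_le hz ?_
  have := Complex.abs_im_le_norm (z - (t : ℂ))
  simp only [Complex.sub_im, Complex.ofReal_im, sub_zero] at this
  exact (le_abs_self _).trans this

theorem sub_ofReal_ne_zero {z : ℂ} (hz : 0 < z.im) (t : ℝ) : z - (t : ℂ) ≠ 0 := by
  intro h
  have := congrArg Complex.im h
  simp at this
  exact hz.ne' this

theorem continuous_one_div_sub_ofReal {z : ℂ} (hz : 0 < z.im) :
    Continuous fun t : ℝ => 1 / (z - (t : ℂ)) :=
  continuous_const.div (by fun_prop) (sub_ofReal_ne_zero hz)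

/-- The function `t ↦ 1 / (z - t)` as a bounded continuous function on the real line. -/
noncomputable def stieltjesKernel (z : ℂ) (hz : 0 < z.im) : ℝ →ᵇ ℂ :=
  BoundedContinuousFunction.ofNormedAddCommGroup (fun t : ℝ => 1 / (z - (t : ℂ)))
    (continuous_one_div_sub_ofReal hz) (1 / z.im) (norm_one_div_sub_ofReal_le hz)

theorem integrable_one_div_sub_ofReal (μ : Measure ℝ) [IsFiniteMeasure μ] {z : ℂ}
    (hz : 0 < z.im) : Integrable (fun t : ℝ => 1 / (z - (t : ℂ))) μ :=
  (stieltjesKernel z hz).integrable μ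

theorem tendsto_stieltjesTransform {ι : Type*} {l : Filter ι} {μs : ι → FiniteMeasure ℝ}
    {μ : FiniteMeasure ℝ} (h : Tendsto μs l (𝓝 μ)) {z : ℂ} (hz : 0 < z.im) :
    Tendsto (fun i => stieltjesTransform (μs i) z) l (𝓝 (stieltjesTransform μ z)) :=
  (FiniteMeasure.tendsto_iff_forall_integral_rclike_tendsto ℂ).1 h (stieltjesKernel z hz)

theorem continuous_stieltjesTransform_horizontal (μ : Measure ℝ) [IsFiniteMeasure μ] {y : ℝ}
    (hy : 0 < y) : Continuous fun x : ℝ => stieltjesTransform μ (x + y * Complex.I) := by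
  refine continuous_of_dominated (bound := fun _ => 1 / y) (fun x => ?_) (fun x => ?_)
    (integrable_const _) ?_
  · exact (continuous_one_div_sub_ofReal (by simpa using hy)).aestronglyMeasurable
  · refine Eventually.of_forall fun t => ?_
    have := norm_one_div_sub_ofReal_le (z := x + y * Complex.I) (by simpa using hy) t
    simpa using this
  · refine Eventually.of_forall fun t => ?_
    refine continuous_const.div (by fun_prop) fun x => sub_ofReal_ne_zero (by simpa using hy) t

theorem im_one_div_sub_ofReal (x y t : ℝ) :
    (1 / ((x : ℂ) + y * Complex.I - t)).im = -(y / ((x - t) ^ 2 + y ^ 2)) := by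
  simp [Complex.normSq_apply]
  ring

theorem integral_comp_mul_cauchy (f : ℝ → ℝ) {y : ℝ} (hy : 0 < y) (t : ℝ) :
    ∫ u, f (t + y * u) * (1 + u ^ 2)⁻¹ = ∫ x, f x * (y / ((x - t) ^ 2 + y ^ 2)) := by
  have h1 : ∀ u : ℝ, f (t + y * u) * (1 + u ^ 2)⁻¹
      = y * (fun w => (fun x => f x * (y / ((x - t) ^ 2 + y ^ 2))) (t + w)) (y * u) := by
    intro u
    have : (1 + u ^ 2) ≠ 0 := by positivity
    have h2 : (y * u) ^ 2 + y ^ 2 ≠ 0 := by positivity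
    simp only [add_sub_cancel_left]
    field_simp
    ring
  simp_rw [h1]
  rw [integral_const_mul, Measure.integral_comp_mul_left
    (fun w => (fun x => f x * (y / ((x - t) ^ 2 + y ^ 2))) (t + w)) y, integral_add_left_eq_self
    (fun x => f x * (y / ((x - t) ^ 2 + y ^ 2))) t, abs_of_pos (inv_pos.2 hy), smul_eq_mul,
    ← mul_assoc, mul_inv_cancel₀ hy.ne', one_mul]

/-- On the line of height y, -Im of the transform is the convolution of μ with the Poisson kernel.
Fubini moves the smoothing from μ onto the test function, after the substitution x = t + yu. This is
Stieltjes inversion before y → 0. -/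
theorem integral_poisson_stieltjesTransform (μ : Measure ℝ) [IsFiniteMeasure μ]
    (f : ℝ →ᵇ ℝ) {y : ℝ} (hy : 0 < y) :
    ∫ x, f x * -(stieltjesTransform μ (x + y * Complex.I)).im
      = ∫ t, ∫ u, f (t + y * u) * (1 + u ^ 2)⁻¹ ∂volume ∂μ := by
  have hk : ∀ x : ℝ, -(stieltjesTransform μ (x + y * Complex.I)).im
      = ∫ t, y / ((x - t) ^ 2 + y ^ 2) ∂μ := by
    intro x
    have h := integrable_one_div_sub_ofReal μ (z := x + y * Complex.I) (by simpa using hy)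
    have h2 : (stieltjesTransform μ (x + y * Complex.I)).im
        = ∫ t, (1 / ((x : ℂ) + y * Complex.I - (t : ℂ))).im ∂μ := by
      exact (integral_im h).symm
    rw [h2, ← integral_neg]
    simp only [im_one_div_sub_ofReal, neg_neg]
  have hc0 : ∀ x t : ℝ, 0 < (x - t) ^ 2 + y ^ 2 := fun x t => by positivity
  have hcont : Continuous (Function.uncurry fun (x t : ℝ) => f x * (y / ((x - t) ^ 2 + y ^ 2))) := by
    refine (f.continuous.comp continuous_fst).mul (continuous_const.div (by fun_prop) ?_)
    exact fun q => (hc0 q.1 q.2).ne'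
  have hint : ∀ t : ℝ, Integrable fun x : ℝ => y / ((x - t) ^ 2 + y ^ 2) := by
    intro t
    have h0 : Integrable fun x : ℝ => (1 + ((y⁻¹ * x)) ^ 2)⁻¹ :=
      integrable_inv_one_add_sq.comp_mul_left' (inv_ne_zero hy.ne')
    have h1 := (h0.comp_sub_right t).const_mul y⁻¹
    refine h1.congr (Eventually.of_forall fun x => ?_)
    have := hc0 x t
    have h3 : 1 + (y⁻¹ * (x - t)) ^ 2 ≠ 0 := by positivity
    simp only
    field_simp
    ring
  have hval : ∀ t : ℝ, ∫ x, y / ((x - t) ^ 2 + y ^ 2) = Real.pi := by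
    intro t
    have := integral_comp_mul_cauchy (fun _ => 1) hy t
    simp only [one_mul] at this
    rw [← this, integral_univ_inv_one_add_sq]
  have hprod : Integrable
      (Function.uncurry fun (x t : ℝ) => f x * (y / ((x - t) ^ 2 + y ^ 2))) (volume.prod μ) := by
    rw [integrable_prod_iff' hcont.aestronglyMeasurable]
    refine ⟨Eventually.of_forall fun t => ?_, ?_⟩
    · exact (hint t).bdd_mul f.continuous.aestronglyMeasurable
        (Eventually.of_forall fun x => f.norm_coe_le_norm x)
    · refine Integrable.mono' (integrable_const (‖f‖ * Real.pi)) ?_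
        (Eventually.of_forall fun t => ?_)
      · exact hcont.norm.aestronglyMeasurable.prod_swap.integral_prod_right'
      · rw [Real.norm_of_nonneg (integral_nonneg fun x => norm_nonneg _)]
        rw [← hval t, ← integral_const_mul]
        refine integral_mono_of_nonneg (Eventually.of_forall fun x => norm_nonneg _)
          ((hint t).const_mul _) (Eventually.of_forall fun x => ?_)
        simp only [Function.uncurry, norm_mul]
        rw [Real.norm_of_nonneg (div_nonneg hy.le (hc0 x t).le)]
        exact mul_le_mul_of_nonneg_right (f.norm_coe_le_norm x) (div_nonneg hy.le (hc0 x t).le)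
  simp_rw [hk, ← integral_const_mul]
  rw [integral_integral_swap hprod]
  simp_rw [integral_comp_mul_cauchy (fun x => f x) hy]

/-- Dominated convergence twice, as the height 1/(k+1) shrinks; π is the mass of the unnormalized
Cauchy density. -/
theorem tendsto_integral_cauchy_smoothing (μ : Measure ℝ) [IsFiniteMeasure μ] (f : ℝ →ᵇ ℝ) :
    Tendsto (fun k : ℕ => ∫ t, ∫ u, f (t + 1 / ((k : ℝ) + 1) * u) * (1 + u ^ 2)⁻¹ ∂volume ∂μ)
      atTop (𝓝 (Real.pi * ∫ t, f t ∂μ)) := by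
  have hbound : ∀ x u : ℝ, ‖f x * (1 + u ^ 2)⁻¹‖ ≤ ‖f‖ * (1 + u ^ 2)⁻¹ := by
    intro x u
    have h1 : (0 : ℝ) ≤ (1 + u ^ 2)⁻¹ := by positivity
    rw [norm_mul, Real.norm_of_nonneg h1]
    exact mul_le_mul_of_nonneg_right (f.norm_coe_le_norm x) h1
  have hinv : Continuous fun u : ℝ => (1 + u ^ 2)⁻¹ :=
    Continuous.inv₀ (by fun_prop) fun u => by positivity
  have hI : Integrable fun u : ℝ => ‖f‖ * (1 + u ^ 2)⁻¹ := integrable_inv_one_add_sq.const_mul _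
  have hlim : ∫ t, ∫ u, f t * (1 + u ^ 2)⁻¹ ∂volume ∂μ = Real.pi * ∫ t, f t ∂μ := by
    simp_rw [integral_const_mul, integral_univ_inv_one_add_sq]
    rw [integral_mul_const, mul_comm]
  rw [← hlim]
  refine tendsto_integral_of_dominated_convergence
    (fun _ => ∫ u, ‖f‖ * (1 + u ^ 2)⁻¹) (fun k => ?_) (integrable_const _) (fun k => ?_) ?_
  · refine AEStronglyMeasurable.integral_prod_right' (f := fun q : ℝ × ℝ =>
      f (q.1 + 1 / ((k : ℝ) + 1) * q.2) * (1 + q.2 ^ 2)⁻¹) ?_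
    exact ((f.continuous.comp (by fun_prop)).mul (hinv.comp continuous_snd)).aestronglyMeasurable
  · exact Eventually.of_forall fun t => norm_integral_le_of_norm_le hI
      (Eventually.of_forall fun u => hbound _ u)
  · refine Eventually.of_forall fun t => ?_
    refine tendsto_integral_of_dominated_convergence _ (fun k => ?_) hI
      (fun k => Eventually.of_forall fun u => hbound _ u) (Eventually.of_forall fun u => ?_)
    · exact ((f.continuous.comp (by fun_prop)).mul hinv).aestronglyMeasurable
    · refine Tendsto.mul_const _ ((f.continuous.tendsto t).comp ?_)
      have := (tendsto_one_div_add_atTop_nhds_zero_nat (𝕜 := ℝ)).mul_const u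
      simpa using this.const_add t

/-- A finite measure on the line is determined by its Stieltjes transform on the points of the
upper half plane with rational coordinates. -/
theorem measure_eq_of_stieltjesTransform_eq {μ ν : Measure ℝ} [IsFiniteMeasure μ]
    [IsFiniteMeasure ν]
    (h : ∀ q r : ℚ, 0 < r → stieltjesTransform μ ((q : ℝ) + (r : ℝ) * Complex.I)
      = stieltjesTransform ν ((q : ℝ) + (r : ℝ) * Complex.I)) : μ = ν := by
  refine ext_of_forall_integral_eq_of_IsFiniteMeasure fun f => ?_
  have key : ∀ k : ℕ, ∫ t, ∫ u, f (t + 1 / ((k : ℝ) + 1) * u) * (1 + u ^ 2)⁻¹ ∂volume ∂μ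
      = ∫ t, ∫ u, f (t + 1 / ((k : ℝ) + 1) * u) * (1 + u ^ 2)⁻¹ ∂volume ∂ν := by
    intro k
    have hy : (0 : ℝ) < 1 / ((k : ℝ) + 1) := by positivity
    rw [← integral_poisson_stieltjesTransform μ f hy, ← integral_poisson_stieltjesTransform ν f hy]
    -- The height 1/(k+1) is rational, so the hypothesis covers a dense set of abscissae on this
    -- line, and continuity along the line does the rest.
    have : (fun x : ℝ => stieltjesTransform μ (x + (1 / ((k : ℝ) + 1) : ℝ) * Complex.I))
        = fun x : ℝ => stieltjesTransform ν (x + (1 / ((k : ℝ) + 1) : ℝ) * Complex.I) := by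
      refine Continuous.ext_on (s := Set.range ((↑) : ℚ → ℝ)) Rat.denseRange_cast
        (continuous_stieltjesTransform_horizontal μ hy)
        (continuous_stieltjesTransform_horizontal ν hy) ?_
      rintro _ ⟨q, rfl⟩
      have := h q (1 / ((k : ℚ) + 1)) (by positivity)
      simpa using this
    refine integral_congr_ae (Eventually.of_forall fun x => ?_)
    have := congrFun this x
    simp only at this ⊢
    rw [this]
  have h1 := tendsto_integral_cauchy_smoothing μ f
  have h2 := tendsto_integral_cauchy_smoothing ν f
  simp_rw [key] at h1
  exact mul_left_cancel₀ Real.pi_ne_zero (tendsto_nhds_unique h1 h2)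

theorem re_one_sub_mul_one_div_sub (k t : ℝ) (hk : 0 < k) :
    (1 - (k * Complex.I) * (1 / (k * Complex.I - t))).re = t ^ 2 / (k ^ 2 + t ^ 2) := by
  have h0 : t ^ 2 + k ^ 2 ≠ 0 := by positivity
  have h1 : (k * Complex.I - t : ℂ) ≠ 0 := by
    simpa using sub_ofReal_ne_zero (z := k * Complex.I) (by simpa using hk) t
  simp [Complex.normSq_apply]
  rw [show k ^ 2 + t ^ 2 = t * t + k * k by ring]
  have h2 : t * t + k * k ≠ 0 := by convert h0 using 1; ring
  field_simp
  ring

/-- On the imaginary axis the defect 1 - z m(z) has as real part an average of t²/(k² + t²), a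
smooth substitute for the indicator of |t| > k. Tightness can therefore be read off the transform.
-/
theorem re_one_sub_mul_stieltjesTransform (μ : Measure ℝ) [IsProbabilityMeasure μ] {k : ℝ}
    (hk : 0 < k) :
    (1 - (k * Complex.I) * stieltjesTransform μ (k * Complex.I)).re
      = ∫ t, t ^ 2 / (k ^ 2 + t ^ 2) ∂μ := by
  have h := integrable_one_div_sub_ofReal μ (z := k * Complex.I) (by simpa using hk)
  have h1 : (1 : ℂ) - (k * Complex.I) * stieltjesTransform μ (k * Complex.I)
      = ∫ t, (1 - (k * Complex.I) * (1 / (k * Complex.I - (t : ℂ)))) ∂μ := by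
    rw [integral_sub (integrable_const _) (h.const_mul _), integral_const_mul]
    simp [stieltjesTransform]
  rw [h1]
  have h2 := integral_re ((integrable_const (1 : ℂ)).sub (h.const_mul (k * Complex.I)))
  simp only [Pi.sub_apply, RCLike.re_eq_complex_re] at h2
  rw [← h2]
  simp_rw [re_one_sub_mul_one_div_sub k _ hk]

/-- Markov's inequality: t²/(k² + t²) is at least 1/2 once |t| > k. -/
theorem measureReal_norm_gt_le (μ : Measure ℝ) [IsProbabilityMeasure μ] {k : ℝ} (hk : 0 < k) :
    μ.real {x | k < ‖x‖} ≤ 2 * (1 - (k * Complex.I) * stieltjesTransform μ (k * Complex.I)).re := by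
  rw [re_one_sub_mul_stieltjesTransform μ hk]
  have hpos : ∀ t : ℝ, 0 < k ^ 2 + t ^ 2 := fun t => by positivity
  have hcont : Continuous fun t : ℝ => t ^ 2 / (k ^ 2 + t ^ 2) :=
    Continuous.div (by fun_prop) (by fun_prop) fun t => (hpos t).ne'
  have hint : Integrable (fun t : ℝ => t ^ 2 / (k ^ 2 + t ^ 2)) μ := by
    refine Integrable.mono' (integrable_const 1) hcont.aestronglyMeasurable
      (Eventually.of_forall fun t => ?_)
    have := hpos t
    rw [Real.norm_of_nonneg (by positivity), div_le_one this]
    nlinarith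
  have h := mul_meas_ge_le_integral_of_nonneg (μ := μ)
    (Eventually.of_forall fun t : ℝ => (by positivity : 0 ≤ t ^ 2 / (k ^ 2 + t ^ 2))) hint (1 / 2)
  have hsub : {x : ℝ | k < ‖x‖} ⊆ {x | 1 / 2 ≤ x ^ 2 / (k ^ 2 + x ^ 2)} := by
    intro x hx
    simp only [Set.mem_ofPred_eq, Real.norm_eq_abs] at hx ⊢
    rw [le_div_iff₀ (hpos x)]
    nlinarith [sq_abs x]
  have := measureReal_mono (μ := μ) hsub
  linarith

/-- Continuity theorem for Stieltjes transforms: if they converge at the rational points of the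
upper half plane and no mass escapes, the measures converge weakly. -/
theorem exists_tendsto_of_tendsto_stieltjesTransform {μs : ℕ → ProbabilityMeasure ℝ} {m : ℂ → ℂ}
    (h : ∀ q r : ℚ, 0 < r → Tendsto
      (fun n => stieltjesTransform (μs n) ((q : ℝ) + (r : ℝ) * Complex.I)) atTop
      (𝓝 (m ((q : ℝ) + (r : ℝ) * Complex.I))))
    (hm : Tendsto (fun k : ℕ => (1 - (((k : ℝ) + 1 : ℝ) * Complex.I)
      * m (((k : ℝ) + 1 : ℝ) * Complex.I)).re) atTop (𝓝 0)) :
    ∃ μ : ProbabilityMeasure ℝ, Tendsto μs atTop (𝓝 μ) ∧ ∀ q r : ℚ, 0 < r →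
      stieltjesTransform μ ((q : ℝ) + (r : ℝ) * Complex.I)
        = m ((q : ℝ) + (r : ℝ) * Complex.I) := by
  have htight : IsTightMeasureSet {((μ : ProbabilityMeasure ℝ) : Measure ℝ) | μ ∈ Set.range μs} := by
    have : IsTightMeasureSet (Set.range fun n => (μs n : Measure ℝ)) := by
      refine isTightMeasureSet_range_of_tendsto_limsup_measure_norm_gt ?_
      rw [ENNReal.tendsto_atTop_zero]
      intro ε hε
      obtain ⟨δ, hδ0, hδ⟩ : ∃ δ : ℝ, 0 < δ ∧ ENNReal.ofReal δ ≤ ε := by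
        rcases eq_or_ne ε ⊤ with rfl | hε'
        · exact ⟨1, one_pos, le_top⟩
        · exact ⟨ε.toReal, ENNReal.toReal_pos hε.ne' hε', by rw [ENNReal.ofReal_toReal hε']⟩
      -- The target is δ/2 because the tail bound carries a factor 2.
      obtain ⟨k, hk⟩ := (hm.eventually (gt_mem_nhds (show (0 : ℝ) < δ / 2 by positivity))).exists
      refine ⟨(k : ℝ) + 1, fun r hr => ?_⟩
      refine le_trans ?_ hδ
      have h1 := h 0 ((k : ℚ) + 1) (by positivity)
      have h2 : Tendsto (fun n => (1 - (((k : ℝ) + 1 : ℝ) * Complex.I)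
          * stieltjesTransform (μs n) (((k : ℝ) + 1 : ℝ) * Complex.I)).re) atTop
          (𝓝 ((1 - (((k : ℝ) + 1 : ℝ) * Complex.I) * m (((k : ℝ) + 1 : ℝ) * Complex.I)).re)) := by
        refine (Complex.continuous_re.tendsto _).comp (tendsto_const_nhds.sub
          (tendsto_const_nhds.mul ?_))
        simpa using h1
      have h3 := h2.eventually (gt_mem_nhds hk)
      refine limsup_le_of_le (by isBoundedDefault) ?_
      filter_upwards [h3] with n hn
      have h4 := measureReal_norm_gt_le (μs n : Measure ℝ) (k := (k : ℝ) + 1) (by positivity)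
      have h5 : (μs n : Measure ℝ) {x | r < ‖x‖} ≤ (μs n : Measure ℝ) {x | (k : ℝ) + 1 < ‖x‖} :=
        measure_mono fun x hx => lt_of_le_of_lt hr hx
      refine h5.trans ?_
      rw [← ENNReal.ofReal_toReal (measure_ne_top (μs n : Measure ℝ) _)]
      exact ENNReal.ofReal_le_ofReal (by simp only [Measure.real] at h4; linarith)
    convert this using 1
    ext μ
    simp
  have hcomp := isCompact_closure_of_isTightMeasureSet htight
  have hmem : ∀ n, μs n ∈ closure (Set.range μs) := fun n => subset_closure ⟨n, rfl⟩
  -- Every subsequential limit has the prescribed transform at the rational points, so all of them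
  -- coincide; with relative compactness this gives convergence of the full sequence.
  have hlimval : ∀ (μ : ProbabilityMeasure ℝ) (φ : ℕ → ℕ), Tendsto φ atTop atTop →
      Tendsto (μs ∘ φ) atTop (𝓝 μ) → ∀ q r : ℚ, 0 < r →
      stieltjesTransform μ ((q : ℝ) + (r : ℝ) * Complex.I)
        = m ((q : ℝ) + (r : ℝ) * Complex.I) := by
    intro μ φ hφ hμ q r hr
    have h1 := tendsto_stieltjesTransform
      ((ProbabilityMeasure.tendsto_nhds_iff_toFiniteMeasure_tendsto_nhds _).1 hμ)
      (z := (q : ℝ) + (r : ℝ) * Complex.I) (by simpa using hr)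
    exact tendsto_nhds_unique h1 ((h q r hr).comp hφ)
  obtain ⟨μ, -, φ, hφ, hμ⟩ := hcomp.tendsto_subseq hmem
  refine ⟨μ, ?_, hlimval μ φ hφ.tendsto_atTop hμ⟩
  refine tendsto_of_subseq_tendsto fun ns hns => ?_
  obtain ⟨μ', -, ψ, hψ, hμ'⟩ := hcomp.tendsto_subseq fun n => hmem (ns n)
  refine ⟨ψ, ?_⟩
  have h1 := hlimval μ φ hφ.tendsto_atTop hμ
  have h2 := hlimval μ' (ns ∘ ψ) (hns.comp hψ.tendsto_atTop) hμ'
  have : μ' = μ := by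
    apply Subtype.ext
    exact measure_eq_of_stieltjesTransform_eq (μ := (μ' : Measure ℝ)) (ν := (μ : Measure ℝ)) fun q r hr => (h2 q r hr).trans (h1 q r hr).symm
  rw [← this]
  exact hμ'

end StieltjesTransform

/-! ### McDiarmid's bounded difference inequality -/

section BoundedDifferences

variable {E : Type*} [MeasurableSpace E]

/-- Resampling one coordinate of an i.i.d. vector does not change its law. -/
theorem measurePreserving_update_pi {ι : Type*} [Fintype ι] [DecidableEq ι] (L : Measure E)
    [IsProbabilityMeasure L] (j : ι) :
    MeasurePreserving (fun q : (ι → E) × E => Function.update q.1 j q.2)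
      ((Measure.pi fun _ : ι => L).prod L) (Measure.pi fun _ : ι => L) := by
  have hmeas : Measurable (fun q : (ι → E) × E => Function.update q.1 j q.2) := by
    refine measurable_pi_lambda _ fun i => ?_
    by_cases h : i = j
    · subst h; simpa using measurable_snd
    · simp only [Function.update_of_ne h]
      exact (measurable_pi_apply i).comp measurable_fst
  refine ⟨hmeas, (Measure.pi_eq fun s hs => ?_).symm⟩
  rw [Measure.map_apply hmeas (MeasurableSet.univ_pi hs)]
  have : (fun q : (ι → E) × E => Function.update q.1 j q.2) ⁻¹' Set.univ.pi s
      = (Set.univ.pi (Function.update s j Set.univ)) ×ˢ s j := by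
    ext q
    simp only [Set.mem_preimage, Set.mem_pi, Set.mem_univ, true_implies, Set.mem_prod]
    constructor
    · intro h
      refine ⟨fun i => ?_, by simpa using h j⟩
      by_cases hi : i = j
      · subst hi; simp
      · simpa [hi] using h i
    · rintro ⟨h1, h2⟩ i
      by_cases hi : i = j
      · subst hi; simpa using h2
      · simpa [hi] using h1 i
  rw [this, Measure.prod_prod, Measure.pi_pi, ← Finset.mul_prod_erase _ _ (Finset.mem_univ j),
    ← Finset.mul_prod_erase Finset.univ (fun i => L (s i)) (Finset.mem_univ j)]
  simp only [Function.update_self, measure_univ, one_mul]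
  rw [mul_comm]
  congr 1
  refine Finset.prod_congr rfl fun i hi => ?_
  rw [Function.update_of_ne (Finset.ne_of_mem_erase hi)]

/-- This serves as conditioning on all columns but the `j`-th: in the inner integral the other
coordinates are frozen. -/
theorem integral_pi_eq_integral_update {ι : Type*} [Fintype ι] [DecidableEq ι] (L : Measure E)
    [IsProbabilityMeasure L] (j : ι) {f : (ι → E) → ℝ}
    (hf : Integrable f (Measure.pi fun _ : ι => L)) :
    ∫ x, f x ∂(Measure.pi fun _ : ι => L)
      = ∫ x, ∫ v, f (Function.update x j v) ∂L ∂(Measure.pi fun _ : ι => L) := by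
  have hmp := measurePreserving_update_pi L j
  have h1 : ∫ x, f x ∂(Measure.pi fun _ : ι => L)
      = ∫ q, f (Function.update q.1 j q.2) ∂((Measure.pi fun _ : ι => L).prod L) := by
    conv_lhs => rw [← hmp.map_eq]
    rw [integral_map hmp.measurable.aemeasurable]
    rw [hmp.map_eq]; exact hf.aestronglyMeasurable
  rw [h1, integral_prod]
  exact hmp.integrable_comp_of_integrable hf

/-- Induction on the number of coordinates. Averaging out the first one leaves a function `g` of the
others with the same bounded differences, while the deviation from `g` lies in [-c, c] and
Hoeffding's lemma controls its exponential moment. The bound `B` provides integrability only. -/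
theorem integral_exp_le_of_bounded_differences (L : Measure E) [IsProbabilityMeasure L] {c B : ℝ}
    (t : ℝ) : ∀ (p : ℕ) (f : (Fin p → E) → ℝ), Measurable f → (∀ x, |f x| ≤ B) →
      (∀ x j v, |f (Function.update x j v) - f x| ≤ c) →
      ∫ x, Real.exp (t * (f x - ∫ y, f y ∂(Measure.pi fun _ => L))) ∂(Measure.pi fun _ => L)
        ≤ Real.exp (p * c ^ 2 * t ^ 2 / 2) := by
  intro p
  induction p with
  | zero =>
    intro f _ _ _
    have : ∀ x : Fin 0 → E, f x = f default := fun x => by rw [Subsingleton.elim x default]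
    simp_rw [this]
    simp
  | succ p ih =>
    intro f hf hB hc
    have hmp := measurePreserving_piFinSuccAbove (fun _ : Fin (p + 1) => L) 0
    have hmps := hmp.symm
    set e := (MeasurableEquiv.piFinSuccAbove (fun _ : Fin (p + 1) => E) 0).symm with he
    have hee : ∀ q, e q = Fin.cons q.1 q.2 := by
      intro q
      simp [he, MeasurableEquiv.piFinSuccAbove, Fin.insertNthEquiv]
    set P := (Measure.pi fun _ : Fin p => L) with hP
    let F : E × (Fin p → E) → ℝ := fun q => f (e q)
    have hF : Measurable F := hf.comp e.measurable
    have hFB : ∀ q, |F q| ≤ B := fun q => hB _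
    have hFI : Integrable F (L.prod P) :=
      Integrable.mono' (integrable_const B) hF.aestronglyMeasurable
        (Eventually.of_forall fun q => hFB q)
    let g : (Fin p → E) → ℝ := fun x => ∫ v, F (v, x) ∂L
    have hFI1 : ∀ x, Integrable (fun v => F (v, x)) L := fun x =>
      Integrable.mono' (integrable_const B) (hF.comp (by fun_prop)).aestronglyMeasurable
        (Eventually.of_forall fun q => hFB _)
    have hg : Measurable g :=
      (hF.stronglyMeasurable.integral_prod_left').measurable
    have hgB : ∀ x, |g x| ≤ B := fun x => by
      have := norm_integral_le_of_norm_le_const (μ := L) (f := fun v => F (v, x))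
        (Eventually.of_forall fun v => hFB (v, x))
      simpa using this
    have hgc : ∀ x j v, |g (Function.update x j v) - g x| ≤ c := by
      intro x j v
      simp only [g]
      rw [← integral_sub (hFI1 _) (hFI1 _)]
      have := norm_integral_le_of_norm_le_const (μ := L)
        (f := fun w => F (w, Function.update x j v) - F (w, x)) (C := c)
        (Eventually.of_forall fun w => by
          have := hc (Fin.cons w x) j.succ v
          rw [← Fin.cons_update] at this
          simpa [F, hee] using this)
      simpa using this
    have hEq : ∫ y, f y ∂(Measure.pi fun _ : Fin (p + 1) => L) = ∫ x, g x ∂P := by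
      rw [← hmps.integral_comp' (g := f)]
      exact integral_prod_symm F hFI
    set a := ∫ x, g x ∂P with ha
    rw [hEq]
    rw [← hmps.integral_comp' (g := fun x => Real.exp (t * (f x - a)))]
    have haB : |a| ≤ B := by
      have := norm_integral_le_of_norm_le_const (μ := P) (f := g) (C := B) (Eventually.of_forall hgB)
      simpa using this
    have hexpI : Integrable (fun q => Real.exp (t * (F q - a))) (L.prod P) := by
      refine Integrable.mono' (integrable_const (Real.exp (|t| * (B + B))))
        (by fun_prop) (Eventually.of_forall fun q => ?_)
      rw [Real.norm_of_nonneg (Real.exp_nonneg _)]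
      refine Real.exp_le_exp.2 ((le_abs_self _).trans ?_)
      rw [abs_mul]
      refine mul_le_mul_of_nonneg_left ((abs_sub _ _).trans (add_le_add (hFB q) haB)) (abs_nonneg _)
    have hexpG : Integrable (fun x => Real.exp (t * (g x - a))) P := by
      refine Integrable.mono' (integrable_const (Real.exp (|t| * (B + B))))
        (by fun_prop) (Eventually.of_forall fun q => ?_)
      rw [Real.norm_of_nonneg (Real.exp_nonneg _)]
      refine Real.exp_le_exp.2 ((le_abs_self _).trans ?_)
      rw [abs_mul]
      refine mul_le_mul_of_nonneg_left ((abs_sub _ _).trans (add_le_add (hgB q) haB)) (abs_nonneg _)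
    have hinner : ∀ x, ∫ v, Real.exp (t * (F (v, x) - a)) ∂L
        ≤ Real.exp (c ^ 2 * t ^ 2 / 2) * Real.exp (t * (g x - a)) := by
      intro x
      have hdev : ∀ v, |F (v, x) - g x| ≤ c := by
        intro v
        have h1 : F (v, x) - g x = ∫ w, (F (v, x) - F (w, x)) ∂L := by
          rw [integral_sub (integrable_const _) (hFI1 x)]
          simp [g]
        rw [h1]
        have := norm_integral_le_of_norm_le_const (μ := L)
          (f := fun w => F (v, x) - F (w, x)) (C := c)
          (Eventually.of_forall fun w => by
            have := hc (Fin.cons w x) 0 v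
            rw [Fin.update_cons_zero] at this
            simpa [F, hee] using this)
        simpa using this
      have hsub := hasSubgaussianMGF_of_mem_Icc (μ := L) (X := fun v => F (v, x))
        (a := g x - c) (b := g x + c) (hF.comp (by fun_prop)).aemeasurable
        (Eventually.of_forall fun v => by
          have := abs_le.1 (hdev v)
          constructor <;> linarith)
      have h2 := hsub.mgf_le t
      -- The interval has length 2c, so Hoeffding's lemma yields the variance proxy c².
      have h3 : ((‖g x + c - (g x - c)‖₊ / 2) ^ 2 : ℝ≥0) = (c ^ 2 : ℝ) := by
        have : g x + c - (g x - c) = 2 * c := by ring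
        rw [this]
        push_cast
        rw [div_pow, Real.norm_eq_abs, sq_abs]
        ring
      rw [h3] at h2
      simp only [mgf] at h2
      have h4 : ∀ v, Real.exp (t * (F (v, x) - a))
          = Real.exp (t * (F (v, x) - g x)) * Real.exp (t * (g x - a)) := by
        intro v; rw [← Real.exp_add]; congr 1; ring
      simp_rw [h4]
      rw [integral_mul_const]
      exact mul_le_mul_of_nonneg_right h2 (Real.exp_nonneg _)
    calc ∫ q, Real.exp (t * (F q - a)) ∂(L.prod P)
        = ∫ x, ∫ v, Real.exp (t * (F (v, x) - a)) ∂L ∂P := integral_prod_symm _ hexpI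
      _ ≤ ∫ x, Real.exp (c ^ 2 * t ^ 2 / 2) * Real.exp (t * (g x - a)) ∂P :=
          integral_mono_of_nonneg
            (Eventually.of_forall fun x => integral_nonneg fun v => Real.exp_nonneg _)
            (hexpG.const_mul _) (Eventually.of_forall hinner)
      _ = Real.exp (c ^ 2 * t ^ 2 / 2) * ∫ x, Real.exp (t * (g x - a)) ∂P := integral_const_mul _ _
      _ ≤ Real.exp (c ^ 2 * t ^ 2 / 2) * Real.exp (p * c ^ 2 * t ^ 2 / 2) :=
          mul_le_mul_of_nonneg_left (ih g hg hgB hgc) (Real.exp_nonneg _)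
      _ = Real.exp ((p + 1 : ℕ) * c ^ 2 * t ^ 2 / 2) := by
          rw [← Real.exp_add]; congr 1; push_cast; ring

/-- McDiarmid's inequality. -/
theorem measureReal_abs_sub_integral_ge_le (L : Measure E) [IsProbabilityMeasure L] {c B ε : ℝ}
    {p : ℕ} (hε : 0 < ε) {f : (Fin p → E) → ℝ} (hf : Measurable f)
    (hB : ∀ x, |f x| ≤ B) (hc : ∀ x j v, |f (Function.update x j v) - f x| ≤ c) :
    (Measure.pi fun _ => L).real {x | ε ≤ |f x - ∫ y, f y ∂(Measure.pi fun _ => L)|}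
      ≤ 2 * Real.exp (-ε ^ 2 / (2 * p * c ^ 2)) := by
  set P := (Measure.pi fun _ : Fin p => L)
  set a := ∫ y, f y ∂P
  have hsub : HasSubgaussianMGF (fun x => f x - a) (Real.toNNReal (p * c ^ 2)) P := by
    refine ⟨fun t => ?_, fun t => ?_⟩
    · refine Integrable.mono' (integrable_const (Real.exp (|t| * (B + |a|))))
        (by fun_prop) (Eventually.of_forall fun q => ?_)
      rw [Real.norm_of_nonneg (Real.exp_nonneg _)]
      refine Real.exp_le_exp.2 ((le_abs_self _).trans ?_)
      rw [abs_mul]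
      exact mul_le_mul_of_nonneg_left ((abs_sub _ _).trans (by linarith [hB q])) (abs_nonneg _)
    · rw [Real.coe_toNNReal _ (by positivity)]
      exact integral_exp_le_of_bounded_differences L t p f hf hB hc
  have h1 := hsub.measure_ge_le hε.le
  have h2 := hsub.neg.measure_ge_le hε.le
  have hcov : {x | ε ≤ |f x - a|} ⊆ {x | ε ≤ f x - a} ∪ {x | ε ≤ (-fun x => f x - a) x} := by
    intro x hx
    rcases le_abs.1 (show ε ≤ |f x - a| from hx) with h | h
    · exact Or.inl h
    · exact Or.inr h
  have h3 := (measureReal_mono (μ := P) hcov).trans (measureReal_union_le _ _)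
  rw [Real.coe_toNNReal _ (by positivity), ← mul_assoc] at h1 h2
  linarith

end BoundedDifferences

/-! ### Mixed moments of the tensor vector and the variance of its quadratic forms -/

section TensorMoments

open scoped symmDiff

/-! ### Counting supersets -/

/-- Factor by factor this is (d - k)/(n - k) ≤ d/n; truncated subtraction makes the case d ≤ k
trivial. -/
theorem descFactorial_mul_pow_le {d n : ℕ} (hdn : d ≤ n) (k : ℕ) :
    d.descFactorial k * n ^ k ≤ n.descFactorial k * d ^ k := by
  induction k with
  | zero => simp
  | succ k ih =>
    rw [Nat.descFactorial_succ, Nat.descFactorial_succ, pow_succ, pow_succ]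
    have h : (d - k) * n ≤ (n - k) * d := by
      rcases le_total d k with h | h
      · simp [Nat.sub_eq_zero_of_le h]
      · zify [h, h.trans hdn]
        have h1 : (d : ℤ) ≤ n := by exact_mod_cast hdn
        have h2 : (0 : ℤ) ≤ k := by positivity
        nlinarith
    calc (d - k) * d.descFactorial k * (n ^ k * n)
        = (d.descFactorial k * n ^ k) * ((d - k) * n) := by ring
      _ ≤ (n.descFactorial k * d ^ k) * ((n - k) * d) := Nat.mul_le_mul ih h
      _ = _ := by ring

/-- A uniform random d-subset of n points contains a given set of size k with probability
C(d,k)/C(n,k), which is at most (d/n)^k: sampling without replacement is dominated by independent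
inclusion. -/
theorem card_superset_le {n d : ℕ} (hn : 0 < n) (hdn : d ≤ n) (e : Finset (Fin n)) :
    ((Finset.univ.filter fun u : TensorIndex n d => e ⊆ u.1).card : ℝ)
      ≤ n.choose d * ((d : ℝ) / n) ^ e.card := by
  set k := e.card with hk
  rcases lt_or_ge d k with hdk | hkd
  · rw [Finset.filter_false_of_mem]
    · simp; positivity
    · intro u _ h
      have := Finset.card_le_card h
      rw [u.2] at this
      omega
  have h1 : (Finset.univ.filter fun u : TensorIndex n d => e ⊆ u.1).card
      ≤ ((Finset.univ \ e).powersetCard (d - k)).card := by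
    refine Finset.card_le_card_of_injOn (fun u => u.1 \ e) ?_ ?_
    · intro u hu
      have hu' : e ⊆ u.1 := by simpa using hu
      refine Finset.mem_coe.2 (Finset.mem_powersetCard.2 ⟨Finset.sdiff_subset_sdiff (Finset.subset_univ _) le_rfl, ?_⟩)
      rw [Finset.card_sdiff_of_subset hu', u.2]
    · intro u hu v hv h
      have hu' : e ⊆ u.1 := by simpa using hu
      have hv' : e ⊆ v.1 := by simpa using hv
      apply Subtype.ext
      rw [← Finset.sdiff_union_of_subset hu', ← Finset.sdiff_union_of_subset hv']
      simp only at h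
      rw [h]
  rw [Finset.card_powersetCard, Finset.card_sdiff_of_subset (Finset.subset_univ _),
    Finset.card_univ, Fintype.card_fin] at h1
  have h2 : n.choose d * d.choose k = n.choose k * (n - k).choose (d - k) :=
    Nat.choose_mul hkd
  have h3 := descFactorial_mul_pow_le hdn k
  rw [Nat.descFactorial_eq_factorial_mul_choose, Nat.descFactorial_eq_factorial_mul_choose,
    mul_assoc, mul_assoc] at h3
  have h3 := Nat.le_of_mul_le_mul_left h3 (Nat.factorial_pos k)
  have hck : 0 < n.choose k := Nat.choose_pos (hkd.trans hdn)
  have h4 : (n - k).choose (d - k) * n ^ k ≤ n.choose d * d ^ k := by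
    refine Nat.le_of_mul_le_mul_left ?_ hck
    calc n.choose k * ((n - k).choose (d - k) * n ^ k)
        = n.choose d * (d.choose k * n ^ k) := by rw [← mul_assoc, ← h2, mul_assoc]
      _ ≤ n.choose d * (n.choose k * d ^ k) := Nat.mul_le_mul_left _ h3
      _ = _ := by ring
  rw [div_pow, ← mul_div_assoc, le_div_iff₀ (by positivity)]
  have h5 := (Nat.mul_le_mul_right (n ^ k) h1).trans h4
  exact_mod_cast h5

theorem one_add_pow_card_eq_sum (x : ℝ) {n : ℕ} (a : Finset (Fin n)) :
    (1 + x) ^ a.card = ∑ w ∈ a.powerset, x ^ w.card := by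
  have := Finset.sum_pow_mul_eq_add_pow x 1 a
  simp only [one_pow, mul_one] at this
  rw [this, add_comm]

/-- Expand κ^|a ∩ u| as the sum of (κ - 1)^|w| over w ⊆ a ∩ u and count the u containing b ∪ w.
Disjointness makes |b ∪ w| = |b| + |w|, and the sum over w refolds by the binomial theorem; κ ≥ 1
keeps the weights nonnegative. -/
theorem sum_superset_pow_card_inter_le {n d : ℕ} (hn : 0 < n) (hdn : d ≤ n) {κ : ℝ}
    (hκ : 1 ≤ κ) {a b : Finset (Fin n)} (hab : Disjoint a b) :
    ∑ u ∈ Finset.univ.filter (fun u : TensorIndex n d => b ⊆ u.1), κ ^ (a ∩ u.1).card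
      ≤ n.choose d * ((d : ℝ) / n) ^ b.card * (1 + (κ - 1) * ((d : ℝ) / n)) ^ a.card := by
  have h1 : ∀ u : TensorIndex n d, κ ^ (a ∩ u.1).card
      = ∑ w ∈ a.powerset, if w ⊆ u.1 then (κ - 1) ^ w.card else 0 := by
    intro u
    conv_lhs => rw [show κ = 1 + (κ - 1) by ring, one_add_pow_card_eq_sum]
    rw [← Finset.sum_filter]
    refine Finset.sum_congr ?_ fun _ _ => rfl
    ext w
    simp only [Finset.mem_powerset, Finset.mem_filter, Finset.subset_inter_iff]
  simp_rw [h1]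
  rw [Finset.sum_comm, one_add_pow_card_eq_sum, Finset.mul_sum]
  refine Finset.sum_le_sum fun w hw => ?_
  have hwb : Disjoint w b := Finset.disjoint_of_subset_left (Finset.mem_powerset.1 hw) hab
  rw [← Finset.sum_filter, Finset.filter_filter, Finset.sum_const, nsmul_eq_mul]
  have h2 : (Finset.univ.filter fun u : TensorIndex n d => b ⊆ u.1 ∧ w ⊆ u.1)
      = Finset.univ.filter fun u : TensorIndex n d => b ∪ w ⊆ u.1 := by
    ext u; simp [Finset.union_subset_iff]
  rw [h2]
  have h3 := card_superset_le (d := d) hn hdn (b ∪ w)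
  rw [Finset.card_union_of_disjoint hwb.symm, pow_add] at h3
  have h4 : (0 : ℝ) ≤ (κ - 1) ^ w.card := pow_nonneg (by linarith) _
  refine (mul_le_mul_of_nonneg_right h3 h4).trans (le_of_eq ?_)
  rw [mul_pow]
  ring

/-! ### Mixed moments of the tensor vector -/

variable {n d : ℕ}

/-- The multiplicity of `i` in a finite set. -/
def finsetMult (s : Finset (Fin n)) (i : Fin n) : ℕ := if i ∈ s then 1 else 0

theorem tensorVector_eq_prod (x : Fin n → ℝ) (s : TensorIndex n d) :
    tensorVector d x s = ∏ i, x i ^ finsetMult s.1 i := by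
  simp [tensorVector, finsetMult, pow_ite]

/-- Hypotheses on the law of a single coordinate: symmetric, with unit variance and a finite
fourth moment. -/
structure IsSymmUnit (ν : Measure ℝ) : Prop where
  symm : ν.map (fun x => -x) = ν
  var : ∫ x, x ^ 2 ∂ν = 1
  int_four : Integrable (fun x : ℝ => x ^ 4) ν

variable {ν : Measure ℝ}

theorem IsSymmUnit.integrable_pow [IsProbabilityMeasure ν] (h : IsSymmUnit ν) {k : ℕ} (hk : k ≤ 4) :
    Integrable (fun x : ℝ => x ^ k) ν := by
  refine Integrable.mono' ((integrable_const 1).add h.int_four)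
    (by fun_prop) (Eventually.of_forall fun x => ?_)
  rw [norm_pow, Pi.add_apply, ← Even.pow_abs (by decide : Even 4) x, ← Real.norm_eq_abs]
  have h0 := norm_nonneg x
  rcases le_total ‖x‖ 1 with h1 | h1
  · have := pow_le_one₀ (n := k) h0 h1
    have : 0 ≤ ‖x‖ ^ 4 := by positivity
    linarith
  · have := pow_le_pow_right₀ h1 hk
    linarith

theorem IsSymmUnit.integral_odd (h : IsSymmUnit ν) {k : ℕ} (hk : Odd k) :
    ∫ x, x ^ k ∂ν = 0 := by
  have h1 : ∫ x, x ^ k ∂ν = ∫ x, (-x) ^ k ∂ν := by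
    conv_lhs => rw [← h.symm]
    rw [integral_map (by fun_prop) (by fun_prop)]
  simp_rw [hk.neg_pow] at h1
  rw [integral_neg] at h1
  linarith

variable [IsProbabilityMeasure ν]

theorem IsSymmUnit.one_le_fourth (h : IsSymmUnit ν) : 1 ≤ ∫ x, x ^ 4 ∂ν := by
  have h2 := h.integrable_pow (k := 2) (by norm_num)
  have h1 : 0 ≤ ∫ x, (x ^ 2 - 1) ^ 2 ∂ν := integral_nonneg fun x => sq_nonneg _
  have h3 : ∀ x : ℝ, (x ^ 2 - 1) ^ 2 = x ^ 4 - 2 * x ^ 2 + 1 := fun x => by ring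
  simp_rw [h3] at h1
  have h4 : Integrable (fun x : ℝ => x ^ 4 - 2 * x ^ 2) ν := h.int_four.sub (h2.const_mul 2)
  rw [integral_add h4 (integrable_const _),
    integral_sub h.int_four (h2.const_mul 2), integral_const_mul, h.var] at h1
  simp at h1
  linarith

theorem integrable_prod_pow (h : IsSymmUnit ν) {m : Fin n → ℕ} (hm : ∀ i, m i ≤ 4) :
    Integrable (fun x : Fin n → ℝ => ∏ i, x i ^ m i) (Measure.pi fun _ => ν) :=
  Integrable.fintype_prod (f := fun i (x : ℝ) => x ^ m i) fun i => h.integrable_pow (hm i)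

theorem integral_prod_pow (m : Fin n → ℕ) :
    ∫ x : Fin n → ℝ, ∏ i, x i ^ m i ∂(Measure.pi fun _ => ν) = ∏ i, ∫ x, x ^ m i ∂ν :=
  integral_fintype_prod_eq_prod (fun i (x : ℝ) => x ^ m i)

theorem tensorVector_mul_eq (x : Fin n → ℝ) (s t : TensorIndex n d) :
    tensorVector d x s * tensorVector d x t
      = ∏ i, x i ^ (finsetMult s.1 i + finsetMult t.1 i) := by
  simp only [tensorVector_eq_prod, ← Finset.prod_mul_distrib, ← pow_add]

theorem tensorVector_mul_mul_eq (x : Fin n → ℝ) (s t u v : TensorIndex n d) :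
    (tensorVector d x s * tensorVector d x t) * (tensorVector d x u * tensorVector d x v)
      = ∏ i, x i ^ ((finsetMult s.1 i + finsetMult t.1 i)
        + (finsetMult u.1 i + finsetMult v.1 i)) := by
  simp only [tensorVector_mul_eq, ← Finset.prod_mul_distrib, ← pow_add]

theorem finsetMult_le (s : Finset (Fin n)) (i : Fin n) : finsetMult s i ≤ 1 := by
  unfold finsetMult; split_ifs <;> simp

theorem integrable_tensorVector_mul (h : IsSymmUnit ν) (s t : TensorIndex n d) :
    Integrable (fun x => tensorVector d x s * tensorVector d x t)
      (Measure.pi fun _ : Fin n => ν) := by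
  simp_rw [tensorVector_mul_eq]
  refine integrable_prod_pow h fun i => ?_
  have := finsetMult_le s.1 i; have := finsetMult_le t.1 i
  omega

theorem integrable_tensorVector_mul_mul (h : IsSymmUnit ν) (s t u v : TensorIndex n d) :
    Integrable (fun x => (tensorVector d x s * tensorVector d x t)
      * (tensorVector d x u * tensorVector d x v)) (Measure.pi fun _ : Fin n => ν) := by
  simp_rw [tensorVector_mul_mul_eq]
  refine integrable_prod_pow h fun i => ?_
  have := finsetMult_le s.1 i; have := finsetMult_le t.1 i
  have := finsetMult_le u.1 i; have := finsetMult_le v.1 i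
  omega

theorem integral_tensorVector_mul (h : IsSymmUnit ν) (s t : TensorIndex n d) :
    ∫ x, tensorVector d x s * tensorVector d x t ∂(Measure.pi fun _ : Fin n => ν)
      = if s = t then 1 else 0 := by
  simp_rw [tensorVector_mul_eq]
  rw [integral_prod_pow]
  have h1 := h.integral_odd (k := 1) (by decide)
  split_ifs with hst
  · subst hst
    refine Finset.prod_eq_one fun i _ => ?_
    unfold finsetMult
    split_ifs
    · exact h.var
    · simp
  · obtain ⟨i, hi⟩ : ∃ i, ¬ (i ∈ s.1 ↔ i ∈ t.1) := by
      by_contra! hcon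
      exact hst (Subtype.ext (Finset.ext hcon))
    refine Finset.prod_eq_zero (Finset.mem_univ i) ?_
    by_cases hs : i ∈ s.1 <;> by_cases ht : i ∈ t.1 <;> simp [finsetMult, hs, ht] at hi ⊢
    all_goals simpa using h1

/-- By independence and symmetry the moment vanishes if some index has odd total multiplicity, and
all multiplicities are even exactly when the two symmetric differences agree. Then multiplicity 2
contributes the variance 1, and multiplicity 4, attained on the common intersection, contributes the
fourth moment. -/
theorem integral_tensorVector_mul_mul (h : IsSymmUnit ν) (s t u v : TensorIndex n d) :
    ∫ x, (tensorVector d x s * tensorVector d x t) * (tensorVector d x u * tensorVector d x v)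
      ∂(Measure.pi fun _ : Fin n => ν)
      = if s.1 ∆ t.1 = u.1 ∆ v.1 then (∫ x, x ^ 4 ∂ν) ^ (s.1 ∩ t.1 ∩ (u.1 ∩ v.1)).card else 0 := by
  simp_rw [tensorVector_mul_mul_eq]
  rw [integral_prod_pow]
  have h1 := h.integral_odd (k := 1) (by decide)
  have h3 := h.integral_odd (k := 3) (by decide)
  split_ifs with hst
  · rw [← Finset.prod_const, ← Finset.prod_filter_mul_prod_filter_not Finset.univ
      (fun i => i ∈ s.1 ∩ t.1 ∩ (u.1 ∩ v.1))]
    rw [Finset.prod_eq_one (s := Finset.univ.filter fun i => ¬ i ∈ s.1 ∩ t.1 ∩ (u.1 ∩ v.1)), mul_one]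
    · refine Finset.prod_congr (by ext; simp) fun i hi => ?_
      simp only [Finset.mem_inter] at hi
      simp [finsetMult, hi]
    · intro i hi
      have hiff : i ∈ s.1 ∆ t.1 ↔ i ∈ u.1 ∆ v.1 := by rw [hst]
      simp only [Finset.mem_symmDiff] at hiff
      simp only [Finset.mem_filter, Finset.mem_univ, true_and, Finset.mem_inter] at hi
      by_cases hs : i ∈ s.1 <;> by_cases ht : i ∈ t.1 <;> by_cases hu : i ∈ u.1 <;>
        by_cases hv : i ∈ v.1 <;> simp [finsetMult, hs, ht, hu, hv] at hi hiff ⊢ <;>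
        exact h.var
  · obtain ⟨i, hi⟩ : ∃ i, ¬ (i ∈ s.1 ∆ t.1 ↔ i ∈ u.1 ∆ v.1) := by
      by_contra! hcon
      exact hst (Finset.ext hcon)
    simp only [Finset.mem_symmDiff] at hi
    refine Finset.prod_eq_zero (Finset.mem_univ i) ?_
    by_cases hs : i ∈ s.1 <;> by_cases ht : i ∈ t.1 <;> by_cases hu : i ∈ u.1 <;>
      by_cases hv : i ∈ v.1 <;> simp [finsetMult, hs, ht, hu, hv] at hi ⊢ <;>
      first | exact h3 | simpa using h1

/-! ### Variance of quadratic forms -/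

/-- The covariance of `X_s X_t` and `X_u X_v`, where `κ` is the fourth moment of a coordinate. -/
noncomputable def tensorCov (κ : ℝ) (p q : TensorIndex n d × TensorIndex n d) : ℝ :=
  (if p.1.1 ∆ p.2.1 = q.1.1 ∆ q.2.1 then κ ^ (p.1.1 ∩ p.2.1 ∩ (q.1.1 ∩ q.2.1)).card else 0)
    - (if p.1 = p.2 then 1 else 0) * (if q.1 = q.2 then 1 else 0)

theorem tensorCov_comm (κ : ℝ) (p q : TensorIndex n d × TensorIndex n d) :
    tensorCov κ p q = tensorCov κ q p := by
  unfold tensorCov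
  rw [mul_comm, Finset.inter_comm (p.1.1 ∩ p.2.1)]
  simp only [eq_comm]

theorem tensorIndex_eq_iff_symmDiff (s t : TensorIndex n d) : s = t ↔ s.1 ∆ t.1 = ∅ := by
  rw [← Finset.bot_eq_empty, symmDiff_eq_bot, Subtype.ext_iff]

/-- Nonnegativity lets plain row sums, without absolute values, be used in Schur's test. A mean
product is subtracted only when both pairs are diagonal, and there the moment is a power of κ ≥ 1.
-/
theorem tensorCov_nonneg {κ : ℝ} (hκ : 1 ≤ κ) (p q : TensorIndex n d × TensorIndex n d) :
    0 ≤ tensorCov κ p q := by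
  unfold tensorCov
  have h1 : ∀ k : ℕ, 1 ≤ κ ^ k := fun k => one_le_pow₀ hκ
  by_cases hp : p.1 = p.2 <;> by_cases hq : q.1 = q.2
  · rw [if_pos]
    · simp [hp, hq, h1]
    · rw [(tensorIndex_eq_iff_symmDiff _ _).1 hp, (tensorIndex_eq_iff_symmDiff _ _).1 hq]
  all_goals
    simp only [hp, hq, if_true, if_false, mul_zero, zero_mul, sub_zero]
    split_ifs
    · exact zero_le_one.trans (h1 _)
    · exact le_rfl

/-- Relative size of the variance of quadratic forms in the tensor vector. -/
noncomputable def tensorErr (n d : ℕ) (κ : ℝ) : ℝ :=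
  ((1 + (κ - 1) * ((d : ℝ) / n)) ^ d - 1)
    + 2 * d * ((d : ℝ) / n) * (1 + (κ - 1) * ((d : ℝ) / n)) ^ d

/-- A diagonal pair correlates only with diagonal pairs (u, u), with covariance κ^|s ∩ u| - 1; the
superset bound with b empty sums this over u. -/
theorem sum_tensorCov_diag_le (hn : 0 < n) (hdn : d ≤ n) {κ : ℝ} (hκ : 1 ≤ κ)
    (s : TensorIndex n d) :
    ∑ q, tensorCov κ (s, s) q ≤ n.choose d * ((1 + (κ - 1) * ((d : ℝ) / n)) ^ d - 1) := by
  have h1 : ∀ u v : TensorIndex n d, tensorCov κ (s, s) (u, v)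
      = if u = v then κ ^ (s.1 ∩ u.1).card - 1 else 0 := by
    intro u v
    unfold tensorCov
    simp only [symmDiff_self, Finset.inter_self, if_true, one_mul]
    by_cases h : u = v
    · subst h; simp
    · have h' : ¬ (⊥ : Finset (Fin n)) = u.1 ∆ v.1 := fun h' =>
        h ((tensorIndex_eq_iff_symmDiff u v).2 h'.symm)
      simp only [h, h', if_false, sub_zero]
  rw [Fintype.sum_prod_type]
  simp_rw [h1]
  simp only [Finset.sum_ite_eq, Finset.mem_univ, if_true, Finset.sum_sub_distrib]
  have h2 := sum_superset_pow_card_inter_le (d := d) hn hdn hκ (Finset.disjoint_empty_right s.1)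
  simp only [Finset.empty_subset, Finset.filter_true, Finset.card_empty, pow_zero, mul_one,
    s.2] at h2
  rw [Finset.sum_const, Finset.card_univ, card_tensorIndex, nsmul_eq_mul, mul_one, mul_sub, mul_one]
  linarith

/-- Put w = s ∆ t. Given u, at most one v satisfies u ∆ v = w. Moreover u must meet w: otherwise u ⊆
v, equality of cardinalities gives u = v, and w is empty. A union bound over the at most 2d points i
of w, each lying in u at a cost d/n, gives the prefactor. -/
theorem sum_tensorCov_offDiag_le (hn : 0 < n) (hdn : d ≤ n) {κ : ℝ} (hκ : 1 ≤ κ)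
    {s t : TensorIndex n d} (hst : s ≠ t) :
    ∑ q, tensorCov κ (s, t) q ≤ n.choose d *
      (2 * d * ((d : ℝ) / n) * (1 + (κ - 1) * ((d : ℝ) / n)) ^ d) := by
  set w := s.1 ∆ t.1 with hw
  have hbase : 1 ≤ 1 + (κ - 1) * ((d : ℝ) / n) :=
    le_add_of_nonneg_right (mul_nonneg (by linarith) (by positivity))
  have hκ0 : 0 ≤ κ := zero_le_one.trans hκ
  have hrow : ∀ u : TensorIndex n d, ∑ v, tensorCov κ (s, t) (u, v)
      ≤ ∑ i ∈ w, if i ∈ u.1 then κ ^ ((s.1 ∩ t.1) ∩ u.1).card else 0 := by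
    intro u
    have hnn : 0 ≤ ∑ i ∈ w, if i ∈ u.1 then κ ^ ((s.1 ∩ t.1) ∩ u.1).card else 0 :=
      Finset.sum_nonneg fun i _ => by split_ifs <;> positivity
    have hterm : ∀ v : TensorIndex n d, tensorCov κ (s, t) (u, v)
        = if w = u.1 ∆ v.1 then κ ^ (s.1 ∩ t.1 ∩ (u.1 ∩ v.1)).card else 0 := by
      intro v
      unfold tensorCov
      simp [hst, ← hw]
    simp_rw [hterm]
    by_cases hex : ∃ v0 : TensorIndex n d, w = u.1 ∆ v0.1
    · obtain ⟨v0, hv0⟩ := hex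
      have huniq : ∀ v : TensorIndex n d, w = u.1 ∆ v.1 → v = v0 := by
        intro v hv
        exact Subtype.ext (symmDiff_right_injective u.1 (hv.symm.trans hv0))
      rw [Finset.sum_eq_single v0 (fun v _ hv => if_neg fun h => hv (huniq v h))
        (fun h => absurd (Finset.mem_univ _) h), if_pos hv0]
      obtain ⟨i, hi, hiu⟩ : ∃ i ∈ w, i ∈ u.1 := by
        by_contra! hcon
        have hsub : u.1 ⊆ v0.1 := by
          intro i hi
          by_contra hiv
          exact hcon i (by rw [hv0, Finset.mem_symmDiff]; exact Or.inl ⟨hi, hiv⟩) hi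
        have heq := Finset.eq_of_subset_of_card_le hsub (by rw [u.2, v0.2])
        rw [heq, symmDiff_self] at hv0
        exact hst ((tensorIndex_eq_iff_symmDiff s t).2 hv0)
      have h1 := Finset.single_le_sum (s := w)
        (f := fun i => if i ∈ u.1 then κ ^ ((s.1 ∩ t.1) ∩ u.1).card else 0)
        (fun i _ => by split_ifs <;> positivity) hi
      simp only [hiu, if_true] at h1
      refine le_trans (pow_le_pow_right₀ hκ (Finset.card_le_card ?_)) h1
      exact Finset.inter_subset_inter le_rfl Finset.inter_subset_left
    · push Not at hex
      rw [Finset.sum_eq_zero fun v _ => if_neg (hex v)]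
      exact hnn
  rw [Fintype.sum_prod_type]
  refine (Finset.sum_le_sum fun u _ => hrow u).trans ?_
  rw [Finset.sum_comm]
  have hi : ∀ i ∈ w, ∑ u : TensorIndex n d, (if i ∈ u.1 then κ ^ ((s.1 ∩ t.1) ∩ u.1).card else 0)
      ≤ n.choose d * ((d : ℝ) / n) * (1 + (κ - 1) * ((d : ℝ) / n)) ^ d := by
    intro i hi
    have hdisj : Disjoint (s.1 ∩ t.1) {i} := by
      rw [Finset.disjoint_singleton_right]
      intro h
      rw [hw, Finset.mem_symmDiff] at hi
      rw [Finset.mem_inter] at h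
      tauto
    have h2 := sum_superset_pow_card_inter_le (d := d) hn hdn hκ hdisj
    simp only [Finset.singleton_subset_iff, Finset.card_singleton, pow_one] at h2
    rw [← Finset.sum_filter]
    refine h2.trans (mul_le_mul_of_nonneg_left (pow_le_pow_right₀ hbase ?_) (by positivity))
    exact (Finset.card_le_card Finset.inter_subset_left).trans s.2.le
  refine (Finset.sum_le_sum hi).trans ?_
  rw [Finset.sum_const, nsmul_eq_mul]
  have hcard : (w.card : ℝ) ≤ 2 * d := by
    have : w.card ≤ s.1.card + t.1.card := by
      refine (Finset.card_le_card (t := s.1 ∪ t.1) ?_).trans (Finset.card_union_le _ _)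
      exact symmDiff_le_sup
    rw [s.2, t.2] at this
    calc (w.card : ℝ) ≤ ((d + d : ℕ) : ℝ) := by exact_mod_cast this
      _ = 2 * d := by push_cast; ring
  refine (mul_le_mul_of_nonneg_right hcard (by positivity)).trans (le_of_eq (by ring))

theorem sum_tensorCov_le (hn : 0 < n) (hdn : d ≤ n) {κ : ℝ} (hκ : 1 ≤ κ)
    (p : TensorIndex n d × TensorIndex n d) :
    ∑ q, tensorCov κ p q ≤ n.choose d * tensorErr n d κ := by
  have hbase : 1 ≤ 1 + (κ - 1) * ((d : ℝ) / n) :=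
    le_add_of_nonneg_right (mul_nonneg (by linarith) (by positivity))
  have hpow : 1 ≤ (1 + (κ - 1) * ((d : ℝ) / n)) ^ d := one_le_pow₀ hbase
  unfold tensorErr
  obtain ⟨s, t⟩ := p
  rw [mul_add]
  by_cases h : s = t
  · subst h
    refine (sum_tensorCov_diag_le hn hdn hκ s).trans (le_add_of_nonneg_right ?_)
    positivity
  · refine (sum_tensorCov_offDiag_le hn hdn hκ h).trans (le_add_of_nonneg_left ?_)
    exact mul_nonneg (by positivity) (by linarith)

/-- Schur's test: bound b_p b_q by (b_p² + b_q²)/2 and use the symmetry of the kernel. -/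
theorem sum_mul_mul_le_sum_sq_mul {ι : Type*} [Fintype ι] (b : ι → ℝ) (V : ι → ι → ℝ) {e : ℝ}
    (hV0 : ∀ p q, 0 ≤ V p q) (hVs : ∀ p q, V p q = V q p) (hVe : ∀ p, ∑ q, V p q ≤ e) :
    ∑ p, ∑ q, b p * b q * V p q ≤ e * ∑ p, b p ^ 2 := by
  have h1 : ∑ p, ∑ q, b p * b q * V p q
      ≤ ∑ p, ∑ q, (b p ^ 2 * V p q / 2 + b q ^ 2 * V q p / 2) := by
    refine Finset.sum_le_sum fun p _ => Finset.sum_le_sum fun q _ => ?_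
    rw [hVs q p]
    have := hV0 p q
    nlinarith [mul_nonneg (sq_nonneg (b p - b q)) this]
  refine h1.trans ?_
  simp only [Finset.sum_add_distrib]
  rw [Finset.sum_comm (f := fun p q => b q ^ 2 * V q p / 2), ← Finset.sum_add_distrib,
    Finset.mul_sum]
  refine Finset.sum_le_sum fun p _ => ?_
  rw [← Finset.sum_add_distrib]
  have : ∀ q, b p ^ 2 * V p q / 2 + b p ^ 2 * V p q / 2 = b p ^ 2 * V p q := fun q => by ring
  simp_rw [this]
  rw [← Finset.mul_sum, mul_comm e]
  exact mul_le_mul_of_nonneg_left (hVe p) (sq_nonneg _)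

/-- Variance bound for quadratic forms in the tensor vector. -/
theorem integral_sq_tensor_quadratic_le (h : IsSymmUnit ν) (hn : 0 < n) (hdn : d ≤ n)
    (b : TensorIndex n d × TensorIndex n d → ℝ) :
    Integrable (fun x => (∑ p, b p * (tensorVector d x p.1 * tensorVector d x p.2
      - if p.1 = p.2 then 1 else 0)) ^ 2) (Measure.pi fun _ : Fin n => ν) ∧
    ∫ x, (∑ p, b p * (tensorVector d x p.1 * tensorVector d x p.2
      - if p.1 = p.2 then 1 else 0)) ^ 2 ∂(Measure.pi fun _ : Fin n => ν)
      ≤ n.choose d * tensorErr n d (∫ x, x ^ 4 ∂ν) * ∑ p, b p ^ 2 := by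
  set P := Measure.pi fun _ : Fin n => ν
  let Y : TensorIndex n d × TensorIndex n d → (Fin n → ℝ) → ℝ := fun p x =>
    tensorVector d x p.1 * tensorVector d x p.2
  let δ : TensorIndex n d × TensorIndex n d → ℝ := fun p => if p.1 = p.2 then 1 else 0
  have hY : ∀ p, Integrable (Y p) P := fun p => integrable_tensorVector_mul h p.1 p.2
  have hYY : ∀ p q, Integrable (fun x => Y p x * Y q x) P := fun p q =>
    integrable_tensorVector_mul_mul h p.1 p.2 q.1 q.2
  have hexp : ∀ p q x, (Y p x - δ p) * (Y q x - δ q)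
      = Y p x * Y q x - δ q * Y p x - δ p * Y q x + δ p * δ q := fun p q x => by ring
  have hI : ∀ p q, Integrable (fun x => (Y p x - δ p) * (Y q x - δ q)) P := by
    intro p q
    simp_rw [hexp]
    exact (((hYY p q).sub ((hY p).const_mul _)).sub ((hY q).const_mul _)).add (integrable_const _)
  have hE : ∀ p q, ∫ x, (Y p x - δ p) * (Y q x - δ q) ∂P = tensorCov (∫ x, x ^ 4 ∂ν) p q := by
    intro p q
    simp_rw [hexp]
    have h1 : Integrable (fun x => Y p x * Y q x - δ q * Y p x) P :=
      (hYY p q).sub ((hY p).const_mul _)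
    have h2 : Integrable (fun x => Y p x * Y q x - δ q * Y p x - δ p * Y q x) P :=
      h1.sub ((hY q).const_mul _)
    rw [integral_add h2 (integrable_const _), integral_sub h1 ((hY q).const_mul _),
      integral_sub (hYY p q) ((hY p).const_mul _), integral_const_mul, integral_const_mul]
    simp only [Y, P]
    rw [integral_tensorVector_mul_mul h, integral_tensorVector_mul h, integral_tensorVector_mul h]
    simp only [integral_const, probReal_univ, smul_eq_mul, one_mul, tensorCov, δ]
    ring
  have hsq : ∀ x, (∑ p, b p * (Y p x - δ p)) ^ 2
      = ∑ p, ∑ q, b p * b q * ((Y p x - δ p) * (Y q x - δ q)) := by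
    intro x
    rw [sq, Finset.sum_mul_sum]
    refine Finset.sum_congr rfl fun p _ => Finset.sum_congr rfl fun q _ => by ring
  change Integrable (fun x => (∑ p, b p * (Y p x - δ p)) ^ 2) P ∧
    ∫ x, (∑ p, b p * (Y p x - δ p)) ^ 2 ∂P ≤ _
  simp_rw [hsq]
  refine ⟨integrable_finsetSum _ fun p _ => integrable_finsetSum _ fun q _ =>
    (hI p q).const_mul _, ?_⟩
  rw [integral_finsetSum _ fun p _ => integrable_finsetSum _ fun q _ => (hI p q).const_mul _]
  have h2 : ∀ p, ∫ x, ∑ q, b p * b q * ((Y p x - δ p) * (Y q x - δ q)) ∂P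
      = ∑ q, b p * b q * tensorCov (∫ x, x ^ 4 ∂ν) p q := by
    intro p
    rw [integral_finsetSum _ fun q _ => (hI p q).const_mul _]
    refine Finset.sum_congr rfl fun q _ => ?_
    rw [integral_const_mul, hE]
  simp_rw [h2]
  have hκ := h.one_le_fourth
  exact sum_mul_mul_le_sum_sq_mul b _ (tensorCov_nonneg hκ) (tensorCov_comm _)
    (sum_tensorCov_le hn hdn hκ)

end TensorMoments

/-! ### Resolvents of positive semidefinite matrices and their rank one perturbations -/

section Resolvent

open Matrix
open scoped Matrix.Norms.L2Operator

variable {ι : Type*}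

section

variable [Fintype ι]

/-- The squared Euclidean norm of a complex vector. -/
noncomputable def normSqVec (u : ι → ℂ) : ℝ := ∑ i, ‖u i‖ ^ 2

theorem normSqVec_nonneg (u : ι → ℂ) : 0 ≤ normSqVec u :=
  Finset.sum_nonneg fun _ _ => by positivity

theorem normSqVec_eq_norm_sq (u : ι → ℂ) : normSqVec u = ‖WithLp.toLp 2 u‖ ^ 2 := by
  rw [EuclideanSpace.norm_sq_eq]
  rfl

theorem star_dotProduct_self (u : ι → ℂ) : star u ⬝ᵥ u = (normSqVec u : ℂ) := by
  simp only [dotProduct, Pi.star_apply, normSqVec, Complex.ofReal_sum]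
  refine Finset.sum_congr rfl fun i _ => ?_
  rw [RCLike.star_def, Complex.conj_mul']
  push_cast
  rfl

theorem norm_dotProduct_le (u v : ι → ℂ) :
    ‖u ⬝ᵥ v‖ ≤ ‖WithLp.toLp 2 u‖ * ‖WithLp.toLp 2 v‖ := by
  have h := norm_inner_le_norm (𝕜 := ℂ) (WithLp.toLp 2 (star u)) (WithLp.toLp 2 v)
  rw [EuclideanSpace.inner_toLp_toLp, star_star, dotProduct_comm] at h
  have h2 : ‖WithLp.toLp 2 (star u)‖ = ‖WithLp.toLp 2 u‖ := by
    simp [EuclideanSpace.norm_eq]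
  rwa [h2] at h

end

/-- The complex matrix with the same entries as a real matrix. -/
noncomputable abbrev complexify {κ : Type*} (A : Matrix ι κ ℝ) : Matrix ι κ ℂ :=
  A.map Complex.ofReal

theorem complexify_mul {κ l : Type*} [Fintype κ] (A : Matrix ι κ ℝ) (B : Matrix κ l ℝ) :
    complexify (A * B) = complexify A * complexify B :=
  Matrix.map_mul (f := Complex.ofRealHom)

theorem complexify_mulVec [Fintype ι] (A : Matrix ι ι ℝ) (v : ι → ℝ) :
    complexify A *ᵥ (fun i => (v i : ℂ)) = fun i => ((A *ᵥ v) i : ℂ) := by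
  ext i
  simp [mulVec, dotProduct]

theorem conjTranspose_complexify (A : Matrix ι ι ℝ) (hA : A.IsHermitian) :
    (complexify A)ᴴ = complexify A := by
  ext i j
  have := congrFun (congrFun hA i) j
  simp only [conjTranspose_apply, star_trivial] at this
  simp [this]

theorem transpose_complexify (A : Matrix ι ι ℝ) (hA : A.IsHermitian) :
    (complexify A)ᵀ = complexify A := by
  ext i j
  have := congrFun (congrFun hA i) j
  simp only [conjTranspose_apply, star_trivial] at this
  simp [this]

variable [Fintype ι]

theorem posSemidef_add_vecMulVec {A : Matrix ι ι ℝ} (hA : A.PosSemidef) {c : ℝ} (hc : 0 ≤ c)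
    (v : ι → ℝ) : (A + c • vecMulVec v v).PosSemidef := by
  refine hA.add (PosSemidef.smul ?_ hc)
  simpa using posSemidef_vecMulVec_self_star v

variable [DecidableEq ι]

theorem sqrt_mul_sqrt_of_posSemidef {A : Matrix ι ι ℝ} (hA : A.PosSemidef) :
    CFC.sqrt A * CFC.sqrt A = A :=
  CFC.sqrt_mul_sqrt_self A (nonneg_iff_posSemidef.2 hA)

theorem isHermitian_sqrt (A : Matrix ι ι ℝ) : (CFC.sqrt A).IsHermitian :=
  (nonneg_iff_posSemidef.1 (CFC.sqrt_nonneg A)).isHermitian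

theorem star_dotProduct_complexify {A : Matrix ι ι ℝ} (hA : A.PosSemidef) (u : ι → ℂ) :
    star u ⬝ᵥ complexify A *ᵥ u = (normSqVec (complexify (CFC.sqrt A) *ᵥ u) : ℂ) := by
  rw [← star_dotProduct_self, star_mulVec, conjTranspose_complexify _ (isHermitian_sqrt A),
    ← dotProduct_mulVec, mulVec_mulVec, ← complexify_mul, sqrt_mul_sqrt_of_posSemidef hA]

theorem normSqVec_mulVec_le (B : Matrix ι ι ℂ) (u : ι → ℂ) :
    normSqVec (B *ᵥ u) ≤ ‖B‖ ^ 2 * normSqVec u := by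
  have h := l2_opNorm_mulVec B (WithLp.toLp 2 u)
  rw [normSqVec_eq_norm_sq, normSqVec_eq_norm_sq, ← mul_pow]
  exact pow_le_pow_left₀ (norm_nonneg _) h 2

theorem norm_dotProduct_mulVec_le (B : Matrix ι ι ℂ) (u : ι → ℂ) :
    ‖u ⬝ᵥ B *ᵥ u‖ ≤ ‖B‖ * normSqVec u := by
  have h := l2_opNorm_mulVec B (WithLp.toLp 2 u)
  refine (norm_dotProduct_le _ _).trans ?_
  rw [normSqVec_eq_norm_sq]
  calc _ ≤ ‖WithLp.toLp 2 u‖ * (‖B‖ * ‖WithLp.toLp 2 u‖) :=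
        mul_le_mul_of_nonneg_left h (norm_nonneg _)
    _ = _ := by ring

theorem normSqVec_single (i : ι) : normSqVec (Pi.single i (1 : ℂ)) = 1 := by
  unfold normSqVec
  rw [Finset.sum_eq_single i]
  · simp
  · intro j _ hj
    simp [hj]
  · simp

theorem norm_trace_le (B : Matrix ι ι ℂ) : ‖B.trace‖ ≤ Fintype.card ι * ‖B‖ := by
  unfold trace
  refine (norm_sum_le _ _).trans ?_
  have : ∀ i ∈ Finset.univ, ‖B.diag i‖ ≤ ‖B‖ := by
    intro i _
    have h := norm_dotProduct_mulVec_le B (Pi.single i 1)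
    rw [normSqVec_single] at h
    simpa using h
  refine (Finset.sum_le_sum this).trans ?_
  simp

/-- Each column is the image of a basis vector, so its squared length is at most ‖B‖². This trades
the Frobenius norm of the variance bound for the operator norm. -/
theorem sum_sq_norm_entries_le (B : Matrix ι ι ℂ) :
    ∑ p : ι × ι, ‖B p.1 p.2‖ ^ 2 ≤ Fintype.card ι * ‖B‖ ^ 2 := by
  rw [Fintype.sum_prod_type_right]
  have : ∀ j ∈ Finset.univ, ∑ i, ‖B i j‖ ^ 2 ≤ ‖B‖ ^ 2 := by
    intro j _
    have h := normSqVec_mulVec_le B (Pi.single j 1)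
    rw [normSqVec_single] at h
    simpa [normSqVec] using h
  refine (Finset.sum_le_sum this).trans ?_
  simp

/-- A real matrix acts separately on the real and imaginary parts of a complex vector, so the real
norm bound applies to each part and the squares add. -/
theorem norm_complexify_le {A : Matrix ι ι ℝ} {K : ℝ} (hK : 0 ≤ K)
    (hA : ‖Matrix.toEuclideanCLM (𝕜 := ℝ) A‖ ≤ K) : ‖complexify A‖ ≤ K := by
  rw [l2_opNorm_def]
  refine ContinuousLinearMap.opNorm_le_bound _ hK fun u => ?_
  have hreal : ∀ a : ι → ℝ, ∑ i, ((A *ᵥ a) i) ^ 2 ≤ K ^ 2 * ∑ i, a i ^ 2 := by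
    intro a
    have h := ((toEuclideanCLM (𝕜 := ℝ) A).le_opNorm (WithLp.toLp 2 a)).trans
      (mul_le_mul_of_nonneg_right hA (norm_nonneg _))
    have h2 := pow_le_pow_left₀ (norm_nonneg _) h 2
    rw [mul_pow, EuclideanSpace.norm_sq_eq, EuclideanSpace.norm_sq_eq] at h2
    simpa using h2
  refine le_of_sq_le_sq ?_ (by positivity)
  have h1 := hreal fun i => (u i).re
  have h2 := hreal fun i => (u i).im
  have e1 : ∀ v : EuclideanSpace ℂ ι, ‖v‖ ^ 2 = ∑ i, ((v i).re ^ 2 + (v i).im ^ 2) := by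
    intro v
    rw [EuclideanSpace.norm_sq_eq]
    refine Finset.sum_congr rfl fun i _ => ?_
    rw [← Complex.normSq_eq_norm_sq, Complex.normSq_apply]
    ring
  rw [mul_pow, e1, e1]
  have e2 : ∀ i, ((complexify A *ᵥ u.ofLp) i).re = (A *ᵥ fun i => (u i).re) i := by
    intro i; simp [mulVec, dotProduct]
  have e3 : ∀ i, ((complexify A *ᵥ u.ofLp) i).im = (A *ᵥ fun i => (u i).im) i := by
    intro i; simp [mulVec, dotProduct]
  change ∑ i, (((complexify A *ᵥ u.ofLp) i).re ^ 2 + ((complexify A *ᵥ u.ofLp) i).im ^ 2) ≤ _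
  simp_rw [e2, e3, Finset.sum_add_distrib, mul_add]
  linarith

theorem norm_complexify_sqrt_sq {A : Matrix ι ι ℝ} (hA : A.PosSemidef) :
    ‖complexify (CFC.sqrt A)‖ * ‖complexify (CFC.sqrt A)‖ = ‖complexify A‖ := by
  rw [← l2_opNorm_conjTranspose_mul_self, conjTranspose_complexify _ (isHermitian_sqrt A),
    ← complexify_mul, sqrt_mul_sqrt_of_posSemidef hA]

/-- A matrix whose imaginary part is bounded below by `y > 0` is invertible, with inverse of
norm at most `1 / y`. -/
theorem isUnit_and_norm_inv_le {M : Matrix ι ι ℂ} {y : ℝ} (hy : 0 < y)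
    (hM : ∀ u, y * normSqVec u ≤ (star u ⬝ᵥ M *ᵥ u).im) : IsUnit M ∧ ‖M⁻¹‖ ≤ 1 / y := by
  have hunit : IsUnit M := by
    rw [← mulVec_injective_iff_isUnit]
    refine (injective_iff_map_eq_zero (M.mulVecLin)).2 fun u hu => ?_
    have hu' : M *ᵥ u = 0 := hu
    have h := hM u
    rw [hu', dotProduct_zero, Complex.zero_im, normSqVec_eq_norm_sq] at h
    have h1 : ‖WithLp.toLp 2 u‖ ^ 2 ≤ 0 := by
      by_contra! hcon
      have := mul_pos hy hcon
      linarith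
    have h2 : ‖WithLp.toLp 2 u‖ = 0 := by nlinarith [norm_nonneg (WithLp.toLp 2 u)]
    simpa using h2
  refine ⟨hunit, ?_⟩
  rw [l2_opNorm_def]
  refine ContinuousLinearMap.opNorm_le_bound _ (by positivity) fun v => ?_
  set u : ι → ℂ := M⁻¹ *ᵥ v.ofLp with hu
  change ‖WithLp.toLp 2 u‖ ≤ 1 / y * ‖v‖
  have hMu : M *ᵥ u = v.ofLp := by
    rw [hu, mulVec_mulVec, mul_nonsing_inv _ ((isUnit_iff_isUnit_det M).1 hunit), one_mulVec]
  have h := hM u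
  rw [hMu] at h
  have h1 := (h.trans (le_abs_self _)).trans (Complex.abs_im_le_norm _)
  have h2 := h1.trans (norm_dotProduct_le (star u) v.ofLp)
  have h3 : ‖WithLp.toLp 2 (star u)‖ = ‖WithLp.toLp 2 u‖ := by simp [EuclideanSpace.norm_eq]
  rw [h3, normSqVec_eq_norm_sq, WithLp.toLp_ofLp] at h2
  rcases (norm_nonneg (WithLp.toLp 2 u)).eq_or_lt with h0 | h0
  · rw [← h0]; positivity
  · rw [one_div, inv_mul_eq_div, le_div_iff₀ hy]
    have : ‖WithLp.toLp 2 u‖ * (‖WithLp.toLp 2 u‖ * y) ≤ ‖WithLp.toLp 2 u‖ * ‖v‖ := by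
      linarith
    exact le_of_mul_le_mul_left this h0

/-- The generalized resolvent `(z - s A)⁻¹` of a real matrix; `s = 1` gives the resolvent. -/
noncomputable def genResolvent (z s : ℂ) (A : Matrix ι ι ℝ) : Matrix ι ι ℂ :=
  (z • (1 : Matrix ι ι ℂ) - s • complexify A)⁻¹

section

variable {z s : ℂ} {A : Matrix ι ι ℝ}

theorem star_dotProduct_sub_mulVec (hA : A.PosSemidef) (u : ι → ℂ) :
    star u ⬝ᵥ (z • (1 : Matrix ι ι ℂ) - s • complexify A) *ᵥ u
      = z * normSqVec u - s * normSqVec (complexify (CFC.sqrt A) *ᵥ u) := by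
  rw [sub_mulVec, smul_mulVec, smul_mulVec, one_mulVec, dotProduct_sub, dotProduct_smul,
    dotProduct_smul, star_dotProduct_self, star_dotProduct_complexify hA, smul_eq_mul, smul_eq_mul]

/-- Im⟨u, (z - sA)u⟩ = Im z ‖u‖² - Im s ‖A^{1/2}u‖², and both terms have the good sign when Im s ≤
0. This is why the sign of Im s is tracked throughout. -/
theorem isUnit_and_norm_genResolvent_le (hz : 0 < z.im) (hs : s.im ≤ 0) (hA : A.PosSemidef) :
    IsUnit (z • (1 : Matrix ι ι ℂ) - s • complexify A) ∧ ‖genResolvent z s A‖ ≤ 1 / z.im := by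
  refine isUnit_and_norm_inv_le hz fun u => ?_
  rw [star_dotProduct_sub_mulVec hA]
  simp only [Complex.sub_im, Complex.mul_im, Complex.ofReal_re, Complex.ofReal_im, mul_zero,
    zero_add]
  have := normSqVec_nonneg (complexify (CFC.sqrt A) *ᵥ u)
  nlinarith

theorem mul_genResolvent (hz : 0 < z.im) (hs : s.im ≤ 0) (hA : A.PosSemidef) :
    (z • (1 : Matrix ι ι ℂ) - s • complexify A) * genResolvent z s A = 1 :=
  mul_nonsing_inv _ ((isUnit_iff_isUnit_det _).1 (isUnit_and_norm_genResolvent_le hz hs hA).1)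

theorem genResolvent_mul (hz : 0 < z.im) (hs : s.im ≤ 0) (hA : A.PosSemidef) :
    genResolvent z s A * (z • (1 : Matrix ι ι ℂ) - s • complexify A) = 1 :=
  nonsing_inv_mul _ ((isUnit_iff_isUnit_det _).1 (isUnit_and_norm_genResolvent_le hz hs hA).1)

theorem transpose_genResolvent (hA : A.IsHermitian) :
    (genResolvent z s A)ᵀ = genResolvent z s A := by
  unfold genResolvent
  rw [transpose_nonsing_inv, transpose_sub, transpose_smul, transpose_smul, transpose_one,
    transpose_complexify A hA]

theorem trace_genResolvent (hA : A.IsHermitian) (hne : ∀ j, z - s * hA.eigenvalues j ≠ 0) :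
    (genResolvent z s A).trace = ∑ j, 1 / (z - s * hA.eigenvalues j) := by
  set U : Matrix ι ι ℝ := (hA.eigenvectorUnitary : Matrix ι ι ℝ) with hU
  have hUU : U * star U = 1 := Unitary.mul_star_self_of_mem hA.eigenvectorUnitary.2
  have hUU' : star U * U = 1 := Unitary.star_mul_self_of_mem hA.eigenvectorUnitary.2
  have hC : complexify U * complexify (star U) = 1 := by
    rw [← complexify_mul, hUU]; simp [complexify]
  have hC' : complexify (star U) * complexify U = 1 := by
    rw [← complexify_mul, hUU']; simp [complexify]
  have hspec : complexify A = complexify U * diagonal (fun j => (hA.eigenvalues j : ℂ))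
      * complexify (star U) := by
    have h : A = U * diagonal hA.eigenvalues * star U := by
      have := hA.spectral_theorem
      rw [Unitary.conjStarAlgAut_apply] at this
      exact this
    conv_lhs => rw [h, complexify_mul, complexify_mul]
    congr 2
    simp [complexify, diagonal_map]
  have hdiag : z • (1 : Matrix ι ι ℂ) - s • complexify A
      = complexify U * diagonal (fun j => z - s * (hA.eigenvalues j : ℂ)) * complexify (star U) := by
    have h1 : diagonal (fun j => z - s * (hA.eigenvalues j : ℂ))
        = z • (1 : Matrix ι ι ℂ) - s • diagonal (fun j => (hA.eigenvalues j : ℂ)) := by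
      ext i j
      by_cases hij : i = j
      · subst hij; simp
      · simp [hij]
    rw [h1, hspec, Matrix.mul_sub, Matrix.sub_mul]
    simp [hC]
  have hinv : genResolvent z s A
      = complexify U * diagonal (fun j => 1 / (z - s * (hA.eigenvalues j : ℂ)))
        * complexify (star U) := by
    unfold genResolvent
    refine inv_eq_right_inv ?_
    rw [hdiag]
    calc _ = complexify U * (diagonal (fun j => z - s * (hA.eigenvalues j : ℂ))
          * (complexify (star U) * complexify U)
          * diagonal (fun j => 1 / (z - s * (hA.eigenvalues j : ℂ)))) * complexify (star U) := by
            simp only [Matrix.mul_assoc]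
      _ = 1 := by
        rw [hC', Matrix.mul_one, diagonal_mul_diagonal]
        have : (fun j => (z - s * (hA.eigenvalues j : ℂ)) * (1 / (z - s * (hA.eigenvalues j : ℂ))))
            = fun _ => 1 := by
          ext j
          rw [mul_one_div_cancel (hne j)]
        rw [this, diagonal_one, Matrix.mul_one, hC]
  rw [hinv, trace_mul_comm, ← Matrix.mul_assoc, hC', Matrix.one_mul, trace_diagonal]

theorem coe_esd (hA : A.IsHermitian) : (esd hA : Measure ℝ)
    = ((Fintype.card ι : ℝ≥0)⁻¹) • ∑ j, Measure.dirac (hA.eigenvalues j) := by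
  unfold esd
  rw [FiniteMeasure.toMeasure_smul, FiniteMeasure.toMeasure_sum]
  rfl

theorem integral_esd {E : Type*} [NormedAddCommGroup E] [NormedSpace ℝ E] [CompleteSpace E]
    (hA : A.IsHermitian) (f : ℝ → E) :
    ∫ t, f t ∂(esd hA : Measure ℝ)
      = ((Fintype.card ι : ℝ)⁻¹) • ∑ j, f (hA.eigenvalues j) := by
  rw [coe_esd, integral_smul_nnreal_measure, integral_finsetSum_measure]
  · simp only [integral_dirac]
    rw [NNReal.smul_def]
    simp
  · intro j _
    exact integrable_dirac (by simp)

theorem sub_mul_eigenvalue_ne_zero (hz : 0 < z.im) (hs : s.im ≤ 0) {t : ℝ} (ht : 0 ≤ t) :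
    z - s * t ≠ 0 := by
  intro h
  have := congrArg Complex.im h
  simp only [Complex.sub_im, Complex.mul_im, Complex.ofReal_re, Complex.ofReal_im, mul_zero,
    zero_add, Complex.zero_im] at this
  nlinarith

theorem integral_esd_one_div (hz : 0 < z.im) (hs : s.im ≤ 0) (hA : A.PosSemidef) :
    ∫ t : ℝ, 1 / (z - s * (t : ℂ)) ∂(esd hA.isHermitian : Measure ℝ)
      = (Fintype.card ι : ℂ)⁻¹ * (genResolvent z s A).trace := by
  rw [integral_esd, trace_genResolvent hA.isHermitian fun j =>
    sub_mul_eigenvalue_ne_zero hz hs (hA.eigenvalues_nonneg j), Complex.real_smul]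
  push_cast
  rfl

theorem stieltjesTransform_esd (hz : 0 < z.im) (hA : A.PosSemidef) :
    stieltjesTransform (esd hA.isHermitian) z
      = (Fintype.card ι : ℂ)⁻¹ * (genResolvent z 1 A).trace := by
  rw [← integral_esd_one_div hz (by simp) hA]
  simp [stieltjesTransform]

end

/-! ### Rank one perturbations -/

section RankOne

variable {z : ℂ} {A : Matrix ι ι ℝ}

/-- The quadratic form `vᵀ B v` of a complex matrix at a real vector. -/
noncomputable def realQuad (B : Matrix ι ι ℂ) (v : ι → ℝ) : ℂ :=
  (fun i => (v i : ℂ)) ⬝ᵥ B *ᵥ (fun i => (v i : ℂ))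

/-- With u = (z - A)⁻¹v and v real, the form vᵀu is the conjugate of ⟨u, v⟩ = ⟨u, (z - A)u⟩. The
later sign and size estimates on rank one factors are read off this expression. -/
theorem realQuad_genResolvent (hz : 0 < z.im) (hA : A.PosSemidef) (v : ι → ℝ) :
    realQuad (genResolvent z 1 A) v
      = (starRingEnd ℂ) z * normSqVec (genResolvent z 1 A *ᵥ fun i => (v i : ℂ))
        - normSqVec (complexify (CFC.sqrt A) *ᵥ (genResolvent z 1 A *ᵥ fun i => (v i : ℂ))) := by
  set w : ι → ℂ := fun i => (v i : ℂ) with hw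
  set u := genResolvent z 1 A *ᵥ w with hu
  have hMu : (z • (1 : Matrix ι ι ℂ) - (1 : ℂ) • complexify A) *ᵥ u = w := by
    rw [hu, mulVec_mulVec, mul_genResolvent hz (by simp) hA, one_mulVec]
  have h1 := star_dotProduct_sub_mulVec (z := z) (s := 1) hA u
  rw [hMu] at h1
  have h2 : realQuad (genResolvent z 1 A) v = star (star u ⬝ᵥ w) := by
    have hstar : star w = w := by ext i; simp [hw]
    rw [← star_dotProduct, hstar]
    rfl
  rw [h2, h1]
  simp

/-- The factor `1 / (1 - c vᵀ (z - A)⁻¹ v)` in the rank one update of the resolvent. -/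
noncomputable def rankOneFactor (z : ℂ) (A : Matrix ι ι ℝ) (c : ℝ) (v : ι → ℝ) : ℂ :=
  (1 - c * realQuad (genResolvent z 1 A) v)⁻¹

/-- After multiplication by z the term ‖z‖²‖u‖² is real and drops out, leaving Im z (1 +
c‖A^{1/2}u‖²). Hence the rank one denominator never vanishes and its inverse is at most ‖z‖ / Im z.
-/
theorem im_le_im_mul_rankOne (hz : 0 < z.im) (hA : A.PosSemidef) {c : ℝ} (hc : 0 ≤ c)
    (v : ι → ℝ) : z.im ≤ (z * (1 - c * realQuad (genResolvent z 1 A) v)).im := by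
  rw [realQuad_genResolvent hz hA]
  have h1 := normSqVec_nonneg (complexify (CFC.sqrt A) *ᵥ (genResolvent z 1 A *ᵥ
    fun i => (v i : ℂ)))
  generalize normSqVec (complexify (CFC.sqrt A) *ᵥ (genResolvent z 1 A *ᵥ
    fun i => (v i : ℂ))) = a at h1 ⊢
  simp
  nlinarith [mul_nonneg hz.le (mul_nonneg hc h1)]

theorem im_rankOne (hz : 0 < z.im) (hA : A.PosSemidef) (c : ℝ) (v : ι → ℝ) :
    (1 - c * realQuad (genResolvent z 1 A) v).im
      = c * z.im * normSqVec (genResolvent z 1 A *ᵥ fun i => (v i : ℂ)) := by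
  rw [realQuad_genResolvent hz hA]
  simp
  ring

theorem one_sub_realQuad_ne_zero (hz : 0 < z.im) (hA : A.PosSemidef) {c : ℝ} (hc : 0 ≤ c)
    (v : ι → ℝ) : 1 - c * realQuad (genResolvent z 1 A) v ≠ 0 := by
  intro h
  have := im_le_im_mul_rankOne hz hA hc v
  rw [h] at this
  simp at this
  linarith

theorem norm_rankOneFactor_le (hz : 0 < z.im) (hA : A.PosSemidef) {c : ℝ} (hc : 0 ≤ c)
    (v : ι → ℝ) : ‖rankOneFactor z A c v‖ ≤ ‖z‖ / z.im := by
  have h1 := (im_le_im_mul_rankOne hz hA hc v).trans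
    ((le_abs_self _).trans (Complex.abs_im_le_norm _))
  rw [norm_mul] at h1
  have h2 : 0 < ‖1 - c * realQuad (genResolvent z 1 A) v‖ :=
    norm_pos_iff.2 (one_sub_realQuad_ne_zero hz hA hc v)
  rw [rankOneFactor, norm_inv, inv_eq_one_div, div_le_div_iff₀ h2 hz]
  linarith

/-- The denominator has imaginary part exactly c · Im z · ‖Rv‖², hence at least that modulus. So a
long v is compensated by a small factor, and rank one bounds do not depend on the length of v. -/
theorem mul_norm_rankOneFactor_mul_le (hz : 0 < z.im) (hA : A.PosSemidef) {c : ℝ} (hc : 0 ≤ c)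
    (v : ι → ℝ) :
    c * ‖rankOneFactor z A c v‖ * normSqVec (genResolvent z 1 A *ᵥ fun i => (v i : ℂ))
      ≤ 1 / z.im := by
  have h1 := (le_abs_self _).trans (Complex.abs_im_le_norm
    (1 - c * realQuad (genResolvent z 1 A) v))
  rw [im_rankOne hz hA] at h1
  have h2 : 0 < ‖1 - c * realQuad (genResolvent z 1 A) v‖ :=
    norm_pos_iff.2 (one_sub_realQuad_ne_zero hz hA hc v)
  rw [rankOneFactor, norm_inv, ← div_eq_mul_inv, div_mul_eq_mul_div, div_le_div_iff₀ h2 hz]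
  linarith

theorem im_rankOneFactor_nonpos (hz : 0 < z.im) (hA : A.PosSemidef) {c : ℝ} (hc : 0 ≤ c)
    (v : ι → ℝ) : (rankOneFactor z A c v).im ≤ 0 := by
  rw [rankOneFactor, Complex.inv_im, im_rankOne hz hA]
  have := normSqVec_nonneg (genResolvent z 1 A *ᵥ fun i => (v i : ℂ))
  refine div_nonpos_of_nonpos_of_nonneg (neg_nonpos.2 (by positivity)) (Complex.normSq_nonneg _)

theorem im_rankOneFactor_div_nonpos (hz : 0 < z.im) (hA : A.PosSemidef) {c : ℝ} (hc : 0 ≤ c)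
    (v : ι → ℝ) : (rankOneFactor z A c v / z).im ≤ 0 := by
  have h := im_le_im_mul_rankOne hz hA hc v
  have h2 : rankOneFactor z A c v / z = (z * (1 - c * realQuad (genResolvent z 1 A) v))⁻¹ := by
    rw [rankOneFactor, mul_inv, div_eq_mul_inv, mul_comm]
  rw [h2, Complex.inv_im]
  exact div_nonpos_of_nonpos_of_nonneg (neg_nonpos.2 (hz.le.trans h)) (Complex.normSq_nonneg _)

theorem genResolvent_add_sub (hz : 0 < z.im) (hA : A.PosSemidef) {c : ℝ} (hc : 0 ≤ c)
    (v : ι → ℝ) :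
    genResolvent z 1 (A + c • vecMulVec v v) - genResolvent z 1 A
      = genResolvent z 1 (A + c • vecMulVec v v)
        * ((c : ℂ) • vecMulVec (fun i => (v i : ℂ)) (fun i => (v i : ℂ))) * genResolvent z 1 A := by
  have h1 := (isUnit_and_norm_genResolvent_le (s := 1) hz (by simp)
    (posSemidef_add_vecMulVec hA hc v)).1
  have h0 := (isUnit_and_norm_genResolvent_le (s := 1) hz (by simp) hA).1
  unfold genResolvent
  rw [Matrix.inv_sub_inv (iff_of_true h1 h0)]
  congr 2
  ext i j
  simp [vecMulVec_apply]

/-- The Sherman–Morrison formula applied to the perturbing vector itself. -/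
theorem genResolvent_add_mulVec (hz : 0 < z.im) (hA : A.PosSemidef) {c : ℝ} (hc : 0 ≤ c)
    (v : ι → ℝ) :
    genResolvent z 1 (A + c • vecMulVec v v) *ᵥ (fun i => (v i : ℂ))
      = rankOneFactor z A c v • (genResolvent z 1 A *ᵥ fun i => (v i : ℂ)) := by
  set w : ι → ℂ := fun i => (v i : ℂ) with hw
  have h := congrArg (fun M => M *ᵥ w) (genResolvent_add_sub hz hA hc v)
  simp only [sub_mulVec] at h
  rw [← mulVec_mulVec, ← mulVec_mulVec, smul_mulVec, vecMulVec_mulVec] at h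
  set R1w := genResolvent z 1 (A + c • vecMulVec v v) *ᵥ w with hR1
  set R0w := genResolvent z 1 A *ᵥ w with hR0
  have hq : w ⬝ᵥ R0w = realQuad (genResolvent z 1 A) v := rfl
  rw [hq] at h
  have hne := one_sub_realQuad_ne_zero hz hA hc v
  have h2 : (1 - c * realQuad (genResolvent z 1 A) v) • R1w = R0w := by
    rw [op_smul_eq_smul, mulVec_smul, mulVec_smul, ← hR1] at h
    rw [sub_smul, one_smul, mul_smul, ← h]
    abel
  rw [rankOneFactor, ← h2, smul_smul, inv_mul_cancel₀ hne, one_smul]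

/-- The difference has rank one, so its trace against B is a single form c β (Rv)ᵀB(Rv); the
symmetry of R turns the row vector vᵀR into Rv. The factor β absorbs ‖Rv‖², leaving no dependence on
v or on the dimension. -/
theorem norm_trace_mul_genResolvent_sub_le (hz : 0 < z.im) (hA : A.PosSemidef) {c : ℝ}
    (hc : 0 ≤ c) (v : ι → ℝ) (B : Matrix ι ι ℂ) :
    ‖(B * (genResolvent z 1 (A + c • vecMulVec v v) - genResolvent z 1 A)).trace‖
      ≤ ‖B‖ / z.im := by
  set w : ι → ℂ := fun i => (v i : ℂ) with hw
  set R0w := genResolvent z 1 A *ᵥ w with hR0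
  have h1 : (B * (genResolvent z 1 (A + c • vecMulVec v v) - genResolvent z 1 A)).trace
      = c * rankOneFactor z A c v * (R0w ⬝ᵥ B *ᵥ R0w) := by
    rw [genResolvent_add_sub hz hA hc, Matrix.mul_smul, Matrix.smul_mul, Matrix.mul_smul,
      mul_vecMulVec, vecMulVec_mul, genResolvent_add_mulVec hz hA hc, mul_vecMulVec, trace_smul,
      trace_vecMulVec, mulVec_smul, smul_dotProduct]
    have : w ᵥ* genResolvent z 1 A = R0w := by
      rw [hR0, ← vecMul_transpose, transpose_genResolvent hA.isHermitian]
    rw [this, dotProduct_comm, smul_eq_mul, smul_eq_mul, mul_assoc]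
  rw [h1, norm_mul, norm_mul, Complex.norm_real, Real.norm_of_nonneg hc]
  have h2 := mul_norm_rankOneFactor_mul_le hz hA hc v
  have h3 := norm_dotProduct_mulVec_le B R0w
  calc c * ‖rankOneFactor z A c v‖ * ‖R0w ⬝ᵥ B *ᵥ R0w‖
      ≤ c * ‖rankOneFactor z A c v‖ * (‖B‖ * normSqVec R0w) :=
        mul_le_mul_of_nonneg_left h3 (by positivity)
    _ = ‖B‖ * (c * ‖rankOneFactor z A c v‖ * normSqVec R0w) := by ring
    _ ≤ ‖B‖ * (1 / z.im) := mul_le_mul_of_nonneg_left h2 (norm_nonneg _)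
    _ = _ := by ring

end RankOne

end Resolvent

/-! ### Leave-one-out identities for the sample covariance matrix -/

section SampleCovariance

open Matrix

variable {ι : Type*} {p : ℕ}

/-- The contribution of the columns in `J` to the sample covariance matrix. -/
noncomputable def partialCov (J : Finset (Fin p)) (x : Fin p → ι → ℝ) : Matrix ι ι ℝ :=
  ∑ j ∈ J, (1 / (p : ℝ)) • vecMulVec (x j) (x j)

theorem sampleCov_eq_partialCov (Z : Matrix ι (Fin p) ℝ) :
    sampleCov Z = partialCov Finset.univ fun j i => Z i j := by
  ext a b
  simp only [sampleCov, partialCov, Matrix.smul_apply, mul_apply, transpose_apply, Matrix.sum_apply,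
    vecMulVec_apply, smul_eq_mul, Finset.mul_sum]

theorem posSemidef_partialCov [Fintype ι] (J : Finset (Fin p)) (x : Fin p → ι → ℝ) :
    (partialCov J x).PosSemidef := by
  refine posSemidef_sum _ fun j _ => PosSemidef.smul ?_ (by positivity)
  simpa using posSemidef_vecMulVec_self_star (x j)

theorem partialCov_univ_eq_add (x : Fin p → ι → ℝ) (j : Fin p) :
    partialCov Finset.univ x
      = partialCov (Finset.univ.erase j) x + (1 / (p : ℝ)) • vecMulVec (x j) (x j) :=
  (Finset.sum_erase_add _ _ (Finset.mem_univ j)).symm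

theorem partialCov_erase_update (x : Fin p → ι → ℝ) (j : Fin p) (v : ι → ℝ) :
    partialCov (Finset.univ.erase j) (Function.update x j v)
      = partialCov (Finset.univ.erase j) x := by
  refine Finset.sum_congr rfl fun k hk => ?_
  rw [Function.update_of_ne (Finset.ne_of_mem_erase hk)]

theorem continuous_partialCov (J : Finset (Fin p)) :
    Continuous fun x : Fin p → ι → ℝ => partialCov J x := by
  unfold partialCov
  refine continuous_finsetSum _ fun j _ => ?_
  exact ((continuous_apply j).matrix_vecMulVec (continuous_apply j)).fun_const_smul _

variable [Fintype ι]

theorem continuous_realQuad {X : Type*} [TopologicalSpace X] {B : X → Matrix ι ι ℂ}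
    {v : X → ι → ℝ} (hB : Continuous B) (hv : Continuous v) :
    Continuous fun x => realQuad (B x) (v x) := by
  unfold realQuad
  have h : Continuous fun x => fun i => ((v x i : ℝ) : ℂ) :=
    continuous_pi fun i => Complex.continuous_ofReal.comp ((continuous_apply i).comp hv)
  exact h.dotProduct (hB.matrix_mulVec h)

theorem trace_complexify_partialCov_mul (J : Finset (Fin p)) (x : Fin p → ι → ℝ)
    (B : Matrix ι ι ℂ) :
    (complexify (partialCov J x) * B).trace
      = ∑ j ∈ J, ((1 / (p : ℝ) : ℝ) : ℂ) * realQuad B (x j) := by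
  have h : complexify (partialCov J x) = ∑ j ∈ J, ((1 / (p : ℝ) : ℝ) : ℂ) •
      vecMulVec (fun i => ((x j i : ℝ) : ℂ)) (fun i => ((x j i : ℝ) : ℂ)) := by
    ext a b
    simp [partialCov, Matrix.sum_apply, vecMulVec_apply]
  rw [h, Finset.sum_mul, trace_sum]
  refine Finset.sum_congr rfl fun j _ => ?_
  rw [Matrix.smul_mul, trace_smul, vecMulVec_mul, trace_vecMulVec, smul_eq_mul, realQuad,
    dotProduct_comm, dotProduct_mulVec]

theorem normSqVec_ofReal (v : ι → ℝ) : normSqVec (fun i => (v i : ℂ)) = ∑ i, v i ^ 2 := by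
  simp [normSqVec]

variable [DecidableEq ι]

/-- Cramer's rule: the inverse is the adjugate over a determinant that does not vanish when Im z >
0. Measurability of all later integrands comes from here. -/
theorem continuous_genResolvent_partialCov {z : ℂ} (hz : 0 < z.im) (J : Finset (Fin p)) :
    Continuous fun x : Fin p → ι → ℝ => genResolvent z 1 (partialCov J x) := by
  have hM : Continuous fun x : Fin p → ι → ℝ =>
      z • (1 : Matrix ι ι ℂ) - (1 : ℂ) • complexify (partialCov J x) :=
    continuous_const.sub (((continuous_partialCov J).matrix_map
      Complex.continuous_ofReal).fun_const_smul _)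
  unfold genResolvent
  simp_rw [Matrix.inv_def, Ring.inverse_eq_inv']
  refine (hM.matrix_det.inv₀ fun x => ?_).smul hM.matrix_adjugate
  exact ((isUnit_iff_isUnit_det _).1 (isUnit_and_norm_genResolvent_le (s := 1) hz (by simp)
    (posSemidef_partialCov J x)).1).ne_zero

/-- The rank one factor of the `j`-th column relative to the other columns. -/
noncomputable def leaveOneOutFactor (z : ℂ) (x : Fin p → ι → ℝ) (j : Fin p) : ℂ :=
  rankOneFactor z (partialCov (Finset.univ.erase j) x) (1 / (p : ℝ)) (x j)

/-- The normalized trace of the resolvent of the sample covariance matrix. -/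
noncomputable def covStieltjes (z : ℂ) (x : Fin p → ι → ℝ) : ℂ :=
  (Fintype.card ι : ℂ)⁻¹ * (genResolvent z 1 (partialCov Finset.univ x)).trace

/-- R is symmetric, so it can act on the left copy of x_j, where Sherman–Morrison replaces R x_j by
β_j R_j x_j. In the resulting matrix R_j B no factor R depends on column j. -/
theorem realQuad_full_mul {z : ℂ} (hz : 0 < z.im) (x : Fin p → ι → ℝ) (j : Fin p)
    (B : Matrix ι ι ℂ) :
    realQuad (genResolvent z 1 (partialCov Finset.univ x) * B) (x j)
      = leaveOneOutFactor z x j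
        * realQuad (genResolvent z 1 (partialCov (Finset.univ.erase j) x) * B) (x j) := by
  have hsym : ∀ J : Finset (Fin p), realQuad (genResolvent z 1 (partialCov J x) * B) (x j)
      = (genResolvent z 1 (partialCov J x) *ᵥ fun i => ((x j i : ℝ) : ℂ))
        ⬝ᵥ (B *ᵥ fun i => ((x j i : ℝ) : ℂ)) := by
    intro J
    rw [realQuad, ← mulVec_mulVec, dotProduct_mulVec, ← mulVec_transpose,
      transpose_genResolvent (posSemidef_partialCov J x).isHermitian]
  rw [hsym, hsym, partialCov_univ_eq_add x j, genResolvent_add_mulVec hz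
    (posSemidef_partialCov _ x) (by positivity), smul_dotProduct]
  rfl

theorem realQuad_full {z : ℂ} (hz : 0 < z.im) (x : Fin p → ι → ℝ) (j : Fin p) :
    realQuad (genResolvent z 1 (partialCov Finset.univ x)) (x j)
      = leaveOneOutFactor z x j
        * realQuad (genResolvent z 1 (partialCov (Finset.univ.erase j) x)) (x j) := by
  simpa using realQuad_full_mul hz x j 1

/-- The average of the leave-one-out factors is the transform of the companion matrix. -/
theorem companion_eq [Nonempty ι] (hp : 0 < p) {z : ℂ} (hz : 0 < z.im) (x : Fin p → ι → ℝ) :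
    1 - (Fintype.card ι : ℂ) / p + (Fintype.card ι : ℂ) / p * z * covStieltjes z x
      = ∑ j, ((1 / (p : ℝ) : ℝ) : ℂ) * leaveOneOutFactor z x j := by
  have hps := posSemidef_partialCov Finset.univ x
  have h1 := congrArg trace (mul_genResolvent (s := 1) hz (by simp) hps)
  rw [Matrix.sub_mul, trace_sub, Matrix.smul_mul, Matrix.smul_mul, one_smul, Matrix.one_mul,
    trace_smul, trace_one, trace_complexify_partialCov_mul, smul_eq_mul] at h1
  have hp' : (p : ℂ) ≠ 0 := by exact_mod_cast hp.ne'
  have hN : (Fintype.card ι : ℂ) ≠ 0 := by exact_mod_cast Fintype.card_ne_zero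
  -- With β = 1/(1 - q), where q is the scaled leave-one-out form, the scaled full form is βq = β -
  -- 1. Summing over j turns the trace of (z - S)R = 1 into an identity for the average of the β.
  have h2 : ∀ j, ((1 / (p : ℝ) : ℝ) : ℂ)
      * realQuad (genResolvent z 1 (partialCov Finset.univ x)) (x j)
      = leaveOneOutFactor z x j - 1 := by
    intro j
    rw [realQuad_full hz]
    have hne := one_sub_realQuad_ne_zero hz (posSemidef_partialCov (Finset.univ.erase j) x)
      (c := 1 / (p : ℝ)) (by positivity) (x j)
    have h3 : leaveOneOutFactor z x j * (1 - ((1 / (p : ℝ) : ℝ) : ℂ)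
        * realQuad (genResolvent z 1 (partialCov (Finset.univ.erase j) x)) (x j)) = 1 := by
      rw [leaveOneOutFactor, rankOneFactor, inv_mul_cancel₀ hne]
    linear_combination -h3
  simp_rw [h2] at h1
  rw [Finset.sum_sub_distrib, Finset.sum_const, Finset.card_univ, Fintype.card_fin,
    nsmul_eq_mul, mul_one] at h1
  rw [← Finset.mul_sum, covStieltjes]
  push_cast
  field_simp
  linear_combination h1

theorem im_sum_leaveOneOutFactor_nonpos {z : ℂ} (hz : 0 < z.im) (x : Fin p → ι → ℝ) :
    (∑ j, ((1 / (p : ℝ) : ℝ) : ℂ) * leaveOneOutFactor z x j).im ≤ 0 := by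
  rw [Complex.im_sum]
  refine Finset.sum_nonpos fun j _ => ?_
  rw [Complex.im_ofReal_mul]
  exact mul_nonpos_of_nonneg_of_nonpos (by positivity)
    (im_rankOneFactor_nonpos hz (posSemidef_partialCov _ x) (by positivity) _)

theorem im_sum_leaveOneOutFactor_div_nonpos {z : ℂ} (hz : 0 < z.im) (x : Fin p → ι → ℝ) :
    ((∑ j, ((1 / (p : ℝ) : ℝ) : ℂ) * leaveOneOutFactor z x j) / z).im ≤ 0 := by
  rw [Finset.sum_div, Complex.im_sum]
  refine Finset.sum_nonpos fun j _ => ?_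
  rw [mul_div_assoc, Complex.im_ofReal_mul]
  exact mul_nonpos_of_nonneg_of_nonpos (by positivity)
    (im_rankOneFactor_div_nonpos hz (posSemidef_partialCov _ x) (by positivity) _)

/-- The resolvent identity R - D = D(S - sT)R, with S expanded over its columns and each full form
reduced to its leave-one-out version. -/
theorem trace_genResolvent_sub {z s : ℂ} (hz : 0 < z.im) (hs : s.im ≤ 0) {T : Matrix ι ι ℝ}
    (hT : T.PosSemidef) (x : Fin p → ι → ℝ) :
    (genResolvent z 1 (partialCov Finset.univ x)).trace - (genResolvent z s T).trace
      = ∑ j, ((1 / (p : ℝ) : ℝ) : ℂ) * (leaveOneOutFactor z x j *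
          realQuad (genResolvent z 1 (partialCov (Finset.univ.erase j) x) * genResolvent z s T)
            (x j))
        - s * (genResolvent z s T * complexify T
          * genResolvent z 1 (partialCov Finset.univ x)).trace := by
  have hps := posSemidef_partialCov Finset.univ x
  set R := genResolvent z 1 (partialCov Finset.univ x) with hR
  set D := genResolvent z s T with hD
  have h1 : R - D = D * (complexify (partialCov Finset.univ x) * R) - s • (D * complexify T * R) := by
    have e1 : D * ((z • (1 : Matrix ι ι ℂ) - (1 : ℂ) • complexify (partialCov Finset.univ x)) * R)
        = D := by rw [mul_genResolvent hz (by simp) hps, Matrix.mul_one]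
    have e2 : (D * (z • (1 : Matrix ι ι ℂ) - s • complexify T)) * R = R := by
      rw [genResolvent_mul hz hs hT, Matrix.one_mul]
    calc R - D = (D * (z • (1 : Matrix ι ι ℂ) - s • complexify T)) * R - D * ((z • (1 : Matrix ι ι ℂ)
          - (1 : ℂ) • complexify (partialCov Finset.univ x)) * R) := by rw [e1, e2]
      _ = _ := ?_
    simp only [Matrix.mul_sub, Matrix.sub_mul, Matrix.mul_smul, Matrix.smul_mul, Matrix.mul_one,
      Matrix.one_mul, one_smul, Matrix.mul_assoc]
    abel
  rw [← trace_sub, h1, trace_sub, trace_smul, trace_mul_comm, Matrix.mul_assoc,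
    trace_complexify_partialCov_mul, smul_eq_mul]
  simp_rw [hR, realQuad_full_mul hz]

end SampleCovariance

/-! ### Approximate self-consistent equation and concentration of the resolvent trace -/

section Expectation

open Matrix
open scoped Matrix.Norms.L2Operator

variable {ι : Type*} [Fintype ι] [DecidableEq ι] {p : ℕ}

/-- The properties of the law of a column used for the limit law: quadratic forms concentrate
around their traces against the covariance `T`, with relative error `ε`. -/
structure ConcentratedColumn (L : Measure (ι → ℝ)) (T : Matrix ι ι ℝ) (K ε : ℝ) : Prop where
  posSemidef : T.PosSemidef
  norm_le : ‖complexify T‖ ≤ K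
  sq_int : ∀ i, Integrable (fun v : ι → ℝ => v i ^ 2) L
  sq_le : ∑ i, ∫ v, v i ^ 2 ∂L ≤ K * Fintype.card ι
  quad_le : ∀ B : Matrix ι ι ℂ,
    ∫ v, ‖realQuad B v - (B * complexify T).trace‖ ∂L ≤ ε * Fintype.card ι * ‖B‖

theorem norm_one_le_one : ‖(1 : Matrix ι ι ℂ)‖ ≤ 1 := by
  rw [← diagonal_one, l2_opNorm_diagonal]
  exact (pi_norm_le_iff_of_nonneg zero_le_one).2 fun i => by simp

theorem norm_covStieltjes_le [Nonempty ι] {z : ℂ} (hz : 0 < z.im) (x : Fin p → ι → ℝ) :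
    ‖covStieltjes z x‖ ≤ 1 / z.im := by
  have h1 := norm_trace_le (genResolvent z 1 (partialCov Finset.univ x))
  have h2 := (isUnit_and_norm_genResolvent_le (s := 1) hz (by simp)
    (posSemidef_partialCov Finset.univ x)).2
  have hN : (0 : ℝ) < Fintype.card ι := by exact_mod_cast Fintype.card_pos
  rw [covStieltjes, norm_mul, norm_inv, Complex.norm_natCast, inv_mul_le_iff₀ hN]
  exact h1.trans (mul_le_mul_of_nonneg_left h2 hN.le)

theorem continuous_covStieltjes {z : ℂ} (hz : 0 < z.im) :
    Continuous fun x : Fin p → ι → ℝ => covStieltjes z x :=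
  continuous_const.mul (continuous_genResolvent_partialCov hz _).matrix_trace

/-- Old and new matrices share the same leave-one-out part, and each unnormalized trace is within 1
/ Im z of the trace for that part. -/
theorem norm_covStieltjes_update_sub_le [Nonempty ι] {z : ℂ} (hz : 0 < z.im)
    (x : Fin p → ι → ℝ) (j : Fin p) (v : ι → ℝ) :
    ‖covStieltjes z (Function.update x j v) - covStieltjes z x‖
      ≤ 2 / (Fintype.card ι * z.im) := by
  have hN : (0 : ℝ) < Fintype.card ι := by exact_mod_cast Fintype.card_pos
  have key : ∀ x : Fin p → ι → ℝ, ‖(genResolvent z 1 (partialCov Finset.univ x)).trace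
      - (genResolvent z 1 (partialCov (Finset.univ.erase j) x)).trace‖ ≤ 1 / z.im := by
    intro x
    have h := norm_trace_mul_genResolvent_sub_le hz (posSemidef_partialCov (Finset.univ.erase j) x)
      (c := 1 / (p : ℝ)) (by positivity) (x j) 1
    rw [← partialCov_univ_eq_add, Matrix.one_mul, trace_sub] at h
    exact h.trans (div_le_div_of_nonneg_right norm_one_le_one hz.le)
  have h1 := key x
  have h2 := key (Function.update x j v)
  rw [partialCov_erase_update] at h2
  rw [covStieltjes, covStieltjes, ← mul_sub, norm_mul, norm_inv, Complex.norm_natCast,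
    inv_mul_le_iff₀ hN]
  have h3 := norm_sub_le_norm_sub_add_norm_sub
    (genResolvent z 1 (partialCov Finset.univ (Function.update x j v))).trace
    (genResolvent z 1 (partialCov (Finset.univ.erase j) x)).trace
    (genResolvent z 1 (partialCov Finset.univ x)).trace
  rw [norm_sub_rev (genResolvent z 1 (partialCov (Finset.univ.erase j) x)).trace] at h3
  refine h3.trans ((add_le_add h2 h1).trans (le_of_eq ?_))
  field_simp
  norm_num

section

variable (L : Measure (ι → ℝ)) [IsProbabilityMeasure L] {T : Matrix ι ι ℝ} {K ε : ℝ}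

theorem integrable_covStieltjes [Nonempty ι] {z : ℂ} (hz : 0 < z.im) :
    Integrable (fun x : Fin p → ι → ℝ => covStieltjes z x) (Measure.pi fun _ => L) :=
  Integrable.mono' (integrable_const (1 / z.im)) (continuous_covStieltjes hz).aestronglyMeasurable
    (Eventually.of_forall (norm_covStieltjes_le hz))

/-- The expected normalized trace of the resolvent. -/
noncomputable def meanCovStieltjes (p : ℕ) (L : Measure (ι → ℝ)) (z : ℂ) : ℂ :=
  ∫ x : Fin p → ι → ℝ, covStieltjes z x ∂(Measure.pi fun _ => L)

/-- The expected companion transform, multiplied by `z`. -/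
noncomputable def meanCompanion (p : ℕ) (L : Measure (ι → ℝ)) (z : ℂ) : ℂ :=
  1 - (Fintype.card ι : ℂ) / p + (Fintype.card ι : ℂ) / p * z * meanCovStieltjes p L z

theorem norm_meanCovStieltjes_le [Nonempty ι] {z : ℂ} (hz : 0 < z.im) :
    ‖meanCovStieltjes p L z‖ ≤ 1 / z.im := by
  have := norm_integral_le_of_norm_le_const (μ := Measure.pi fun _ : Fin p => L)
    (f := fun x => covStieltjes z x) (Eventually.of_forall (norm_covStieltjes_le hz))
  simpa [meanCovStieltjes] using this

theorem meanCompanion_eq_integral [Nonempty ι] {z : ℂ} (hz : 0 < z.im) :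
    meanCompanion p L z = ∫ x : Fin p → ι → ℝ, (1 - (Fintype.card ι : ℂ) / p
      + (Fintype.card ι : ℂ) / p * z * covStieltjes z x) ∂(Measure.pi fun _ => L) := by
  rw [integral_add (integrable_const _) ((integrable_covStieltjes L hz).const_mul _),
    integral_const_mul]
  simp [meanCompanion, meanCovStieltjes]

theorem integrable_companion [Nonempty ι] {z : ℂ} (hz : 0 < z.im) (a b : ℂ) :
    Integrable (fun x : Fin p → ι → ℝ => a + b * covStieltjes z x) (Measure.pi fun _ => L) :=
  (integrable_const _).add ((integrable_covStieltjes L hz).const_mul _)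

theorem im_meanCompanion_nonpos [Nonempty ι] (hp : 0 < p) {z : ℂ} (hz : 0 < z.im) :
    (meanCompanion p L z).im ≤ 0 := by
  rw [meanCompanion_eq_integral L hz]
  have h := integral_im (integrable_companion (p := p) L hz
    (1 - (Fintype.card ι : ℂ) / p) ((Fintype.card ι : ℂ) / p * z))
  simp only [RCLike.im_eq_complex_im] at h
  rw [← h]
  refine integral_nonpos fun x => ?_
  simp only [Pi.zero_apply]
  rw [companion_eq hp hz]
  exact im_sum_leaveOneOutFactor_nonpos hz x

theorem im_meanCompanion_div_nonpos [Nonempty ι] (hp : 0 < p) {z : ℂ} (hz : 0 < z.im) :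
    (meanCompanion p L z / z).im ≤ 0 := by
  rw [meanCompanion_eq_integral L hz, ← integral_div]
  have h := integral_im ((integrable_companion (p := p) L hz
    (1 - (Fintype.card ι : ℂ) / p) ((Fintype.card ι : ℂ) / p * z)).div_const z)
  simp only [RCLike.im_eq_complex_im] at h
  rw [← h]
  refine integral_nonpos fun x => ?_
  simp only [Pi.zero_apply]
  rw [companion_eq hp hz]
  exact im_sum_leaveOneOutFactor_div_nonpos hz x

variable {L}

/-- The self-consistent equation holds approximately for the expected resolvent trace. -/
theorem norm_meanCovStieltjes_sub_le [Nonempty ι] (hL : ConcentratedColumn L T K ε) (hp : 0 < p)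
    {z : ℂ} (hz : 0 < z.im) :
    ‖meanCovStieltjes p L z
        - ∫ t : ℝ, 1 / (z - meanCompanion p L z * (t : ℂ)) ∂(esd hL.posSemidef.isHermitian : Measure ℝ)‖
      ≤ ‖z‖ / z.im * (ε * (1 / z.im ^ 2) + K / z.im ^ 2 / Fintype.card ι)
        + K / z.im ^ 2 * (Fintype.card ι / p * ‖z‖)
          * ∫ x : Fin p → ι → ℝ, ‖covStieltjes z x - meanCovStieltjes p L z‖
            ∂(Measure.pi fun _ => L) := by
  have hT := hL.posSemidef
  set P := Measure.pi fun _ : Fin p => L with hP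
  set N : ℝ := ((Fintype.card ι : ℕ) : ℝ) with hNdef
  have hN : 0 < N := by rw [hNdef]; exact_mod_cast Fintype.card_pos
  have hpR : (0 : ℝ) < p := by exact_mod_cast hp
  set s := meanCompanion p L z with hs
  have hs0 : s.im ≤ 0 := im_meanCompanion_nonpos L hp hz
  set y := z.im with hy
  set D := genResolvent z s T with hD
  set M := meanCovStieltjes p L z with hM
  have hK : 0 ≤ K := (norm_nonneg _).trans hL.norm_le
  have hDn : ‖D‖ ≤ 1 / y := (isUnit_and_norm_genResolvent_le hz hs0 hT).2
  have hRn : ∀ J (x : Fin p → ι → ℝ), ‖genResolvent z 1 (partialCov J x)‖ ≤ 1 / y := fun J x =>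
    (isUnit_and_norm_genResolvent_le (s := 1) hz (by simp) (posSemidef_partialCov J x)).2
  have hDTn : ‖D * complexify T‖ ≤ K / y := by
    refine (l2_opNorm_mul _ _).trans ?_
    calc ‖D‖ * ‖complexify T‖ ≤ 1 / y * K :=
          mul_le_mul hDn hL.norm_le (norm_nonneg _) (by positivity)
      _ = K / y := by ring
  have hRDn : ∀ J (x : Fin p → ι → ℝ), ‖genResolvent z 1 (partialCov J x) * D‖ ≤ 1 / y ^ 2 := by
    intro J x
    refine (l2_opNorm_mul _ _).trans ?_
    calc _ ≤ 1 / y * (1 / y) := mul_le_mul (hRn J x) hDn (norm_nonneg _) (by positivity)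
      _ = 1 / y ^ 2 := by ring
  -- the fluctuation of the quadratic form of the `j`-th column
  let F : Fin p → (Fin p → ι → ℝ) → ℝ := fun j x =>
    ‖realQuad (genResolvent z 1 (partialCov (Finset.univ.erase j) x) * D) (x j)
      - (genResolvent z 1 (partialCov (Finset.univ.erase j) x) * D * complexify T).trace‖
  have hRDc : ∀ J, Continuous fun x : Fin p → ι → ℝ => genResolvent z 1 (partialCov J x) * D :=
    fun J => (continuous_genResolvent_partialCov hz J).matrix_mul continuous_const
  have hFc : ∀ j, Continuous (F j) := by
    intro j
    refine Continuous.norm (Continuous.sub ?_ ?_)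
    · exact continuous_realQuad (hRDc _) (continuous_apply j)
    · exact ((hRDc _).matrix_mul continuous_const).matrix_trace
  have hsqI : ∀ j, Integrable (fun x : Fin p → ι → ℝ => ∑ i, x j i ^ 2) P := by
    intro j
    refine integrable_finsetSum _ fun i _ => ?_
    exact integrable_comp_eval (μ := fun _ : Fin p => L) (i := j) (f := fun v => v i ^ 2)
      (hL.sq_int i)
  have hFI : ∀ j, Integrable (F j) P := by
    intro j
    refine Integrable.mono' (((hsqI j).const_mul (1 / y ^ 2)).add
      (integrable_const (N * (1 / y ^ 2 * K)))) (hFc j).aestronglyMeasurable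
      (Eventually.of_forall fun x => ?_)
    simp only [F, norm_norm, Pi.add_apply]
    refine (norm_sub_le _ _).trans (add_le_add ?_ ?_)
    · refine (norm_dotProduct_mulVec_le _ _).trans ?_
      rw [normSqVec_ofReal]
      exact mul_le_mul_of_nonneg_right (hRDn _ x) (Finset.sum_nonneg fun i _ => sq_nonneg _)
    · refine (norm_trace_le _).trans (mul_le_mul_of_nonneg_left ?_ hN.le)
      exact (l2_opNorm_mul _ _).trans
        (mul_le_mul (hRDn _ x) hL.norm_le (norm_nonneg _) (by positivity))
  have hε : ∀ j, ∫ x, F j x ∂P ≤ ε * N * (1 / y ^ 2) := by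
    intro j
    -- Testing the concentration bound on the identity matrix shows that its right side is
    -- nonnegative.
    have hεN : 0 ≤ ε * N := by
      have h1 := hL.quad_le 1
      have h2 : 0 ≤ ∫ v, ‖realQuad (1 : Matrix ι ι ℂ) v - (1 * complexify T).trace‖ ∂L :=
        integral_nonneg fun v => norm_nonneg _
      have h3 : 0 < ‖(1 : Matrix ι ι ℂ)‖ := norm_pos_iff.2 one_ne_zero
      by_contra! hcon
      have := mul_neg_of_neg_of_pos hcon h3
      rw [hNdef] at this
      linarith
    -- Condition on the other columns: R_j D is then a fixed matrix of norm at most 1/y², to which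
    -- the concentration hypothesis applies.
    rw [hP, integral_pi_eq_integral_update L j (hFI j)]
    have hin : ∀ x : Fin p → ι → ℝ, ∫ v, F j (Function.update x j v) ∂L ≤ ε * N * (1 / y ^ 2) := by
      intro x
      simp only [F, partialCov_erase_update, Function.update_self]
      exact (hL.quad_le _).trans (mul_le_mul_of_nonneg_left (hRDn _ x) hεN)
    have := integral_mono_of_nonneg (μ := Measure.pi fun _ : Fin p => L)
      (f := fun x : Fin p → ι → ℝ => ∫ v, F j (Function.update x j v) ∂L)
      (g := fun _ => ε * N * (1 / y ^ 2))
      (Eventually.of_forall fun x => integral_nonneg fun v => norm_nonneg _)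
      (integrable_const _) (Eventually.of_forall hin)
    simpa using this
  -- pointwise comparison of the traces
  have hpt : ∀ x : Fin p → ι → ℝ,
      ‖(genResolvent z 1 (partialCov Finset.univ x)).trace - D.trace‖
        ≤ ‖z‖ / y * (1 / p * ∑ j, (F j x + K / y ^ 2))
          + N * (K / y ^ 2) * (N / p * ‖z‖) * ‖covStieltjes z x - M‖ := by
    intro x
    set τ := (D * complexify T * genResolvent z 1 (partialCov Finset.univ x)).trace with hτ
    have hτn : ‖τ‖ ≤ N * (K / y ^ 2) := by
      refine (norm_trace_le _).trans (mul_le_mul_of_nonneg_left ?_ hN.le)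
      refine (l2_opNorm_mul _ _).trans ?_
      calc _ ≤ K / y * (1 / y) := mul_le_mul hDTn (hRn _ x) (norm_nonneg _) (by positivity)
        _ = K / y ^ 2 := by field_simp
    -- Subtract the common value τ from every form. The correction is τ times the difference between
    -- the average of the β_j and s, that is (N/p) z times the fluctuation of the normalized trace.
    have hid : (genResolvent z 1 (partialCov Finset.univ x)).trace - D.trace
        = ∑ j, ((1 / (p : ℝ) : ℝ) : ℂ) * (leaveOneOutFactor z x j *
          (realQuad (genResolvent z 1 (partialCov (Finset.univ.erase j) x) * D) (x j) - τ))
          + (Fintype.card ι : ℂ) / p * z * (covStieltjes z x - M) * τ := by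
      have e1 := trace_genResolvent_sub hz hs0 hT x
      have e2 := companion_eq hp hz x
      have e3 : ∑ j, ((1 / (p : ℝ) : ℝ) : ℂ) * (leaveOneOutFactor z x j *
          (realQuad (genResolvent z 1 (partialCov (Finset.univ.erase j) x) * D) (x j) - τ))
          = ∑ j, ((1 / (p : ℝ) : ℝ) : ℂ) * (leaveOneOutFactor z x j *
          realQuad (genResolvent z 1 (partialCov (Finset.univ.erase j) x) * D) (x j))
          - (∑ j, ((1 / (p : ℝ) : ℝ) : ℂ) * leaveOneOutFactor z x j) * τ := by
        rw [Finset.sum_mul, ← Finset.sum_sub_distrib]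
        exact Finset.sum_congr rfl fun j _ => by ring
      have e4 : s = 1 - (Fintype.card ι : ℂ) / p + (Fintype.card ι : ℂ) / p * z * M := rfl
      rw [e3, ← e2]
      refine e1.trans ?_
      rw [← hD, ← hτ]
      linear_combination -τ * e4
    have hj : ∀ j, ‖realQuad (genResolvent z 1 (partialCov (Finset.univ.erase j) x) * D) (x j) - τ‖
        ≤ F j x + K / y ^ 2 := by
      intro j
      -- Exchanging R_j for R inside the trace against DT costs only K/y², which vanishes after
      -- division by N.
      have e1 := norm_trace_mul_genResolvent_sub_le hz
        (posSemidef_partialCov (Finset.univ.erase j) x)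
        (c := 1 / (p : ℝ)) (by positivity) (x j) (D * complexify T)
      rw [← partialCov_univ_eq_add, Matrix.mul_sub, trace_sub, ← hτ] at e1
      have e2 : (genResolvent z 1 (partialCov (Finset.univ.erase j) x) * D * complexify T).trace
          = (D * complexify T * genResolvent z 1 (partialCov (Finset.univ.erase j) x)).trace := by
        rw [Matrix.mul_assoc, trace_mul_comm]
      have e3 := norm_sub_le_norm_sub_add_norm_sub
        (realQuad (genResolvent z 1 (partialCov (Finset.univ.erase j) x) * D) (x j))
        (genResolvent z 1 (partialCov (Finset.univ.erase j) x) * D * complexify T).trace τ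
      refine e3.trans (add_le_add le_rfl ?_)
      rw [e2, norm_sub_rev]
      refine e1.trans ?_
      calc ‖D * complexify T‖ / y ≤ K / y / y := div_le_div_of_nonneg_right hDTn hz.le
        _ = K / y ^ 2 := by field_simp
    rw [hid]
    refine (norm_add_le _ _).trans (add_le_add ?_ ?_)
    · refine (norm_sum_le _ _).trans ?_
      rw [Finset.mul_sum, Finset.mul_sum]
      refine Finset.sum_le_sum fun j _ => ?_
      rw [norm_mul, norm_mul, Complex.norm_real, Real.norm_of_nonneg (by positivity)]
      have e1 : ‖leaveOneOutFactor z x j‖ ≤ ‖z‖ / y :=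
        norm_rankOneFactor_le hz (posSemidef_partialCov _ x) (by positivity) _
      calc _ ≤ 1 / (p : ℝ) * (‖z‖ / y * (F j x + K / y ^ 2)) :=
            mul_le_mul_of_nonneg_left (mul_le_mul e1 (hj j) (norm_nonneg _) (by positivity))
              (by positivity)
        _ = _ := by ring
    · rw [norm_mul, norm_mul, norm_mul, norm_div, Complex.norm_natCast, Complex.norm_natCast]
      calc _ ≤ N / p * ‖z‖ * ‖covStieltjes z x - M‖ * (N * (K / y ^ 2)) :=
            mul_le_mul_of_nonneg_left hτn (by positivity)
        _ = _ := by ring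
  have hdevI : Integrable (fun x : Fin p → ι → ℝ => ‖covStieltjes z x - M‖) P :=
    ((integrable_covStieltjes L hz).sub (integrable_const _)).norm
  have hbI : Integrable (fun x : Fin p → ι → ℝ => ‖z‖ / y * (1 / p * ∑ j, (F j x + K / y ^ 2))
      + N * (K / y ^ 2) * (N / p * ‖z‖) * ‖covStieltjes z x - M‖) P :=
    (((integrable_finsetSum _ fun j _ => (hFI j).add (integrable_const _)).const_mul _).const_mul
      _).add (hdevI.const_mul _)
  have hdiff : M - ∫ t : ℝ, 1 / (z - s * (t : ℂ)) ∂(esd hT.isHermitian : Measure ℝ)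
      = (Fintype.card ι : ℂ)⁻¹ * ∫ x : Fin p → ι → ℝ,
        ((genResolvent z 1 (partialCov Finset.univ x)).trace - D.trace) ∂P := by
    rw [integral_esd_one_div hz hs0 hT]
    have e1 : ∀ x : Fin p → ι → ℝ, (genResolvent z 1 (partialCov Finset.univ x)).trace
        = (Fintype.card ι : ℂ) * covStieltjes z x := by
      intro x
      rw [covStieltjes, mul_inv_cancel_left₀ (by exact_mod_cast Fintype.card_ne_zero)]
    simp_rw [e1]
    rw [integral_sub ((integrable_covStieltjes L hz).const_mul _) (integrable_const _),
      integral_const_mul, mul_sub, inv_mul_cancel_left₀ (by exact_mod_cast Fintype.card_ne_zero)]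
    simp [hM, hD, meanCovStieltjes]
  rw [hdiff, norm_mul, norm_inv, Complex.norm_natCast, inv_mul_le_iff₀ hN]
  refine (norm_integral_le_integral_norm _).trans ((integral_mono_of_nonneg
    (Eventually.of_forall fun x => norm_nonneg _) hbI (Eventually.of_forall hpt)).trans ?_)
  have hI0 : ∀ j, Integrable (fun x : Fin p → ι → ℝ => F j x + K / y ^ 2) P := fun j =>
    (hFI j).add (integrable_const _)
  have hI1 : Integrable (fun x : Fin p → ι → ℝ => ∑ j, (F j x + K / y ^ 2)) P :=
    integrable_finsetSum _ fun j _ => hI0 j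
  rw [integral_add ((hI1.const_mul _).const_mul _) (hdevI.const_mul _),
    integral_const_mul, integral_const_mul, integral_const_mul,
    integral_finsetSum _ fun j _ => hI0 j]
  have hsum : ∑ j, ∫ x, (F j x + K / y ^ 2) ∂P ≤ p * (ε * N * (1 / y ^ 2) + K / y ^ 2) := by
    calc ∑ j, ∫ x, (F j x + K / y ^ 2) ∂P ≤ ∑ _j : Fin p, (ε * N * (1 / y ^ 2) + K / y ^ 2) := by
          refine Finset.sum_le_sum fun j _ => ?_
          rw [integral_add (hFI j) (integrable_const _)]
          have := hε j
          simp
          simp at this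
          linarith
      _ = _ := by simp [mul_add]
  calc _ ≤ ‖z‖ / y * (1 / p * (p * (ε * N * (1 / y ^ 2) + K / y ^ 2)))
        + N * (K / y ^ 2) * (N / p * ‖z‖) * ∫ x, ‖covStieltjes z x - M‖ ∂P := by
        gcongr
    _ = _ := by
        field_simp

variable (L)

/-- Concentration of the normalized resolvent trace around its mean. -/
theorem measureReal_norm_covStieltjes_sub_ge_le [Nonempty ι] {z : ℂ} (hz : 0 < z.im) {δ : ℝ}
    (hδ : 0 < δ) :
    (Measure.pi fun _ : Fin p => L).real {x | δ ≤ ‖covStieltjes z x - meanCovStieltjes p L z‖}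
      ≤ 4 * Real.exp (-(δ / 2) ^ 2 / (2 * p * (2 / (Fintype.card ι * z.im)) ^ 2)) := by
  set P := Measure.pi fun _ : Fin p => L
  have hI := integrable_covStieltjes (p := p) L hz
  have hre : ∫ x : Fin p → ι → ℝ, (covStieltjes z x).re ∂P = (meanCovStieltjes p L z).re :=
    integral_re hI
  have him : ∫ x : Fin p → ι → ℝ, (covStieltjes z x).im ∂P = (meanCovStieltjes p L z).im :=
    integral_im hI
  have h1 := measureReal_abs_sub_integral_ge_le L (p := p) (ε := δ / 2) (by positivity)
    (f := fun x => (covStieltjes z x).re) (B := 1 / z.im) (c := 2 / (Fintype.card ι * z.im))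
    (Complex.continuous_re.comp (continuous_covStieltjes hz)).measurable
    (fun x => (Complex.abs_re_le_norm _).trans (norm_covStieltjes_le hz x))
    (fun x j v => by
      rw [← Complex.sub_re]
      exact (Complex.abs_re_le_norm _).trans (norm_covStieltjes_update_sub_le hz x j v))
  have h2 := measureReal_abs_sub_integral_ge_le L (p := p) (ε := δ / 2) (by positivity)
    (f := fun x => (covStieltjes z x).im) (B := 1 / z.im) (c := 2 / (Fintype.card ι * z.im))
    (Complex.continuous_im.comp (continuous_covStieltjes hz)).measurable
    (fun x => (Complex.abs_im_le_norm _).trans (norm_covStieltjes_le hz x))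
    (fun x j v => by
      rw [← Complex.sub_im]
      exact (Complex.abs_im_le_norm _).trans (norm_covStieltjes_update_sub_le hz x j v))
  rw [hre] at h1
  rw [him] at h2
  have hsub : {x : Fin p → ι → ℝ | δ ≤ ‖covStieltjes z x - meanCovStieltjes p L z‖}
      ⊆ {x | δ / 2 ≤ |(covStieltjes z x).re - (meanCovStieltjes p L z).re|}
        ∪ {x | δ / 2 ≤ |(covStieltjes z x).im - (meanCovStieltjes p L z).im|} := by
    intro x hx
    have hx' : δ ≤ ‖covStieltjes z x - meanCovStieltjes p L z‖ := hx
    have h := Complex.norm_le_abs_re_add_abs_im (covStieltjes z x - meanCovStieltjes p L z)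
    rw [Complex.sub_re, Complex.sub_im] at h
    by_contra hcon
    simp only [Set.mem_union, Set.mem_ofPred_eq, not_or, not_le] at hcon
    linarith [hcon.1, hcon.2]
  have h3 := (measureReal_mono (μ := P) hsub).trans (measureReal_union_le _ _)
  linarith

end

end Expectation

/-! ### Uniqueness for the self-consistent equation and passage to the limit -/

section SelfConsistentEquation

open scoped BoundedContinuousFunction

theorem im_le_im_sub_mul {z s : ℂ} (hs : s.im ≤ 0) {t : ℝ} (ht : 0 ≤ t) :
    z.im ≤ (z - s * t).im := by
  simp only [Complex.sub_im, Complex.mul_im, Complex.ofReal_re, Complex.ofReal_im, mul_zero,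
    zero_add]
  nlinarith

theorem im_le_norm_sub_mul {z s : ℂ} (hs : s.im ≤ 0) {t : ℝ} (ht : 0 ≤ t) :
    z.im ≤ ‖z - s * t‖ :=
  (im_le_im_sub_mul hs ht).trans ((le_abs_self _).trans (Complex.abs_im_le_norm _))

theorem norm_one_div_sub_mul_le {z s : ℂ} (hz : 0 < z.im) (hs : s.im ≤ 0) {t : ℝ} (ht : 0 ≤ t) :
    ‖1 / (z - s * t)‖ ≤ 1 / z.im := by
  rw [norm_div, norm_one]
  exact one_div_le_one_div_of_le hz (im_le_norm_sub_mul hs ht)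

theorem integrable_one_div_sub_mul {H : Measure ℝ} [IsFiniteMeasure H] (hH : ∀ᵐ t ∂H, 0 ≤ t)
    {z s : ℂ} (hz : 0 < z.im) (hs : s.im ≤ 0) :
    Integrable (fun t : ℝ => 1 / (z - s * (t : ℂ))) H := by
  refine Integrable.mono' (integrable_const (1 / z.im)) ?_ ?_
  · exact (Measurable.const_div (by fun_prop) _).aestronglyMeasurable
  · filter_upwards [hH] with t ht using norm_one_div_sub_mul_le hz hs ht

/-- `s` solves the self-consistent equation at `z`, written for `s = 1 - γ + γ z m(z)`. -/
structure IsCompanionSolution (H : Measure ℝ) (γ : ℝ) (z s : ℂ) : Prop where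
  im_nonpos : s.im ≤ 0
  im_div_nonpos : (s / z).im ≤ 0
  eq : s = 1 - γ + γ * z * ∫ t : ℝ, 1 / (z - s * (t : ℂ)) ∂H

variable {H : Measure ℝ} [IsProbabilityMeasure H] {γ : ℝ} {z s : ℂ}

theorem ne_zero_of_im_pos (hz : 0 < z.im) : z ≠ 0 := by
  rintro rfl
  simp at hz

/-- Limits preserve only weak inequalities; strictness is recovered from the equation. If g = s/z
were real, the right side would be real, so s = zg would be real, forcing g = 0; but s = 0 does not
solve the equation. -/
theorem IsCompanionSolution.im_div_neg (h : IsCompanionSolution H γ z s) (hz : 0 < z.im) :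
    (s / z).im < 0 := by
  refine lt_of_le_of_ne h.im_div_nonpos fun hg => ?_
  have hz0 := ne_zero_of_im_pos hz
  set g := s / z with hgdef
  have hsg : s = z * g := by rw [hgdef, mul_div_cancel₀ _ hz0]
  have hgr : g = (g.re : ℂ) := by
    apply Complex.ext <;> simp [hg]
  -- Pulling out constants and casting from the reals are valid for the Bochner integral without
  -- integrability, so none has to be checked here.
  have h1 : γ * z * ∫ t : ℝ, 1 / (z - s * (t : ℂ)) ∂H
      = (γ * ∫ t : ℝ, 1 / (1 - g.re * t) ∂H : ℝ) := by
    rw [mul_assoc, ← integral_const_mul]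
    push_cast
    rw [← integral_complex_ofReal]
    congr 1
    refine integral_congr_ae (Eventually.of_forall fun t => ?_)
    simp only
    rw [hsg, mul_assoc, ← mul_one_sub, mul_one_div, div_mul_cancel_left₀ hz0, hgr]
    simp
  have h2 := h.eq
  rw [h1] at h2
  have h3 : s.im = 0 := by
    have := congrArg Complex.im h2
    simpa using this
  rw [hsg, hgr, mul_comm, Complex.im_ofReal_mul] at h3
  have h4 : g.re = 0 := by
    rcases mul_eq_zero.1 h3 with h | h
    · exact h
    · exact absurd h hz.ne'
  have h5 : s = 0 := by rw [hsg, hgr, h4]; simp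
  have h6 := h.eq
  rw [h5] at h6
  simp [hz0] at h6

/-- In the variable g = s/z the equation isolates z, which makes two solutions at the same z
comparable. The bound comes from |1 - tg| ≥ t · (-Im g), so the transformed integrand is bounded
without a bound on the support of H. -/
theorem IsCompanionSolution.inv_add_eq (h : IsCompanionSolution H γ z s) (hz : 0 < z.im)
    (hH : ∀ᵐ t ∂H, 0 ≤ t) :
    (∀ᵐ t : ℝ ∂H, (1 : ℂ) - t * (s / z) ≠ 0) ∧
    (∀ᵐ t : ℝ ∂H, ‖(t : ℂ) / (1 - t * (s / z))‖ ≤ 1 / -(s / z).im) ∧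
    Integrable (fun t : ℝ => (t : ℂ) / (1 - t * (s / z))) H ∧
    z = (s / z)⁻¹ + γ * ∫ t : ℝ, (t : ℂ) / (1 - t * (s / z)) ∂H := by
  have hz0 := ne_zero_of_im_pos hz
  have hgim := h.im_div_neg hz
  have hs := h.im_nonpos
  have heq := h.eq
  set g := s / z with hgdef
  have hsg : s = z * g := by rw [hgdef, mul_div_cancel₀ _ hz0]
  have hg0 : g ≠ 0 := by
    intro h0; rw [h0] at hgim; simp at hgim
  have hne : ∀ᵐ t : ℝ ∂H, (1 : ℂ) - t * g ≠ 0 := by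
    filter_upwards [hH] with t ht h0
    have := sub_mul_eigenvalue_ne_zero hz hs ht
    apply this
    rw [hsg]
    linear_combination z * h0
  have hbd : ∀ᵐ t : ℝ ∂H, ‖(t : ℂ) / (1 - t * g)‖ ≤ 1 / -g.im := by
    filter_upwards [hH, hne] with t ht h0
    rw [norm_div, Complex.norm_real, Real.norm_of_nonneg ht,
      div_le_div_iff₀ (norm_pos_iff.2 h0) (by linarith)]
    have h1 := (le_abs_self _).trans (Complex.abs_im_le_norm ((1 : ℂ) - t * g))
    simp at h1
    linarith
  have hint : Integrable (fun t : ℝ => (t : ℂ) / (1 - t * g)) H := by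
    refine Integrable.mono' (integrable_const (1 / -g.im)) ?_ hbd
    exact (Measurable.div (by fun_prop) (by fun_prop)).aestronglyMeasurable
  refine ⟨hne, hbd, hint, ?_⟩
  have h1 : z * ∫ t : ℝ, 1 / (z - s * (t : ℂ)) ∂H
      = 1 + g * ∫ t : ℝ, (t : ℂ) / (1 - t * g) ∂H := by
    rw [← integral_const_mul, ← integral_const_mul]
    have hadd : 1 + ∫ t : ℝ, g * ((t : ℂ) / (1 - t * g)) ∂H
        = ∫ t : ℝ, (1 + g * ((t : ℂ) / (1 - t * g))) ∂H := by
      rw [integral_add (integrable_const _) (hint.const_mul _)]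
      simp
    rw [hadd]
    refine integral_congr_ae ?_
    filter_upwards [hne] with t h0
    have h2 : z - s * t ≠ 0 := by
      rw [hsg]
      intro h3
      have : z * (1 - t * g) = 0 := by linear_combination h3
      rcases mul_eq_zero.1 this with h | h
      · exact hz0 h
      · exact h0 h
    rw [show z - s * t = z * (1 - t * g) by rw [hsg]; ring]
    field_simp
    ring
  rw [mul_assoc, h1] at heq
  have h3 : z * g = 1 + γ * g * ∫ t : ℝ, (t : ℂ) / (1 - t * g) ∂H := by
    rw [← hsg, heq]; ring
  apply mul_right_cancel₀ hg0
  rw [h3, add_mul, inv_mul_cancel₀ hg0]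
  ring

/-- Take imaginary parts in z = 1/g + γ∫φ, where Im φ = Im g · |φ|². This gives Im z · |g|² = -Im g
· (1 - γ|g|²∫|φ|²); the left side and -Im g are positive, hence so is the bracket. -/
theorem IsCompanionSolution.contraction (h : IsCompanionSolution H γ z s) (hz : 0 < z.im)
    (hH : ∀ᵐ t ∂H, 0 ≤ t) :
    Integrable (fun t : ℝ => ‖(t : ℂ) / (1 - t * (s / z))‖ ^ 2) H ∧
    γ * (‖s / z‖ ^ 2 * ∫ t : ℝ, ‖(t : ℂ) / (1 - t * (s / z))‖ ^ 2 ∂H) < 1 := by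
  obtain ⟨hne, hbd, hint, heq⟩ := h.inv_add_eq hz hH
  have hgim := h.im_div_neg hz
  set g := s / z with hgdef
  have hsq : Integrable (fun t : ℝ => ‖(t : ℂ) / (1 - t * g)‖ ^ 2) H := by
    refine Integrable.mono' (integrable_const ((1 / -g.im) ^ 2)) ?_ ?_
    · exact ((Measurable.div (by fun_prop) (by fun_prop)).norm.pow_const 2).aestronglyMeasurable
    · filter_upwards [hbd] with t ht
      rw [norm_pow, norm_norm]
      exact pow_le_pow_left₀ (norm_nonneg _) ht 2
  refine ⟨hsq, ?_⟩
  have h1 : (∫ t : ℝ, (t : ℂ) / (1 - t * g) ∂H).im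
      = g.im * ∫ t : ℝ, ‖(t : ℂ) / (1 - t * g)‖ ^ 2 ∂H := by
    have h2 := integral_im hint
    simp only [RCLike.im_eq_complex_im] at h2
    rw [← h2, ← integral_const_mul]
    refine integral_congr_ae ?_
    filter_upwards [hne] with t h0
    have h3 : Complex.normSq (1 - t * g) ≠ 0 := by
      simpa [Complex.normSq_eq_zero] using h0
    rw [← Complex.normSq_eq_norm_sq, Complex.normSq_div, Complex.normSq_ofReal, Complex.div_im]
    simp
    field_simp
  have h4 := congrArg Complex.im heq
  rw [Complex.add_im, Complex.inv_im, Complex.im_ofReal_mul, h1, Complex.normSq_eq_norm_sq] at h4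
  have hgn : 0 < ‖g‖ ^ 2 := by
    have : g ≠ 0 := by intro h0; rw [h0] at hgim; simp at hgim
    positivity
  set I := ∫ t : ℝ, ‖(t : ℂ) / (1 - t * g)‖ ^ 2 ∂H
  have h5 : z.im * ‖g‖ ^ 2 = -g.im * (1 - γ * (‖g‖ ^ 2 * I)) := by
    rw [h4, add_mul, div_mul_cancel₀ _ hgn.ne']; ring
  have h6 : 0 < -g.im * (1 - γ * (‖g‖ ^ 2 * I)) := by rw [← h5]; positivity
  have h7 := (pos_iff_pos_of_mul_pos h6).1 (by linarith)
  linarith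

/-- The self-consistent equation has at most one solution at each point of the upper half
plane. -/
theorem IsCompanionSolution.unique {s' : ℂ} (h : IsCompanionSolution H γ z s)
    (h' : IsCompanionSolution H γ z s') (hγ : 0 < γ) (hz : 0 < z.im) (hH : ∀ᵐ t ∂H, 0 ≤ t) :
    s = s' := by
  have hz0 := ne_zero_of_im_pos hz
  obtain ⟨hne, hbd, hint, heq⟩ := h.inv_add_eq hz hH
  obtain ⟨hne', hbd', hint', heq'⟩ := h'.inv_add_eq hz hH
  obtain ⟨hsq, hlt⟩ := h.contraction hz hH
  obtain ⟨hsq', hlt'⟩ := h'.contraction hz hH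
  have hgim := h.im_div_neg hz
  have hgim' := h'.im_div_neg hz
  suffices hgg : s / z = s' / z by
    field_simp at hgg
    exact hgg
  set g := s / z with hgdef
  set g' := s' / z with hgdef'
  by_contra hcon
  have hg0 : g ≠ 0 := by intro h0; rw [h0] at hgim; simp at hgim
  have hg0' : g' ≠ 0 := by intro h0; rw [h0] at hgim'; simp at hgim'
  set φ : ℝ → ℂ := fun t => (t : ℂ) / (1 - t * g) with hφ
  set φ' : ℝ → ℂ := fun t => (t : ℂ) / (1 - t * g') with hφ'
  have hdiff : ∫ t, φ t ∂H - ∫ t, φ' t ∂H = (g - g') * ∫ t, φ t * φ' t ∂H := by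
    rw [← integral_sub hint hint', ← integral_const_mul]
    refine integral_congr_ae ?_
    filter_upwards [hne, hne'] with t h0 h0'
    simp only [hφ, hφ']
    field_simp
    ring
  -- Subtracting the two equations and cancelling g - g' gives this identity. The inequality between
  -- geometric and arithmetic means bounds its left side by the average of the two contraction
  -- constants, both below 1.
  have hone : γ * (g * g' * ∫ t, φ t * φ' t ∂H) = 1 := by
    have e1 : g⁻¹ - g'⁻¹ + γ * ((g - g') * ∫ t, φ t * φ' t ∂H) = 0 := by
      rw [← hdiff]
      linear_combination heq' - heq
    have e2 : (g - g') * (γ * (g * g' * ∫ t, φ t * φ' t ∂H) - 1) = 0 := by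
      have e3 : g⁻¹ - g'⁻¹ = (g' - g) / (g * g') := by field_simp
      rw [e3] at e1
      have e4 := congrArg (fun w => w * (g * g')) e1
      simp only [add_mul, zero_mul] at e4
      rw [div_mul_cancel₀ _ (mul_ne_zero hg0 hg0')] at e4
      linear_combination e4
    rcases mul_eq_zero.1 e2 with h | h
    · exact absurd (sub_eq_zero.1 h) hcon
    · exact sub_eq_zero.1 h
  have hnorm : ‖g * g' * ∫ t, φ t * φ' t ∂H‖
      ≤ (‖g‖ ^ 2 * ∫ t, ‖φ t‖ ^ 2 ∂H + ‖g'‖ ^ 2 * ∫ t, ‖φ' t‖ ^ 2 ∂H) / 2 := by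
    rw [← integral_const_mul]
    refine (norm_integral_le_integral_norm _).trans ?_
    rw [← integral_const_mul, ← integral_const_mul,
      ← integral_add (hsq.const_mul _) (hsq'.const_mul _), ← integral_div]
    refine integral_mono_of_nonneg (Eventually.of_forall fun t => norm_nonneg _)
      (((hsq.const_mul _).add (hsq'.const_mul _)).div_const 2) (Eventually.of_forall fun t => ?_)
    simp only [norm_mul]
    change ‖g‖ * ‖g'‖ * (‖φ t‖ * ‖φ' t‖) ≤ (‖g‖ ^ 2 * ‖φ t‖ ^ 2 + ‖g'‖ ^ 2 * ‖φ' t‖ ^ 2) / 2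
    nlinarith [sq_nonneg (‖g‖ * ‖φ t‖ - ‖g'‖ * ‖φ' t‖)]
  have h1 : (1 : ℝ) = γ * ‖g * g' * ∫ t, φ t * φ' t ∂H‖ := by
    have := congrArg norm hone
    rw [norm_mul, Complex.norm_real, Real.norm_of_nonneg hγ.le, norm_one] at this
    exact this.symm
  have h2 := mul_le_mul_of_nonneg_left hnorm hγ.le
  rw [← h1] at h2
  linarith

/-! ### Passing to the limit -/

theorem ae_nonneg_of_tendsto {ι : Type*} {l : Filter ι} [l.NeBot] {Hs : ι → FiniteMeasure ℝ}
    {H : FiniteMeasure ℝ} (h : Tendsto Hs l (𝓝 H))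
    (hs : ∀ n, ∀ᵐ t ∂(Hs n : Measure ℝ), 0 ≤ t) : ∀ᵐ t ∂(H : Measure ℝ), 0 ≤ t := by
  let f : ℝ →ᵇ ℝ := BoundedContinuousFunction.ofNormedAddCommGroup
    (fun t => min 1 (max 0 (-t))) (by fun_prop) 1 (fun t => by
      rw [Real.norm_of_nonneg (le_min zero_le_one (le_max_left _ _))]
      exact min_le_left _ _)
  have hf : ∀ t, f t = min 1 (max 0 (-t)) := fun _ => rfl
  have h1 := FiniteMeasure.tendsto_iff_forall_integral_tendsto.1 h f
  have h2 : ∀ n, ∫ t, f t ∂(Hs n : Measure ℝ) = 0 := by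
    intro n
    refine integral_eq_zero_of_ae ?_
    filter_upwards [hs n] with t ht
    rw [hf, max_eq_left (by linarith)]
    simp
  simp_rw [h2] at h1
  have h3 := tendsto_nhds_unique h1 tendsto_const_nhds
  have h4 := (integral_eq_zero_iff_of_nonneg (μ := (H : Measure ℝ)) (f := f)
    (fun t => le_min zero_le_one (le_max_left _ _)) (f.integrable _)).1 h3
  filter_upwards [h4] with t ht
  by_contra! hneg
  have h5 : 0 < min 1 (max 0 (-t)) := lt_min one_pos (lt_max_of_lt_right (by linarith))
  rw [Pi.zero_apply, hf] at ht
  linarith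

/-- Split the change: weak convergence handles the fixed limit parameter s, while the integrand is
Lipschitz in s with constant K/y² on [0, K], uniformly in the measures. Total mass at most 1, rather
than equal to 1, accommodates empty matrices, whose spectral distribution is zero. -/
theorem tendsto_integral_one_div_sub_mul {ι : Type*} {l : Filter ι} {Hs : ι → FiniteMeasure ℝ}
    {H : FiniteMeasure ℝ} (h : Tendsto Hs l (𝓝 H)) {K : ℝ}
    (hHs : ∀ n, ∀ᵐ t ∂(Hs n : Measure ℝ), 0 ≤ t ∧ t ≤ K)
    (hmass : ∀ n, (Hs n : Measure ℝ).real Set.univ ≤ 1)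
    (hH : ∀ᵐ t ∂(H : Measure ℝ), 0 ≤ t) {z : ℂ} (hz : 0 < z.im) {ss : ι → ℂ} {s : ℂ}
    (hss : Tendsto ss l (𝓝 s)) (hs : s.im ≤ 0) (hssim : ∀ᶠ n in l, (ss n).im ≤ 0) :
    Tendsto (fun n => ∫ t : ℝ, 1 / (z - ss n * (t : ℂ)) ∂(Hs n : Measure ℝ)) l
      (𝓝 (∫ t : ℝ, 1 / (z - s * (t : ℂ)) ∂(H : Measure ℝ))) := by
  -- Truncation at 0 makes the test function bounded and continuous on the whole line; for negative
  -- t the denominator could vanish.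
  let f : ℝ →ᵇ ℂ := BoundedContinuousFunction.ofNormedAddCommGroup
    (fun t => 1 / (z - s * ((max t 0 : ℝ) : ℂ)))
    (continuous_const.div (by fun_prop) fun t =>
      sub_mul_eigenvalue_ne_zero hz hs (le_max_right _ _)) (1 / z.im)
    (fun t => norm_one_div_sub_mul_le hz hs (le_max_right _ _))
  have hf : ∀ t : ℝ, 0 ≤ t → f t = 1 / (z - s * (t : ℂ)) := by
    intro t ht
    change 1 / (z - s * ((max t 0 : ℝ) : ℂ)) = _
    rw [max_eq_left ht]
  have h1 := (FiniteMeasure.tendsto_iff_forall_integral_rclike_tendsto ℂ).1 h f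
  have e1 : ∀ n, ∫ t, f t ∂(Hs n : Measure ℝ)
      = ∫ t : ℝ, 1 / (z - s * (t : ℂ)) ∂(Hs n : Measure ℝ) := by
    intro n
    refine integral_congr_ae ?_
    filter_upwards [hHs n] with t ht using hf t ht.1
  have e2 : ∫ t, f t ∂(H : Measure ℝ) = ∫ t : ℝ, 1 / (z - s * (t : ℂ)) ∂(H : Measure ℝ) := by
    refine integral_congr_ae ?_
    filter_upwards [hH] with t ht using hf t ht
  rw [e2] at h1
  simp_rw [e1] at h1
  have h2 : Tendsto (fun n => ∫ t : ℝ, 1 / (z - ss n * (t : ℂ)) ∂(Hs n : Measure ℝ)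
      - ∫ t : ℝ, 1 / (z - s * (t : ℂ)) ∂(Hs n : Measure ℝ)) l (𝓝 0) := by
    have hb : Tendsto (fun n => ‖ss n - s‖ * (|K| / z.im ^ 2)) l (𝓝 0) := by
      have := (tendsto_iff_norm_sub_tendsto_zero.1 hss).mul_const (|K| / z.im ^ 2)
      simpa using this
    refine squeeze_zero_norm' ?_ hb
    filter_upwards [hssim] with n hn
    have hpos : ∀ᵐ t ∂(Hs n : Measure ℝ), 0 ≤ t := (hHs n).mono fun t ht => ht.1
    rw [← integral_sub (integrable_one_div_sub_mul hpos hz hn)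
      (integrable_one_div_sub_mul hpos hz hs)]
    have hbd : ∀ᵐ t : ℝ ∂(Hs n : Measure ℝ),
        ‖1 / (z - ss n * (t : ℂ)) - 1 / (z - s * (t : ℂ))‖ ≤ ‖ss n - s‖ * (|K| / z.im ^ 2) := by
      filter_upwards [hHs n] with t ht
      have n1 := sub_mul_eigenvalue_ne_zero hz hn ht.1
      have n2 := sub_mul_eigenvalue_ne_zero hz hs ht.1
      have : 1 / (z - ss n * (t : ℂ)) - 1 / (z - s * (t : ℂ))
          = (ss n - s) * (t * ((1 / (z - ss n * (t : ℂ))) * (1 / (z - s * (t : ℂ))))) := by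
        rw [← mul_assoc, show (ss n - s) * (t : ℂ) = (z - s * t) - (z - ss n * t) by ring]
        generalize z - s * (t : ℂ) = b at *
        generalize z - ss n * (t : ℂ) = a at *
        field_simp
      rw [this, norm_mul, norm_mul, norm_mul, Complex.norm_real, Real.norm_of_nonneg ht.1]
      refine mul_le_mul_of_nonneg_left ?_ (norm_nonneg _)
      have b1 := norm_one_div_sub_mul_le hz hn ht.1
      have b2 := norm_one_div_sub_mul_le hz hs ht.1
      calc t * (‖1 / (z - ss n * (t : ℂ))‖ * ‖1 / (z - s * (t : ℂ))‖)
          ≤ |K| * (1 / z.im * (1 / z.im)) :=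
            mul_le_mul (ht.2.trans (le_abs_self K))
              (mul_le_mul b1 b2 (norm_nonneg _) (by positivity)) (by positivity) (abs_nonneg _)
        _ = _ := by ring
    refine (norm_integral_le_of_norm_le_const hbd).trans ?_
    exact mul_le_of_le_one_right (by positivity) (hmass n)
  simpa using h2.add h1

section Limit

variable {Hs : ℕ → FiniteMeasure ℝ} {H : ProbabilityMeasure ℝ} {K γ : ℝ} {z : ℂ}
  {γs : ℕ → ℝ} {M : ℕ → ℂ}

theorem isCompanionSolution_of_tendsto (hlim : Tendsto Hs atTop (𝓝 H.toFiniteMeasure))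
    (hHs : ∀ n, ∀ᵐ t ∂(Hs n : Measure ℝ), 0 ≤ t ∧ t ≤ K)
    (hmass : ∀ n, (Hs n : Measure ℝ).real Set.univ ≤ 1) (hz : 0 < z.im)
    (hγs : Tendsto γs atTop (𝓝 γ))
    (him : ∀ᶠ n in atTop, (1 - γs n + γs n * z * M n : ℂ).im ≤ 0)
    (himd : ∀ᶠ n in atTop, ((1 - γs n + γs n * z * M n : ℂ) / z).im ≤ 0)
    (heq : Tendsto (fun n => M n - ∫ t : ℝ, 1 / (z - (1 - γs n + γs n * z * M n) * (t : ℂ))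
      ∂(Hs n : Measure ℝ)) atTop (𝓝 0))
    {φ : ℕ → ℕ} (hφ : Tendsto φ atTop atTop) {m : ℂ} (hm : Tendsto (M ∘ φ) atTop (𝓝 m)) :
    m = ∫ t : ℝ, 1 / (z - (1 - γ + γ * z * m) * (t : ℂ)) ∂(H : Measure ℝ) ∧
      IsCompanionSolution H γ z (1 - γ + γ * z * m) := by
  have hγC : Tendsto (fun n => ((γs (φ n) : ℝ) : ℂ)) atTop (𝓝 γ) :=
    (Complex.continuous_ofReal.tendsto _).comp (hγs.comp hφ)
  have hs : Tendsto (fun n => (1 - γs (φ n) + γs (φ n) * z * M (φ n) : ℂ)) atTop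
      (𝓝 (1 - γ + γ * z * m)) :=
    (tendsto_const_nhds.sub hγC).add ((hγC.mul_const z).mul hm)
  have hs1 : (1 - γ + γ * z * m : ℂ).im ≤ 0 :=
    le_of_tendsto ((Complex.continuous_im.tendsto _).comp hs) (hφ.eventually him)
  have hs2 : ((1 - γ + γ * z * m : ℂ) / z).im ≤ 0 :=
    le_of_tendsto ((Complex.continuous_im.tendsto _).comp (hs.div_const z)) (hφ.eventually himd)
  have hH0 : ∀ᵐ t ∂(H : Measure ℝ), 0 ≤ t :=
    ae_nonneg_of_tendsto hlim fun n => (hHs n).mono fun t ht => ht.1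
  have h1 := tendsto_integral_one_div_sub_mul (hlim.comp hφ) (fun n => hHs (φ n))
    (fun n => hmass (φ n)) hH0 hz hs hs1 (hφ.eventually him)
  have h2 := (heq.comp hφ).add h1
  have h3 : m = ∫ t : ℝ, 1 / (z - (1 - γ + γ * z * m) * (t : ℂ)) ∂(H : Measure ℝ) := by
    refine tendsto_nhds_unique hm ?_
    refine Tendsto.congr (fun n => ?_) (by simpa using h2)
    simp
  exact ⟨h3, hs1, hs2, by rw [← h3]⟩

/-- The sequence is eventually in a compact disc and every subsequential limit gives a solution of
the limiting equation. Uniqueness determines s, hence m, because γz ≠ 0. -/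
theorem exists_tendsto_of_approx_solution (hlim : Tendsto Hs atTop (𝓝 H.toFiniteMeasure))
    (hHs : ∀ n, ∀ᵐ t ∂(Hs n : Measure ℝ), 0 ≤ t ∧ t ≤ K)
    (hmass : ∀ n, (Hs n : Measure ℝ).real Set.univ ≤ 1) (hz : 0 < z.im)
    (hγ : 0 < γ) (hγs : Tendsto γs atTop (𝓝 γ)) (hM : ∀ᶠ n in atTop, ‖M n‖ ≤ 1 / z.im)
    (him : ∀ᶠ n in atTop, (1 - γs n + γs n * z * M n : ℂ).im ≤ 0)
    (himd : ∀ᶠ n in atTop, ((1 - γs n + γs n * z * M n : ℂ) / z).im ≤ 0)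
    (heq : Tendsto (fun n => M n - ∫ t : ℝ, 1 / (z - (1 - γs n + γs n * z * M n) * (t : ℂ))
      ∂(Hs n : Measure ℝ)) atTop (𝓝 0)) :
    ∃ m, Tendsto M atTop (𝓝 m) := by
  have hH0 : ∀ᵐ t ∂(H : Measure ℝ), 0 ≤ t :=
    ae_nonneg_of_tendsto hlim fun n => (hHs n).mono fun t ht => ht.1
  have hz0 := ne_zero_of_im_pos hz
  have hcomp := isCompact_closedBall (0 : ℂ) (1 / z.im)
  have hfreq : ∀ ns : ℕ → ℕ, Tendsto ns atTop atTop → ∃ m, ∃ ψ : ℕ → ℕ,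
      Tendsto ψ atTop atTop ∧ Tendsto (fun n => M (ns (ψ n))) atTop (𝓝 m) := by
    intro ns hns
    have h1 : ∃ᶠ n in atTop, M (ns n) ∈ Metric.closedBall (0 : ℂ) (1 / z.im) :=
      ((hns.eventually hM).mono fun n hn => by simpa using hn).frequently
    obtain ⟨m, -, ψ, hψ, hm⟩ := hcomp.tendsto_subseq' h1
    exact ⟨m, ψ, hψ.tendsto_atTop, hm⟩
  obtain ⟨m, φ, hφ, hm⟩ := hfreq id tendsto_id
  refine ⟨m, tendsto_of_subseq_tendsto fun ns hns => ?_⟩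
  obtain ⟨m', ψ, hψ, hm'⟩ := hfreq ns hns
  refine ⟨ψ, ?_⟩
  have h1 := (isCompanionSolution_of_tendsto hlim hHs hmass hz hγs him himd heq hφ hm).2
  have h2 := (isCompanionSolution_of_tendsto hlim hHs hmass hz hγs him himd heq
    (hns.comp hψ) hm').2
  have h3 := h1.unique h2 hγ hz hH0
  have hγ0 : (γ : ℂ) * z ≠ 0 := mul_ne_zero (by exact_mod_cast hγ.ne') hz0
  have h4 : m = m' := mul_left_cancel₀ hγ0 (add_left_cancel h3)
  rw [h4]
  exact hm'

end Limit

end SelfConsistentEquation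

/-! ### Concentration of quadratic forms for the coloured tensor law -/

section ColouredTensorLaw

open Matrix
open scoped Matrix.Norms.L2Operator

variable {n d : ℕ} {ν : Measure ℝ}

theorem continuous_tensorVector : Continuous (tensorVector (n := n) d) :=
  continuous_pi fun _ => continuous_finsetProd _ fun i _ => continuous_apply i

theorem continuous_mulVec_tensorVector (A : Matrix (TensorIndex n d) (TensorIndex n d) ℝ) :
    Continuous fun x : Fin n → ℝ => A *ᵥ tensorVector d x :=
  Continuous.matrix_mulVec continuous_const continuous_tensorVector

theorem colouredTensorLaw_eq_map (T : Matrix (TensorIndex n d) (TensorIndex n d) ℝ) :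
    colouredTensorLaw ν T
      = (Measure.pi fun _ : Fin n => ν).map fun x => CFC.sqrt T *ᵥ tensorVector d x := by
  unfold colouredTensorLaw tensorLaw
  have h : Continuous fun v => CFC.sqrt T *ᵥ v :=
    Continuous.matrix_mulVec continuous_const continuous_id
  rw [Measure.map_map h.measurable continuous_tensorVector.measurable]
  rfl

variable [IsProbabilityMeasure ν]

instance (T : Matrix (TensorIndex n d) (TensorIndex n d) ℝ) :
    IsProbabilityMeasure (colouredTensorLaw ν T) := by
  rw [colouredTensorLaw_eq_map]
  exact Measure.isProbabilityMeasure_map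
    (continuous_mulVec_tensorVector _).measurable.aemeasurable

/-- The variance of |Y| is nonnegative. -/
theorem integral_abs_le_sqrt_integral_sq {Ω : Type*} [MeasurableSpace Ω] {P : Measure Ω}
    [IsProbabilityMeasure P] {Y : Ω → ℝ} (hY : AEStronglyMeasurable Y P)
    (hY2 : Integrable (fun ω => Y ω ^ 2) P) :
    Integrable Y P ∧ ∫ ω, |Y ω| ∂P ≤ √(∫ ω, Y ω ^ 2 ∂P) := by
  have hI : Integrable Y P := by
    refine Integrable.mono' ((integrable_const 1).add hY2) hY (Eventually.of_forall fun ω => ?_)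
    rw [Real.norm_eq_abs, Pi.add_apply]
    nlinarith [sq_nonneg (|Y ω| - 1), sq_abs (Y ω)]
  refine ⟨hI, Real.le_sqrt_of_sq_le ?_⟩
  set m := ∫ ω, |Y ω| ∂P with hm
  have h1 : 0 ≤ ∫ ω, (|Y ω| - m) ^ 2 ∂P := integral_nonneg fun ω => sq_nonneg _
  have h2 : ∀ ω, (|Y ω| - m) ^ 2 = Y ω ^ 2 - 2 * m * |Y ω| + m ^ 2 := by
    intro ω
    rw [← sq_abs (Y ω)]
    ring
  simp_rw [h2] at h1
  have h3 : Integrable (fun ω => Y ω ^ 2 - 2 * m * |Y ω|) P := hY2.sub (hI.abs.const_mul _)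
  rw [integral_add h3 (integrable_const _), integral_sub hY2 (hI.abs.const_mul _),
    integral_const_mul, ← hm] at h1
  simp at h1
  nlinarith

theorem realQuad_mulVec_of_isHermitian {ι : Type*} [Fintype ι] (A : Matrix ι ι ℝ)
    (hA : A.IsHermitian) (B : Matrix ι ι ℂ) (v : ι → ℝ) :
    realQuad B (A *ᵥ v) = realQuad (complexify A * B * complexify A) v := by
  unfold realQuad
  rw [← complexify_mulVec, ← mulVec_mulVec, ← mulVec_mulVec, dotProduct_mulVec _ (complexify A),
    ← mulVec_transpose, transpose_complexify A hA]

theorem realQuad_sub_trace_eq (B : Matrix (TensorIndex n d) (TensorIndex n d) ℂ) (x : Fin n → ℝ) :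
    realQuad B (tensorVector d x) - B.trace
      = ∑ p : TensorIndex n d × TensorIndex n d, B p.1 p.2 *
        ((tensorVector d x p.1 * tensorVector d x p.2 - if p.1 = p.2 then 1 else 0 : ℝ) : ℂ) := by
  rw [Fintype.sum_prod_type]
  have h1 : realQuad B (tensorVector d x) = ∑ s, ∑ t, B s t *
      ((tensorVector d x s : ℂ) * (tensorVector d x t : ℂ)) := by
    simp only [realQuad, dotProduct, mulVec, Finset.mul_sum]
    exact Finset.sum_congr rfl fun s _ => Finset.sum_congr rfl fun t _ => by ring
  have h2 : B.trace = ∑ s, ∑ t, B s t * (if s = t then 1 else 0) := by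
    simp [trace]
  rw [h1, h2, ← Finset.sum_sub_distrib]
  refine Finset.sum_congr rfl fun s _ => ?_
  rw [← Finset.sum_sub_distrib]
  refine Finset.sum_congr rfl fun t _ => ?_
  split_ifs <;> push_cast <;> ring

theorem tensorErr_nonneg {κ : ℝ} (hκ : 1 ≤ κ) : 0 ≤ tensorErr n d κ := by
  have hbase : 1 ≤ 1 + (κ - 1) * ((d : ℝ) / n) :=
    le_add_of_nonneg_right (mul_nonneg (by linarith) (by positivity))
  have hpow : 1 ≤ (1 + (κ - 1) * ((d : ℝ) / n)) ^ d := one_le_pow₀ hbase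
  unfold tensorErr
  have : 0 ≤ 2 * d * ((d : ℝ) / n) * (1 + (κ - 1) * ((d : ℝ) / n)) ^ d := by positivity
  linarith

/-- Apply the real variance bound to the real and imaginary parts of B, whence the factor 2. Each
has squared Frobenius norm at most N‖B‖², so its standard deviation is at most N‖B‖ times the root
of the relative error. -/
theorem integral_norm_realQuad_tensor_le (h : IsSymmUnit ν) (hn : 0 < n) (hdn : d ≤ n)
    (B : Matrix (TensorIndex n d) (TensorIndex n d) ℂ) :
    ∫ x, ‖realQuad B (tensorVector d x) - B.trace‖ ∂(Measure.pi fun _ : Fin n => ν)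
      ≤ 2 * √(tensorErr n d (∫ x, x ^ 4 ∂ν)) * n.choose d * ‖B‖ := by
  set P := Measure.pi fun _ : Fin n => ν
  set e := tensorErr n d (∫ x, x ^ 4 ∂ν) with he
  have he0 : 0 ≤ e := tensorErr_nonneg h.one_le_fourth
  let Y : (TensorIndex n d × TensorIndex n d → ℝ) → (Fin n → ℝ) → ℝ := fun b x =>
    ∑ p, b p * (tensorVector d x p.1 * tensorVector d x p.2 - if p.1 = p.2 then 1 else 0)
  have hYc : ∀ b, Continuous (Y b) := by
    intro b
    have hc : ∀ s : TensorIndex n d, Continuous fun x : Fin n → ℝ => tensorVector d x s := fun s =>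
      (continuous_apply s).comp continuous_tensorVector
    exact continuous_finsetSum _ fun p _ =>
      continuous_const.mul (((hc p.1).mul (hc p.2)).sub continuous_const)
  have hY : ∀ b, (∑ p, b p ^ 2 ≤ n.choose d * ‖B‖ ^ 2) →
      Integrable (Y b) P ∧ ∫ x, |Y b x| ∂P ≤ √e * n.choose d * ‖B‖ := by
    intro b hb
    obtain ⟨hI, hle⟩ := integral_sq_tensor_quadratic_le h hn hdn b
    obtain ⟨hI1, hle1⟩ := integral_abs_le_sqrt_integral_sq (hYc b).aestronglyMeasurable hI
    refine ⟨hI1, hle1.trans (Real.sqrt_le_iff.2 ⟨by positivity, ?_⟩)⟩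
    refine hle.trans ?_
    rw [mul_pow, mul_pow, Real.sq_sqrt he0]
    calc n.choose d * e * ∑ p, b p ^ 2 ≤ n.choose d * e * (n.choose d * ‖B‖ ^ 2) :=
          mul_le_mul_of_nonneg_left hb (by positivity)
      _ = _ := by ring
  have hfro := sum_sq_norm_entries_le B
  rw [card_tensorIndex] at hfro
  have h1 := hY (fun p => (B p.1 p.2).re) (le_trans (Finset.sum_le_sum fun p _ => by
    rw [← sq_abs]
    exact pow_le_pow_left₀ (abs_nonneg _) (Complex.abs_re_le_norm _) 2) hfro)
  have h2 := hY (fun p => (B p.1 p.2).im) (le_trans (Finset.sum_le_sum fun p _ => by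
    rw [← sq_abs]
    exact pow_le_pow_left₀ (abs_nonneg _) (Complex.abs_im_le_norm _) 2) hfro)
  have hpt : ∀ x, ‖realQuad B (tensorVector d x) - B.trace‖
      ≤ |Y (fun p => (B p.1 p.2).re) x| + |Y (fun p => (B p.1 p.2).im) x| := by
    intro x
    rw [realQuad_sub_trace_eq]
    refine (Complex.norm_le_abs_re_add_abs_im _).trans (le_of_eq ?_)
    congr 2
    · rw [Complex.re_sum]
      exact Finset.sum_congr rfl fun p _ => by rw [Complex.re_mul_ofReal]
    · rw [Complex.im_sum]
      exact Finset.sum_congr rfl fun p _ => by rw [Complex.im_mul_ofReal]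
  refine (integral_mono_of_nonneg (Eventually.of_forall fun x => norm_nonneg _)
    (h1.1.abs.add h2.1.abs) (Eventually.of_forall hpt)).trans ?_
  have h3 := integral_add h1.1.abs h2.1.abs
  simp only [Pi.add_apply]
  rw [h3]
  linarith [h1.2, h2.2]

/-- Quadratic forms in a coloured tensor vector concentrate around their means. -/
theorem concentratedColumn_colouredTensorLaw (h : IsSymmUnit ν) (hn : 0 < n) (hdn : d ≤ n)
    {T : Matrix (TensorIndex n d) (TensorIndex n d) ℝ} (hT : T.PosSemidef) {K : ℝ}
    (hK : ‖complexify T‖ ≤ K) :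
    ConcentratedColumn (colouredTensorLaw ν T) T K
      (2 * K * √(tensorErr n d (∫ x, x ^ 4 ∂ν))) := by
  set P := Measure.pi fun _ : Fin n => ν with hP
  set S := CFC.sqrt T with hS
  have hSh : S.IsHermitian := isHermitian_sqrt T
  have hSS : S * S = T := sqrt_mul_sqrt_of_posSemidef hT
  have hlaw : colouredTensorLaw ν T = P.map fun x => S *ᵥ tensorVector d x :=
    colouredTensorLaw_eq_map T
  have hm := (continuous_mulVec_tensorVector (n := n) (d := d) S).measurable
  have hsq : ∀ i, ∀ x : Fin n → ℝ, (S *ᵥ tensorVector d x) i ^ 2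
      = ∑ k, ∑ l, S i k * S i l * (tensorVector d x k * tensorVector d x l) := by
    intro i x
    rw [sq, mulVec, dotProduct, Finset.sum_mul_sum]
    exact Finset.sum_congr rfl fun k _ => Finset.sum_congr rfl fun l _ => by ring
  have hI : ∀ i k l, Integrable (fun x : Fin n → ℝ =>
      S i k * S i l * (tensorVector d x k * tensorVector d x l)) P := fun i k l =>
    (integrable_tensorVector_mul h k l).const_mul _
  refine ⟨hT, hK, fun i => ?_, ?_, fun B => ?_⟩
  · rw [hlaw, integrable_map_measure
      ((measurable_pi_apply i).pow_const 2).aestronglyMeasurable hm.aemeasurable]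
    simp only [Function.comp_def]
    simp_rw [hsq]
    exact integrable_finsetSum _ fun k _ => integrable_finsetSum _ fun l _ => hI i k l
  · have h1 : ∀ i, ∫ v, v i ^ 2 ∂(colouredTensorLaw ν T) = T i i := by
      intro i
      rw [hlaw, integral_map hm.aemeasurable
        ((measurable_pi_apply i).pow_const 2).aestronglyMeasurable]
      simp_rw [hsq]
      rw [integral_finsetSum _ fun k _ => integrable_finsetSum _ fun l _ => hI i k l]
      have h2 : ∀ k, ∫ x, ∑ l, S i k * S i l * (tensorVector d x k * tensorVector d x l) ∂P
          = S i k * S i k := by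
        intro k
        rw [integral_finsetSum _ fun l _ => hI i k l]
        have h3 : ∀ l, ∫ x, S i k * S i l * (tensorVector d x k * tensorVector d x l) ∂P
            = S i k * S i l * if k = l then 1 else 0 := fun l => by
          rw [integral_const_mul, integral_tensorVector_mul h]
        rw [Finset.sum_congr rfl fun l _ => h3 l]
        simp
      rw [Finset.sum_congr rfl fun k _ => h2 k]
      conv_rhs => rw [← hSS, mul_apply]
      refine Finset.sum_congr rfl fun k _ => ?_
      have := congrFun (congrFun hSh i) k
      simp only [conjTranspose_apply, star_trivial] at this
      rw [this]
    simp_rw [h1]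
    have h3 := (norm_trace_le (complexify T)).trans
      (mul_le_mul_of_nonneg_left hK (Nat.cast_nonneg _))
    have h4 : (complexify T).trace = ((∑ i, T i i : ℝ) : ℂ) := by
      simp [trace]
    rw [h4, Complex.norm_real] at h3
    rw [mul_comm]
    exact (le_abs_self _).trans h3
  · have hmeas : Continuous fun v : TensorIndex n d → ℝ =>
        ‖realQuad B v - (B * complexify T).trace‖ :=
      ((continuous_realQuad continuous_const continuous_id).sub continuous_const).norm
    rw [hlaw, integral_map hm.aemeasurable hmeas.aestronglyMeasurable]
    -- The colouring is absorbed into the matrix: with S the root of T, both the form and its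
    -- centring become those of SBS for the uncoloured vector, and ‖SBS‖ ≤ ‖T‖‖B‖.
    have htr : (B * complexify T).trace = (complexify S * B * complexify S).trace := by
      rw [Matrix.mul_assoc, trace_mul_comm (complexify S), Matrix.mul_assoc, ← complexify_mul, hSS]
    simp_rw [realQuad_mulVec_of_isHermitian S hSh, htr]
    refine (integral_norm_realQuad_tensor_le h hn hdn _).trans ?_
    have hnorm : ‖complexify S * B * complexify S‖ ≤ K * ‖B‖ := by
      calc _ ≤ ‖complexify S‖ * ‖B‖ * ‖complexify S‖ :=
            (l2_opNorm_mul _ _).trans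
              (mul_le_mul_of_nonneg_right (l2_opNorm_mul _ _) (norm_nonneg _))
        _ = (‖complexify S‖ * ‖complexify S‖) * ‖B‖ := by ring
        _ = ‖complexify T‖ * ‖B‖ := by rw [norm_complexify_sqrt_sq hT]
        _ ≤ K * ‖B‖ := mul_le_mul_of_nonneg_right hK (norm_nonneg _)
    calc _ ≤ 2 * √(tensorErr n d (∫ x, x ^ 4 ∂ν)) * n.choose d * (K * ‖B‖) :=
          mul_le_mul_of_nonneg_left hnorm (by positivity)
      _ = _ := by rw [card_tensorIndex]; ring

end ColouredTensorLaw

/-! ### The growth condition and the size of the binomial coefficient -/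

section Asymptotics

/-- Use (1 + x)^d ≤ exp(dx) with dx = (κ - 1)d²/n ≤ 4C²d²/n = 4η. The bound on κ is the moment
hypothesis at k = 2. -/
theorem tensorErr_le {n d : ℕ} {κ C η : ℝ} (hκ1 : 1 ≤ κ) (hκ : κ ≤ (C * 2) ^ 2)
    (hC : 1 ≤ C) (hη : η = (C * d / √(n : ℝ)) ^ 2) :
    tensorErr n d κ ≤ (Real.exp (4 * η) - 1) + 2 * η * Real.exp (4 * η) := by
  have hη0 : 0 ≤ η := by rw [hη]; positivity
  have hη' : η = C ^ 2 * (d * ((d : ℝ) / n)) := by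
    rw [hη, div_pow, Real.sq_sqrt (Nat.cast_nonneg _)]; ring
  have hdd : 0 ≤ d * ((d : ℝ) / n) := by positivity
  have h1 : d * ((d : ℝ) / n) ≤ η := by
    rw [hη']
    exact le_mul_of_one_le_left hdd (one_le_pow₀ hC)
  have h2 : d * ((κ - 1) * ((d : ℝ) / n)) ≤ 4 * η := by
    have : (κ - 1) ≤ 4 * C ^ 2 := by linarith [hκ, show (C * 2) ^ 2 = 4 * C ^ 2 by ring]
    calc d * ((κ - 1) * ((d : ℝ) / n)) = (κ - 1) * (d * ((d : ℝ) / n)) := by ring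
      _ ≤ 4 * C ^ 2 * (d * ((d : ℝ) / n)) := mul_le_mul_of_nonneg_right this hdd
      _ = 4 * η := by rw [hη']; ring
  have ha : 0 ≤ (κ - 1) * ((d : ℝ) / n) := mul_nonneg (by linarith) (by positivity)
  have h3 : (1 + (κ - 1) * ((d : ℝ) / n)) ^ d ≤ Real.exp (4 * η) := by
    calc (1 + (κ - 1) * ((d : ℝ) / n)) ^ d ≤ Real.exp ((κ - 1) * ((d : ℝ) / n)) ^ d :=
          pow_le_pow_left₀ (by linarith) (by linarith [Real.add_one_le_exp ((κ - 1) * ((d : ℝ) / n))]) d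
      _ = Real.exp (d * ((κ - 1) * ((d : ℝ) / n))) := by rw [← Real.exp_nat_mul]
      _ ≤ _ := Real.exp_le_exp.2 h2
  unfold tensorErr
  have h4 : 2 * d * ((d : ℝ) / n) * (1 + (κ - 1) * ((d : ℝ) / n)) ^ d
      ≤ 2 * η * Real.exp (4 * η) := by
    refine mul_le_mul (by linarith) h3 (by positivity) (by positivity)
  linarith

/-- Since log C ≥ log 2, a vanishing ratio forces log(√n/d) → ∞. Eventually log C is below half of
that logarithm, so C d/√n is at most (√n/d)^(-1/2). -/
theorem tendsto_growth_ratio {d : ℕ → ℕ} {C : ℕ → ℝ} (hd_pos : ∀ n, 2 ≤ n → 1 ≤ d n)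
    (hd_lt : ∀ n, 2 ≤ n → (d n : ℝ) < √(n : ℝ)) (hC : ∀ n, 2 ≤ n → 2 ≤ C n)
    (hC_lim : Tendsto (fun n : ℕ => Real.log (C n) / Real.log (√(n : ℝ) / d n)) atTop (𝓝 0)) :
    Tendsto (fun n : ℕ => C n * d n / √(n : ℝ)) atTop (𝓝 0) := by
  have hr : ∀ n : ℕ, 2 ≤ n → 0 < Real.log (√(n : ℝ) / d n) := by
    intro n hn
    have h1 : (0 : ℝ) < d n := by exact_mod_cast hd_pos n hn
    exact Real.log_pos ((one_lt_div h1).2 (hd_lt n hn))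
  have hlog2 : 0 < Real.log 2 := Real.log_pos one_lt_two
  have hrt : Tendsto (fun n : ℕ => Real.log (√(n : ℝ) / d n)) atTop atTop := by
    rw [tendsto_atTop]
    intro A
    have hA : 0 < |A| + 1 := by positivity
    filter_upwards [hC_lim.eventually (gt_mem_nhds (show 0 < Real.log 2 / (|A| + 1) by positivity)),
      eventually_ge_atTop 2] with n hn hn2
    rw [div_lt_div_iff₀ (hr n hn2) hA] at hn
    have h1 : Real.log 2 ≤ Real.log (C n) := Real.log_le_log two_pos (hC n hn2)
    have h2 : Real.log 2 * (|A| + 1) < Real.log 2 * Real.log (√(n : ℝ) / d n) :=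
      lt_of_le_of_lt (mul_le_mul_of_nonneg_right h1 hA.le) hn
    have h3 := lt_of_mul_lt_mul_left h2 hlog2.le
    linarith [le_abs_self A]
  have hbound : ∀ᶠ n : ℕ in atTop, C n * d n / √(n : ℝ)
      ≤ Real.exp (-(1 / 2 * Real.log (√(n : ℝ) / d n))) := by
    filter_upwards [hC_lim.eventually (gt_mem_nhds (show (0 : ℝ) < 1 / 2 by norm_num)),
      eventually_ge_atTop 2] with n hn hn2
    rw [div_lt_iff₀ (hr n hn2)] at hn
    have hCpos : 0 < C n := by linarith [hC n hn2]
    have h1 : (0 : ℝ) < d n := by exact_mod_cast hd_pos n hn2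
    have h2 : (0 : ℝ) < √(n : ℝ) := h1.trans (hd_lt n hn2)
    have h3 : C n * d n / √(n : ℝ)
        = Real.exp (Real.log (C n) - Real.log (√(n : ℝ) / d n)) := by
      rw [Real.exp_sub, Real.exp_log hCpos, Real.exp_log (by positivity)]
      field_simp
    rw [h3]
    exact Real.exp_le_exp.2 (by linarith)
  have hlim : Tendsto (fun n : ℕ => Real.exp (-(1 / 2 * Real.log (√(n : ℝ) / d n)))) atTop (𝓝 0) :=
    Real.tendsto_exp_neg_atTop_nhds_zero.comp (hrt.const_mul_atTop (by norm_num))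
  refine tendsto_of_tendsto_of_tendsto_of_le_of_le' tendsto_const_nhds hlim ?_ hbound
  filter_upwards [eventually_ge_atTop 2] with n hn
  have : 0 < C n := by linarith [hC n hn]
  positivity

/-- The dimension is at least n, which turns tails exponential in the dimension into summable ones.
Induction with Pascal's rule; the edge case d = n - 1 is an equality. -/
theorem le_choose_of_pos_of_lt : ∀ {n d : ℕ}, 1 ≤ d → d < n → n ≤ n.choose d := by
  intro n
  induction n with
  | zero => intro d _ h; omega
  | succ m ih =>
    intro d hd hdn
    obtain ⟨e, rfl⟩ : ∃ e, d = e + 1 := ⟨d - 1, by omega⟩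
    rcases Nat.lt_or_ge (e + 1) m with h | h
    · rw [Nat.choose_succ_succ']
      have h1 := ih (d := e + 1) (by omega) h
      have h2 : 1 ≤ m.choose e := Nat.choose_pos (by omega)
      omega
    · have : e + 1 = m := by omega
      rw [this]
      simp

end Asymptotics

/-! ### Empirical spectral distributions and the first moment bound for tightness -/

section SpectralDistribution

open Matrix

variable {ι : Type*} [Fintype ι]

theorem trace_partialCov {p : ℕ} (x : Fin p → ι → ℝ) :
    (partialCov Finset.univ x).trace = (1 / (p : ℝ)) * ∑ j, ∑ i, x j i ^ 2 := by
  simp only [partialCov, trace_sum, trace_smul, trace_vecMulVec, dotProduct, smul_eq_mul,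
    Finset.mul_sum, sq]

variable [DecidableEq ι] {A : Matrix ι ι ℝ}

theorem esd_congr {B : Matrix ι ι ℝ} (h : A = B) (hA : A.IsHermitian) (hB : B.IsHermitian) :
    esd hA = esd hB := by
  subst h
  rfl

theorem measureReal_univ_esd (hA : A.IsHermitian) :
    (esd hA : Measure ℝ).real Set.univ = (Fintype.card ι : ℝ)⁻¹ * Fintype.card ι := by
  have h := integral_esd hA fun _ => (1 : ℝ)
  rw [integral_const] at h
  simpa using h

theorem isProbabilityMeasure_esd [Nonempty ι] (hA : A.IsHermitian) :
    IsProbabilityMeasure (esd hA : Measure ℝ) := by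
  rw [isProbabilityMeasure_iff_real, measureReal_univ_esd]
  exact inv_mul_cancel₀ (by exact_mod_cast Fintype.card_ne_zero)

theorem measureReal_univ_esd_le (hA : A.IsHermitian) : (esd hA : Measure ℝ).real Set.univ ≤ 1 := by
  rw [measureReal_univ_esd]
  exact inv_mul_le_one

theorem ae_esd (hA : A.IsHermitian) {q : ℝ → Prop} (h : ∀ j, q (hA.eigenvalues j)) :
    ∀ᵐ t ∂(esd hA : Measure ℝ), q t := by
  rw [ae_iff, coe_esd, Measure.smul_apply, Measure.finsetSum_apply]
  simp [h]

theorem eigenvalues_le_of_norm_le (hA : A.IsHermitian) {K : ℝ}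
    (hK : ‖Matrix.toEuclideanCLM (𝕜 := ℝ) A‖ ≤ K) (j : ι) : hA.eigenvalues j ≤ K := by
  have h1 : Matrix.toEuclideanCLM (𝕜 := ℝ) A (hA.eigenvectorBasis j)
      = hA.eigenvalues j • hA.eigenvectorBasis j := by
    apply (WithLp.equiv 2 (ι → ℝ)).injective
    exact hA.mulVec_eigenvectorBasis j
  have h2 := (Matrix.toEuclideanCLM (𝕜 := ℝ) A).le_opNorm (hA.eigenvectorBasis j)
  rw [h1, norm_smul, hA.eigenvectorBasis.orthonormal.1 j, mul_one, mul_one] at h2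
  exact (le_abs_self _).trans (h2.trans hK)

theorem stieltjesTransform_esd_partialCov {p : ℕ} {z : ℂ} (hz : 0 < z.im) (x : Fin p → ι → ℝ) :
    stieltjesTransform (esd (posSemidef_partialCov Finset.univ x).isHermitian) z
      = covStieltjes z x :=
  stieltjesTransform_esd hz (posSemidef_partialCov Finset.univ x)

/-- For t ≥ 0 one has t²/(k² + t²) ≤ t/(2k), so the trace alone controls the defect: tightness needs
no bound on the largest sample eigenvalue. -/
theorem re_one_sub_mul_covStieltjes_bounds [Nonempty ι] {p : ℕ} {k : ℝ} (hk : 0 < k)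
    (x : Fin p → ι → ℝ) :
    0 ≤ (1 - (k * Complex.I) * covStieltjes (k * Complex.I) x).re ∧
    (1 - (k * Complex.I) * covStieltjes (k * Complex.I) x).re
      ≤ (2 * k)⁻¹ * ((Fintype.card ι : ℝ)⁻¹ * ((1 / (p : ℝ)) * ∑ j, ∑ i, x j i ^ 2)) := by
  have hS := posSemidef_partialCov Finset.univ x
  have := isProbabilityMeasure_esd hS.isHermitian
  rw [← stieltjesTransform_esd_partialCov (by simpa using hk) x,
    re_one_sub_mul_stieltjesTransform _ hk, integral_esd, ← trace_partialCov,
    hS.isHermitian.trace_eq_sum_eigenvalues, smul_eq_mul]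
  have hN : (0 : ℝ) ≤ (Fintype.card ι : ℝ)⁻¹ := by positivity
  refine ⟨mul_nonneg hN (Finset.sum_nonneg fun j _ => by positivity), ?_⟩
  rw [mul_left_comm]
  refine mul_le_mul_of_nonneg_left ?_ hN
  rw [Finset.mul_sum]
  refine Finset.sum_le_sum fun j _ => ?_
  have ht := hS.eigenvalues_nonneg j
  set t := hS.isHermitian.eigenvalues j
  simp only [RCLike.ofReal_real_eq_id, id]
  rw [← div_eq_inv_mul, div_le_div_iff₀ (by positivity) (by positivity)]
  nlinarith [mul_nonneg ht (sq_nonneg (k - t))]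

variable {L : Measure (ι → ℝ)} [IsProbabilityMeasure L] {T : Matrix ι ι ℝ} {K ε : ℝ}

theorem re_one_sub_mul_meanCovStieltjes_bounds [Nonempty ι] (hL : ConcentratedColumn L T K ε)
    {p : ℕ} (hp : 0 < p) {k : ℝ} (hk : 0 < k) :
    0 ≤ (1 - (k * Complex.I) * meanCovStieltjes p L (k * Complex.I)).re ∧
    (1 - (k * Complex.I) * meanCovStieltjes p L (k * Complex.I)).re ≤ K / (2 * k) := by
  have hz : 0 < ((k : ℂ) * Complex.I).im := by simpa using hk
  set z : ℂ := k * Complex.I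
  set P := Measure.pi fun _ : Fin p => L with hP
  have hI : Integrable (fun x : Fin p → ι → ℝ => 1 - z * covStieltjes z x) P :=
    (integrable_const _).sub ((integrable_covStieltjes L hz).const_mul _)
  have h1 : (1 - z * meanCovStieltjes p L z).re
      = ∫ x : Fin p → ι → ℝ, (1 - z * covStieltjes z x).re ∂P := by
    have h := integral_re hI
    simp only [RCLike.re_eq_complex_re] at h
    rw [h, integral_sub (integrable_const _) ((integrable_covStieltjes L hz).const_mul _),
      integral_const_mul]
    simp [meanCovStieltjes]
  have hcoord : ∀ j : Fin p, ∀ i, Integrable (fun x : Fin p → ι → ℝ => x j i ^ 2) P ∧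
      ∫ x : Fin p → ι → ℝ, x j i ^ 2 ∂P = ∫ v, v i ^ 2 ∂L := by
    intro j i
    have hmp := measurePreserving_eval (fun _ : Fin p => L) j
    have hm : AEStronglyMeasurable (fun v : ι → ℝ => v i ^ 2)
        (P.map (Function.eval j)) :=
      ((measurable_pi_apply i).pow_const 2).aestronglyMeasurable
    refine ⟨hmp.integrable_comp_of_integrable (hL.sq_int i), ?_⟩
    have h := integral_map hmp.measurable.aemeasurable hm
    rw [hmp.map_eq] at h
    exact h.symm
  have hIs : Integrable (fun x : Fin p → ι → ℝ => ∑ j, ∑ i, x j i ^ 2) P :=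
    integrable_finsetSum _ fun j _ => integrable_finsetSum _ fun i _ => (hcoord j i).1
  rw [h1]
  refine ⟨integral_nonneg fun x => (re_one_sub_mul_covStieltjes_bounds hk x).1, ?_⟩
  refine (integral_mono hI.re (((hIs.const_mul _).const_mul _).const_mul _) fun x =>
    (re_one_sub_mul_covStieltjes_bounds hk x).2).trans ?_
  rw [integral_const_mul, integral_const_mul, integral_const_mul,
    integral_finsetSum _ fun j _ => integrable_finsetSum _ fun i _ => (hcoord j i).1]
  have h2 : ∀ j : Fin p, ∫ x : Fin p → ι → ℝ, ∑ i, x j i ^ 2 ∂P = ∑ i, ∫ v, v i ^ 2 ∂L := by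
    intro j
    rw [integral_finsetSum _ fun i _ => (hcoord j i).1]
    exact Finset.sum_congr rfl fun i _ => (hcoord j i).2
  rw [Finset.sum_congr rfl fun j _ => h2 j, Finset.sum_const, Finset.card_univ, Fintype.card_fin,
    nsmul_eq_mul]
  have hp' : (p : ℝ) ≠ 0 := by exact_mod_cast hp.ne'
  have hN : (0 : ℝ) < Fintype.card ι := by exact_mod_cast Fintype.card_pos
  have h3 : (1 / (p : ℝ)) * (p * ∑ i, ∫ v, v i ^ 2 ∂L) = ∑ i, ∫ v, v i ^ 2 ∂L := by
    field_simp
  rw [h3, div_eq_inv_mul]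
  refine mul_le_mul_of_nonneg_left ?_ (by positivity)
  rw [inv_mul_le_iff₀ hN, mul_comm]
  exact hL.sq_le

end SpectralDistribution

/-! ### Almost sure convergence from geometric tails, for any coupling -/

section BorelCantelli

theorem ae_tendsto_zero_of_geometric_tail {Ω E : Type*} [MeasurableSpace Ω] {P : Measure Ω}
    [IsFiniteMeasure P] [SeminormedAddCommGroup E] {f : ℕ → Ω → E} {c : ℝ}
    (h : ∀ δ > 0, ∃ q : ℝ, 0 ≤ q ∧ q < 1 ∧ ∀ᶠ n in atTop, P.real {ω | δ ≤ ‖f n ω‖} ≤ c * q ^ n) :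
    ∀ᵐ ω ∂P, Tendsto (fun n => f n ω) atTop (𝓝 0) := by
  have h1 : ∀ k : ℕ, ∀ᵐ ω ∂P, ∀ᶠ n in atTop, ¬ (1 / ((k : ℝ) + 1) ≤ ‖f n ω‖) := by
    intro k
    obtain ⟨q, hq0, hq1, hq⟩ := h (1 / ((k : ℝ) + 1)) (by positivity)
    have hs : Summable fun n => P.real {ω | 1 / ((k : ℝ) + 1) ≤ ‖f n ω‖} := by
      refine Summable.of_norm_bounded_eventually_nat
        ((summable_geometric_of_lt_one hq0 hq1).mul_left c) ?_
      filter_upwards [hq] with n hn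
      rwa [Real.norm_of_nonneg measureReal_nonneg]
    have ht := hs.tsum_ofReal_ne_top
    rw [tsum_congr fun n => ofReal_measureReal] at ht
    exact ae_eventually_notMem ht
  filter_upwards [ae_all_iff.2 h1] with ω hω
  rw [tendsto_zero_iff_norm_tendsto_zero, Metric.tendsto_atTop']
  intro ε hε
  obtain ⟨k, hk⟩ := exists_nat_one_div_lt hε
  obtain ⟨m, hm⟩ := eventually_atTop.1 (hω k)
  refine ⟨m, fun n hn => ?_⟩
  rw [dist_zero_right, norm_norm]
  exact (not_le.1 (hm n hn.le)).trans hk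

end BorelCantelli

/-! ### The generalized Marchenko–Pastur theorem for concentrated columns -/

section Convergence

open Matrix
open scoped Matrix.Norms.L2Operator

/-- The McDiarmid exponent is δ²y²N²/(32p); inserting N/p ≥ γ/2 and N ≥ n leaves a geometric rate in
n. -/
theorem exp_concentration_le {p N n : ℕ} {γ δ y : ℝ} (hp : 0 < p) (hN : 0 < N)
    (hγ : γ / 2 ≤ (N : ℝ) / p) (hn : n ≤ N) (hy : 0 < y) :
    4 * Real.exp (-(δ / 2) ^ 2 / (2 * p * (2 / (N * y)) ^ 2))
      ≤ 4 * Real.exp (-(δ ^ 2 * y ^ 2 * γ / 64)) ^ n := by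
  rw [← Real.exp_nat_mul]
  refine mul_le_mul_of_nonneg_left (Real.exp_le_exp.2 ?_) (by norm_num)
  have hp' : (0 : ℝ) < p := by exact_mod_cast hp
  have hN' : (0 : ℝ) < N := by exact_mod_cast hN
  have hn' : (n : ℝ) ≤ N := by exact_mod_cast hn
  have h1 : -(δ / 2) ^ 2 / (2 * p * (2 / (N * y)) ^ 2)
      = -(δ ^ 2 * y ^ 2 / 32 * ((N : ℝ) / p * N)) := by
    field_simp
    ring
  have h2 : γ / 2 * n ≤ (N : ℝ) / p * N :=
    mul_le_mul hγ hn' (Nat.cast_nonneg _) (by positivity)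
  have h3 : δ ^ 2 * y ^ 2 / 32 * (γ / 2 * n) ≤ δ ^ 2 * y ^ 2 / 32 * ((N : ℝ) / p * N) :=
    mul_le_mul_of_nonneg_left h2 (by positivity)
  rw [h1]
  linarith

theorem toFiniteMeasure_normalize_esd {ι : Type*} [Fintype ι] [DecidableEq ι] [Nonempty ι]
    {A : Matrix ι ι ℝ} (hA : A.IsHermitian) : (esd hA).normalize.toFiniteMeasure = esd hA := by
  have h := isProbabilityMeasure_esd hA
  exact congrArg ProbabilityMeasure.toFiniteMeasure
    (ProbabilityMeasure.toFiniteMeasure_normalize_eq_self ⟨(esd hA : Measure ℝ), h⟩)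

variable {ι : ℕ → Type*} [∀ n, Fintype (ι n)] {p : ℕ → ℕ} {γ : ℝ}

theorem eventually_nonempty_of_le_card (hcard : ∀ᶠ n in atTop, n ≤ Fintype.card (ι n)) :
    ∀ᶠ n in atTop, Nonempty (ι n) := by
  filter_upwards [hcard, eventually_ge_atTop 1] with n h1 h2
  exact Fintype.card_pos_iff.1 (by omega)

theorem eventually_pos_of_tendsto_ratio (hγ : 0 < γ)
    (hγ_lim : Tendsto (fun n => (Fintype.card (ι n) : ℝ) / p n) atTop (𝓝 γ)) :
    ∀ᶠ n in atTop, 0 < p n := by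
  filter_upwards [hγ_lim.eventually (lt_mem_nhds hγ)] with n hn
  rcases Nat.eq_zero_or_pos (p n) with h | h
  · simp [h] at hn
  · exact h

variable [∀ n, DecidableEq (ι n)] {L : ∀ n, Measure (ι n → ℝ)} [∀ n, IsProbabilityMeasure (L n)]
  {T : ∀ n, Matrix (ι n) (ι n) ℝ} {K : ℝ} {ε : ℕ → ℝ}
  {Ω : Type*} [MeasurableSpace Ω] {P : Measure Ω} [IsProbabilityMeasure P]
  {X : ∀ n, Ω → Fin (p n) → ι n → ℝ}

theorem ae_tendsto_covStieltjes_sub (hcard : ∀ᶠ n in atTop, n ≤ Fintype.card (ι n)) (hγ : 0 < γ)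
    (hγ_lim : Tendsto (fun n => (Fintype.card (ι n) : ℝ) / p n) atTop (𝓝 γ))
    (hX : ∀ᶠ n in atTop, HasLaw (X n) (Measure.pi fun _ => L n) P) {z : ℂ} (hz : 0 < z.im) :
    ∀ᵐ ω ∂P, Tendsto (fun n => covStieltjes z (X n ω) - meanCovStieltjes (p n) (L n) z)
      atTop (𝓝 0) := by
  refine ae_tendsto_zero_of_geometric_tail (c := 4) fun δ hδ => ?_
  refine ⟨Real.exp (-(δ ^ 2 * z.im ^ 2 * γ / 64)), (Real.exp_pos _).le,
    Real.exp_lt_one_iff.2 (neg_lt_zero.2 (by positivity)), ?_⟩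
  filter_upwards [hcard, eventually_nonempty_of_le_card hcard,
    eventually_pos_of_tendsto_ratio hγ hγ_lim, hX,
    hγ_lim.eventually (lt_mem_nhds (half_lt_self hγ))] with n hn hne hp hXn hr
  refine le_trans ?_ (exp_concentration_le hp (Fintype.card_pos_iff.2 hne) hr.le hn hz)
  refine le_trans (le_of_eq ?_) (measureReal_norm_covStieltjes_sub_ge_le (L n) hz hδ)
  have hset : MeasurableSet {x : Fin (p n) → ι n → ℝ |
      δ ≤ ‖covStieltjes z x - meanCovStieltjes (p n) (L n) z‖} :=
    (isClosed_le continuous_const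
      ((continuous_covStieltjes hz).sub continuous_const).norm).measurableSet
  exact hXn.measureReal_eq hset

/-- Almost sure convergence together with the uniform bound 2 / Im z gives convergence in mean. -/
theorem tendsto_integral_norm_covStieltjes_sub
    (hcard : ∀ᶠ n in atTop, n ≤ Fintype.card (ι n)) (hγ : 0 < γ)
    (hγ_lim : Tendsto (fun n => (Fintype.card (ι n) : ℝ) / p n) atTop (𝓝 γ))
    (hX : ∀ᶠ n in atTop, HasLaw (X n) (Measure.pi fun _ => L n) P) {z : ℂ} (hz : 0 < z.im) :
    Tendsto (fun n => ∫ x : Fin (p n) → ι n → ℝ, ‖covStieltjes z x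
      - meanCovStieltjes (p n) (L n) z‖ ∂(Measure.pi fun _ => L n)) atTop (𝓝 0) := by
  have hc : ∀ n, Continuous fun x : Fin (p n) → ι n → ℝ =>
      ‖covStieltjes z x - meanCovStieltjes (p n) (L n) z‖ := fun n =>
    ((continuous_covStieltjes hz).sub continuous_const).norm
  have h1 : Tendsto (fun n => ∫ ω, ‖covStieltjes z (X n ω)
      - meanCovStieltjes (p n) (L n) z‖ ∂P) atTop (𝓝 (∫ _, (0 : ℝ) ∂P)) := by
    refine tendsto_integral_filter_of_dominated_convergence (fun _ => 2 * (1 / z.im)) ?_ ?_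
      (integrable_const _) ?_
    · filter_upwards [hX] with n hXn
      exact ((hc n).measurable.comp_aemeasurable hXn.aemeasurable).aestronglyMeasurable
    · filter_upwards [eventually_nonempty_of_le_card hcard] with n hne
      refine Eventually.of_forall fun ω => ?_
      rw [norm_norm, two_mul]
      exact (norm_sub_le _ _).trans
        (add_le_add (norm_covStieltjes_le hz _) (norm_meanCovStieltjes_le (L n) hz))
    · filter_upwards [ae_tendsto_covStieltjes_sub hcard hγ hγ_lim hX hz] with ω hω
      exact tendsto_zero_iff_norm_tendsto_zero.1 hω
  rw [integral_zero] at h1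
  refine h1.congr' ?_
  filter_upwards [hX] with n hXn
  exact hXn.integral_comp (hc n).aestronglyMeasurable

theorem tendsto_meanCovStieltjes_sub (hT : ∀ n, (T n).PosSemidef)
    (hL : ∀ᶠ n in atTop, ConcentratedColumn (L n) (T n) K (ε n)) (hε : Tendsto ε atTop (𝓝 0))
    (hcard : ∀ᶠ n in atTop, n ≤ Fintype.card (ι n)) (hγ : 0 < γ)
    (hγ_lim : Tendsto (fun n => (Fintype.card (ι n) : ℝ) / p n) atTop (𝓝 γ))
    (hX : ∀ᶠ n in atTop, HasLaw (X n) (Measure.pi fun _ => L n) P) {z : ℂ} (hz : 0 < z.im) :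
    Tendsto (fun n => meanCovStieltjes (p n) (L n) z
      - ∫ t : ℝ, 1 / (z - meanCompanion (p n) (L n) z * (t : ℂ))
        ∂(esd (hT n).isHermitian : Measure ℝ)) atTop (𝓝 0) := by
  have hN : Tendsto (fun n => (Fintype.card (ι n) : ℝ)) atTop atTop :=
    tendsto_atTop_mono' _ (hcard.mono fun n hn => Nat.cast_le.2 hn) tendsto_natCast_atTop_atTop
  have hlim : Tendsto (fun n => ‖z‖ / z.im * (ε n * (1 / z.im ^ 2)
        + K / z.im ^ 2 / Fintype.card (ι n))
      + K / z.im ^ 2 * (Fintype.card (ι n) / p n * ‖z‖)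
        * ∫ x : Fin (p n) → ι n → ℝ, ‖covStieltjes z x - meanCovStieltjes (p n) (L n) z‖
          ∂(Measure.pi fun _ => L n)) atTop
      (𝓝 (‖z‖ / z.im * (0 * (1 / z.im ^ 2) + 0) + K / z.im ^ 2 * (γ * ‖z‖) * 0)) :=
    (((hε.mul_const _).add (tendsto_const_nhds.div_atTop hN)).const_mul _).add
      (((hγ_lim.mul_const _).const_mul _).mul
        (tendsto_integral_norm_covStieltjes_sub hcard hγ hγ_lim hX hz))
  rw [zero_mul, add_zero, mul_zero, mul_zero, add_zero] at hlim
  refine squeeze_zero_norm' ?_ hlim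
  filter_upwards [eventually_nonempty_of_le_card hcard,
    eventually_pos_of_tendsto_ratio hγ hγ_lim, hL] with n hne hp hLn
  exact norm_meanCovStieltjes_sub_le hLn hp hz

/-- The generalized Marchenko–Pastur theorem for columns with concentrated quadratic forms. -/
theorem exists_tendsto_esd_of_concentratedColumn (hT : ∀ n, (T n).PosSemidef)
    (hTK : ∀ n, ‖Matrix.toEuclideanCLM (𝕜 := ℝ) (T n)‖ ≤ K)
    (hL : ∀ᶠ n in atTop, ConcentratedColumn (L n) (T n) K (ε n)) (hε : Tendsto ε atTop (𝓝 0))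
    (hcard : ∀ᶠ n in atTop, n ≤ Fintype.card (ι n)) (hγ : 0 < γ)
    (hγ_lim : Tendsto (fun n => (Fintype.card (ι n) : ℝ) / p n) atTop (𝓝 γ))
    {H : ProbabilityMeasure ℝ}
    (hT_lim : Tendsto (fun n => esd (hT n).isHermitian) atTop (𝓝 H.toFiniteMeasure))
    (hX : ∀ᶠ n in atTop, HasLaw (X n) (Measure.pi fun _ => L n) P) :
    ∃ μ : ProbabilityMeasure ℝ,
      (∀ᵐ ω ∂P, Tendsto (fun n => esd (posSemidef_partialCov Finset.univ (X n ω)).isHermitian) atTop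
        (𝓝 μ.toFiniteMeasure)) ∧
      ∀ z : ℂ, 0 < z.im →
        stieltjesTransform μ z = ∫ t : ℝ, 1 / (z - (1 - γ + γ * z * stieltjesTransform μ z) * t)
          ∂(H : Measure ℝ) ∧
        IsCompanionSolution H γ z (1 - γ + γ * z * stieltjesTransform μ z) := by
  set M : ℕ → ℂ → ℂ := fun n z => meanCovStieltjes (p n) (L n) z
  set γs : ℕ → ℝ := fun n => (Fintype.card (ι n) : ℝ) / p n
  have hne := eventually_nonempty_of_le_card hcard
  have hp := eventually_pos_of_tendsto_ratio hγ hγ_lim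
  have hcomp : ∀ n z, (1 - γs n + γs n * z * M n z : ℂ) = meanCompanion (p n) (L n) z := by
    intro n z
    simp [γs, M, meanCompanion]
  have hHs : ∀ n, ∀ᵐ t ∂(esd (hT n).isHermitian : Measure ℝ), 0 ≤ t ∧ t ≤ K := fun n =>
    ae_esd _ fun j => ⟨(hT n).eigenvalues_nonneg j, eigenvalues_le_of_norm_le _ (hTK n) j⟩
  have hmass : ∀ n, (esd (hT n).isHermitian : Measure ℝ).real Set.univ ≤ 1 := fun n =>
    measureReal_univ_esd_le _
  have him : ∀ z : ℂ, 0 < z.im → ∀ᶠ n in atTop, (1 - γs n + γs n * z * M n z : ℂ).im ≤ 0 := by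
    intro z hz
    filter_upwards [hne, hp] with n hn hpn
    rw [hcomp]
    exact im_meanCompanion_nonpos (L n) hpn hz
  have himd : ∀ z : ℂ, 0 < z.im →
      ∀ᶠ n in atTop, ((1 - γs n + γs n * z * M n z : ℂ) / z).im ≤ 0 := by
    intro z hz
    filter_upwards [hne, hp] with n hn hpn
    rw [hcomp]
    exact im_meanCompanion_div_nonpos (L n) hpn hz
  have heq : ∀ z : ℂ, 0 < z.im → Tendsto (fun n => M n z
      - ∫ t : ℝ, 1 / (z - (1 - γs n + γs n * z * M n z) * (t : ℂ))
        ∂(esd (hT n).isHermitian : Measure ℝ)) atTop (𝓝 0) := by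
    intro z hz
    simp_rw [hcomp]
    exact tendsto_meanCovStieltjes_sub hT hL hε hcard hγ hγ_lim hX hz
  have hex : ∀ z : ℂ, ∃ m, 0 < z.im → Tendsto (fun n => M n z) atTop (𝓝 m) := by
    intro z
    by_cases hz : 0 < z.im
    · obtain ⟨m, hm⟩ := exists_tendsto_of_approx_solution (M := fun n => M n z) hT_lim hHs hmass hz
        hγ hγ_lim (hne.mono fun n hn => norm_meanCovStieltjes_le (L n) hz) (him z hz) (himd z hz)
        (heq z hz)
      exact ⟨m, fun _ => hm⟩
    · exact ⟨0, fun h => absurd h hz⟩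
  choose m hm using hex
  -- No mass escapes: the expected trace is at most KN, so the defect at height k + 1 is at most
  -- K/(2(k + 1)), uniformly in n, and this survives the limit.
  have hmk : Tendsto (fun k : ℕ => (1 - (((k : ℝ) + 1 : ℝ) * Complex.I)
      * m (((k : ℝ) + 1 : ℝ) * Complex.I)).re) atTop (𝓝 0) := by
    have hb : ∀ k : ℕ, 0 ≤ (1 - (((k : ℝ) + 1 : ℝ) * Complex.I)
          * m (((k : ℝ) + 1 : ℝ) * Complex.I)).re ∧
        (1 - (((k : ℝ) + 1 : ℝ) * Complex.I) * m (((k : ℝ) + 1 : ℝ) * Complex.I)).re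
          ≤ K / 2 * (1 / ((k : ℝ) + 1)) := by
      intro k
      have hk : (0 : ℝ) < (k : ℝ) + 1 := by positivity
      set c : ℝ := (k : ℝ) + 1
      have ht : Tendsto (fun n => (1 - (c * Complex.I) * M n (c * Complex.I)).re) atTop
          (𝓝 (1 - (c * Complex.I) * m (c * Complex.I)).re) :=
        (Complex.continuous_re.tendsto _).comp
          (tendsto_const_nhds.sub ((hm (c * Complex.I) (by simpa using hk)).const_mul _))
      have hbn : ∀ᶠ n in atTop, 0 ≤ (1 - (c * Complex.I) * M n (c * Complex.I)).re ∧
          (1 - (c * Complex.I) * M n (c * Complex.I)).re ≤ K / (2 * c) := by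
        filter_upwards [hne, hp, hL] with n hn hpn hLn
        exact re_one_sub_mul_meanCovStieltjes_bounds hLn hpn hk
      refine ⟨ge_of_tendsto ht (hbn.mono fun n h => h.1), ?_⟩
      refine (le_of_tendsto ht (hbn.mono fun n h => h.2)).trans (le_of_eq ?_)
      field_simp
    refine squeeze_zero (fun k => (hb k).1) (fun k => (hb k).2) ?_
    simpa using (tendsto_one_div_add_atTop_nhds_zero_nat (𝕜 := ℝ)).const_mul (K / 2)
  have hpos : ∀ q r : ℚ, 0 < r → 0 < (((q : ℝ) : ℂ) + ((r : ℝ) : ℂ) * Complex.I).im := by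
    intro q r hr
    simpa using hr
  -- Only countably many points z are involved, so one null set serves all of them.
  have hrat : ∀ᵐ ω ∂P, ∀ q r : ℚ, 0 < r → Tendsto
      (fun n => covStieltjes ((q : ℝ) + (r : ℝ) * Complex.I) (X n ω)) atTop
      (𝓝 (m ((q : ℝ) + (r : ℝ) * Complex.I))) := by
    refine ae_all_iff.2 fun q => ae_all_iff.2 fun r => ?_
    by_cases hr : 0 < r
    · filter_upwards [ae_tendsto_covStieltjes_sub hcard hγ hγ_lim hX (hpos q r hr)] with ω hω _
      simpa only [M, sub_add_cancel, zero_add] using hω.add (hm _ (hpos q r hr))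
    · exact Eventually.of_forall fun ω h => absurd h hr
  have hconv : ∀ ω, (∀ q r : ℚ, 0 < r → Tendsto
      (fun n => covStieltjes ((q : ℝ) + (r : ℝ) * Complex.I) (X n ω)) atTop
      (𝓝 (m ((q : ℝ) + (r : ℝ) * Complex.I)))) → ∃ μ : ProbabilityMeasure ℝ,
      Tendsto (fun n => esd (posSemidef_partialCov Finset.univ (X n ω)).isHermitian) atTop
        (𝓝 μ.toFiniteMeasure) ∧ ∀ q r : ℚ, 0 < r →
        stieltjesTransform μ ((q : ℝ) + (r : ℝ) * Complex.I)
          = m ((q : ℝ) + (r : ℝ) * Complex.I) := by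
    intro ω hω
    have hnorm : ∀ᶠ n in atTop,
        (esd (posSemidef_partialCov Finset.univ (X n ω)).isHermitian).normalize.toFiniteMeasure
          = esd (posSemidef_partialCov Finset.univ (X n ω)).isHermitian := by
      filter_upwards [hne] with n hn using toFiniteMeasure_normalize_esd _
    obtain ⟨μ, hμ, hμm⟩ := exists_tendsto_of_tendsto_stieltjesTransform
      (μs := fun n => (esd (posSemidef_partialCov Finset.univ (X n ω)).isHermitian).normalize)
      (m := m) (fun q r hr => (hω q r hr).congr' (by
        filter_upwards [hnorm] with n hn
        rw [← stieltjesTransform_esd_partialCov (hpos q r hr)]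
        exact congrArg (fun ν : FiniteMeasure ℝ => stieltjesTransform ν _) hn.symm)) hmk
    refine ⟨μ, ?_, hμm⟩
    exact ((ProbabilityMeasure.toFiniteMeasure_isEmbedding ℝ).tendsto_nhds_iff.1 hμ).congr' hnorm
  -- A single good outcome defines μ. Any other good outcome yields a measure with the same
  -- deterministic transform, hence the same measure.
  obtain ⟨ω₀, hω₀⟩ := hrat.exists
  obtain ⟨μ, -, hμm⟩ := hconv ω₀ hω₀
  have hae : ∀ᵐ ω ∂P, Tendsto
      (fun n => esd (posSemidef_partialCov Finset.univ (X n ω)).isHermitian) atTop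
      (𝓝 μ.toFiniteMeasure) := by
    filter_upwards [hrat] with ω hω
    obtain ⟨μ', hμ', hμm'⟩ := hconv ω hω
    have : μ' = μ := ProbabilityMeasure.toMeasure_injective
      (measure_eq_of_stieltjesTransform_eq fun q r hr => (hμm' q r hr).trans (hμm q r hr).symm)
    rwa [← this]
  refine ⟨μ, hae, fun z hz => ?_⟩
  -- For an arbitrary z, one outcome with both weak convergence and concentration at z identifies
  -- the limit of the mean transforms with the transform of μ at z.
  obtain ⟨ω, hω, hω'⟩ := (hae.and (ae_tendsto_covStieltjes_sub hcard hγ hγ_lim hX hz)).exists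
  have h1 := tendsto_stieltjesTransform hω hz
  simp_rw [stieltjesTransform_esd_partialCov hz] at h1
  have h2 : Tendsto (fun n => M n z) atTop (𝓝 (stieltjesTransform μ z)) := by
    simpa using h1.sub hω'
  exact isCompanionSolution_of_tendsto (M := fun n => M n z) hT_lim hHs hmass hz hγ_lim (him z hz)
    (himd z hz) (heq z hz) tendsto_id h2

end Convergence

/-! ### Application to the random tensor model -/

theorem tendsto_exp_error {η : ℕ → ℝ} (hη : Tendsto η atTop (𝓝 0)) :
    Tendsto (fun n => (Real.exp (4 * η n) - 1) + 2 * η n * Real.exp (4 * η n)) atTop (𝓝 0) := by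
  have h : Continuous fun x : ℝ => (Real.exp (4 * x) - 1) + 2 * x * Real.exp (4 * x) := by fun_prop
  simpa [Function.comp_def] using (h.tendsto 0).comp hη

theorem mainTheorem2
    (d p : ℕ → ℕ) (C : ℕ → ℝ) (γ : ℝ)
    -- `ν n` is the law of `x_1 = x(n)`
    (ν : ℕ → Measure ℝ) [∀ n, IsProbabilityMeasure (ν n)]
    (hd_pos : ∀ n, 2 ≤ n → 1 ≤ d n)
    (hd_lt : ∀ n, 2 ≤ n → (d n : ℝ) < √(n : ℝ))
    (hν_symm : ∀ n, 2 ≤ n → (ν n).map (fun x => -x) = ν n)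
    (hν_var : ∀ n, 2 ≤ n → ∫ x, x ^ 2 ∂(ν n) = 1)
    (hC : ∀ n, 2 ≤ n → 2 ≤ C n)
    (hν_mom : ∀ n, 2 ≤ n → ∀ k : ℕ, 1 ≤ k →
      Integrable (fun x : ℝ => x ^ (2 * k)) (ν n) ∧
        ∫ x, x ^ (2 * k) ∂(ν n) ≤ (C n * k) ^ k)
    (hC_lim : Tendsto (fun n : ℕ => Real.log (C n) / Real.log (√(n : ℝ) / d n)) atTop (𝓝 0))
    -- the asymptotic regime
    (hγ : 0 < γ)
    (hγ_lim : Tendsto (fun n : ℕ => (n.choose (d n) : ℝ) / (p n : ℝ)) atTop (𝓝 γ))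
    -- the deterministic matrices `T(n)`, bounded in `ℓ²` operator norm
    (T : (n : ℕ) → Matrix (TensorIndex n (d n)) (TensorIndex n (d n)) ℝ)
    (hT : ∀ n, (T n).PosSemidef)
    (hT_bdd : BddAbove (Set.range fun n => ‖Matrix.toEuclideanCLM (𝕜 := ℝ) (T n)‖))
    (H : ProbabilityMeasure ℝ)
    (hT_lim : Tendsto (fun n => esd (hT n).isHermitian) atTop (𝓝 H.toFiniteMeasure))
    -- the random matrices, with an arbitrary coupling between different values of `n`
    {Ω : Type*} [MeasurableSpace Ω] (P : Measure Ω) [IsProbabilityMeasure P]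
    (Z : (n : ℕ) → Ω → Matrix (TensorIndex n (d n)) (Fin (p n)) ℝ)
    (hZ_law : ∀ n, 2 ≤ n → ∀ j : Fin (p n),
      HasLaw (fun ω i => Z n ω i j) (colouredTensorLaw (ν n) (T n)) P)
    (hZ_indep : ∀ n, 2 ≤ n → iIndepFun (fun (j : Fin (p n)) ω i => Z n ω i j) P) :
    ∃ μ : ProbabilityMeasure ℝ,
      (∀ᵐ ω ∂P, Tendsto (fun n => esd (isHermitian_sampleCov (Z n ω))) atTop
        (𝓝 μ.toFiniteMeasure)) ∧
      ∀ z : ℂ, 0 < z.im →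
        (∀ᵐ t : ℝ ∂(H : Measure ℝ),
          z - t * (1 - γ + γ * z * stieltjesTransform μ z) ≠ 0) ∧
        Integrable (fun t : ℝ => 1 / (z - t * (1 - γ + γ * z * stieltjesTransform μ z)))
          (H : Measure ℝ) ∧
        stieltjesTransform μ z =
          ∫ t : ℝ, 1 / (z - t * (1 - γ + γ * z * stieltjesTransform μ z)) ∂(H : Measure ℝ) := by
  obtain ⟨K, hK⟩ := hT_bdd
  have hTK : ∀ n, ‖Matrix.toEuclideanCLM (𝕜 := ℝ) (T n)‖ ≤ K := fun n => hK ⟨n, rfl⟩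
  have hK0 : 0 ≤ K := (norm_nonneg _).trans (hTK 0)
  have hdn : ∀ n, 2 ≤ n → d n < n := by
    intro n hn
    have h1 : √(n : ℝ) ≤ n := by
      rw [Real.sqrt_le_left (Nat.cast_nonneg _)]
      exact_mod_cast Nat.le_self_pow two_ne_zero n
    exact_mod_cast (hd_lt n hn).trans_le h1
  have hunit : ∀ n, 2 ≤ n → IsSymmUnit (ν n) := fun n hn =>
    ⟨hν_symm n hn, hν_var n hn, (hν_mom n hn 2 one_le_two).1⟩
  have hε : Tendsto (fun n => 2 * K * √(tensorErr n (d n) (∫ x, x ^ 4 ∂(ν n)))) atTop (𝓝 0) := by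
    have h1 := (tendsto_growth_ratio hd_pos hd_lt hC hC_lim).pow 2
    rw [zero_pow two_ne_zero] at h1
    have h2 : Tendsto (fun n => tensorErr n (d n) (∫ x, x ^ 4 ∂(ν n))) atTop (𝓝 0) := by
      refine squeeze_zero' ?_ ?_ (tendsto_exp_error h1)
      · filter_upwards [eventually_ge_atTop 2] with n hn
        exact tensorErr_nonneg (hunit n hn).one_le_fourth
      · filter_upwards [eventually_ge_atTop 2] with n hn
        -- The case k = 2 bounds the fourth moment by (2C)².
        have h4 := (hν_mom n hn 2 one_le_two).2
        norm_num at h4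
        exact tensorErr_le (hunit n hn).one_le_fourth h4 (by linarith [hC n hn]) rfl
    have h3 := ((Real.continuous_sqrt.tendsto 0).comp h2).const_mul (2 * K)
    rw [Real.sqrt_zero, mul_zero] at h3
    exact h3
  have hcard : ∀ᶠ n in atTop, n ≤ Fintype.card (TensorIndex n (d n)) := by
    filter_upwards [eventually_ge_atTop 2] with n hn
    rw [card_tensorIndex]
    exact le_choose_of_pos_of_lt (hd_pos n hn) (hdn n hn)
  -- For each n separately, independence and the column laws fix the joint law of the columns;
  -- nothing about the coupling between different n is involved.
  have hX : ∀ᶠ n in atTop, HasLaw (fun ω (j : Fin (p n)) i => Z n ω i j)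
      (Measure.pi fun _ => colouredTensorLaw (ν n) (T n)) P := by
    filter_upwards [eventually_ge_atTop 2] with n hn
    exact (hZ_indep n hn).hasLaw_pi (hZ_law n hn)
  obtain ⟨μ, hμ, hμz⟩ := exists_tendsto_esd_of_concentratedColumn (p := p)
    (L := fun n => colouredTensorLaw (ν n) (T n)) hT hTK
    (by
      filter_upwards [eventually_ge_atTop 2] with n hn
      exact concentratedColumn_colouredTensorLaw (hunit n hn) (by omega) (hdn n hn).le (hT n)
        (norm_complexify_le hK0 (hTK n)))
    hε hcard hγ (by simpa only [card_tensorIndex] using hγ_lim) hT_lim hX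
  have hH0 : ∀ᵐ t ∂(H : Measure ℝ), 0 ≤ t :=
    ae_nonneg_of_tendsto hT_lim fun n => ae_esd _ (hT n).eigenvalues_nonneg
  refine ⟨μ, ?_, fun z hz => ?_⟩
  · filter_upwards [hμ] with ω hω
    exact hω.congr fun n => (esd_congr (sampleCov_eq_partialCov _) _ _).symm
  · obtain ⟨h1, h2⟩ := hμz z hz
    simp_rw [mul_comm (_ : ℂ) (1 - γ + γ * z * stieltjesTransform μ z)]
    refine ⟨?_, integrable_one_div_sub_mul hH0 hz h2.im_nonpos, h1⟩
    filter_upwards [hH0] with t ht using sub_mul_eigenvalue_ne_zero hz h2.im_nonpos ht
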